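/- Conventions. The Kauffman bracket of a link diagram $D$ with $n$ crossings is $\langle D\rangle=\sum_s A^{\sum_i s(i)}(-A^{-2}-A^2)^{|sD|-1}$, the sum being over all states $s:\{c_1,\dots,c_n\}\to\{-1,1\}$, where $|sD|$ is the number of circuits left after splitting every crossing according to $s$ (positively for $+1$, negatively for $-1$). The Jones polynomial of an oriented link with diagram $D$ of writhe $w(D)$ is $J=(-A^{-3})^{w(D)}\langle D\rangle$ with $t^{-1/2}=A^2$. The breadth $B(p)$ of a Laurent polynomial $p$ is its maximal minus its minimal exponent (for $J$: exponents of $t$). Let $s_+$ and $s_-$ be the states that are constantly $+1$ and $-1$. A diagram $D$ with $n\ge 1$ crossings is adequate if $|s_+D|>|sD|$ for every state $s$ with $\sum_i s(i)=n-2$, and $|s_-D|>|sD|$ for every state $s$ with $\sum_i s(i)=-n+2$. A knot is adequate if it has an adequate diagram. For a diagram $D$ and $r\in\mathbb N$, the $r$-parallel $D^r$ is the diagram obtained by replacing $D$ by $r$ parallel copies in the plane (blackboard framing), all with the orientation and the over/under information of $D$. For a knot diagram $E$, the $r$-cable $(E;r)$ is the $r$-parallel with framing $0$, i.e. $E^r$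 with $-w(E)$ full twists added to the $r$ parallel strands. (For $r=0$ both are the empty diagram, whose bracket is taken to be $1$.) Lemma. Let $K\subset\mathbb S^3$ be an oriented adequate knot and let $r\in\mathbb N$. Let $J(K^r)$ be the Jones polynomial of $D^r$, where $D$ is any adequate diagram of $K$, and let $J(K;r)$ be the Jones polynomial of $(E;r)$, where $E$ is any diagram of $K$. Then $$B(J(K;r))\ \ge\ B(J(K^r)).$$ -/

import Mathlib

namespace SlicedLink

/-! ### Link diagrams

A link diagram in the plane, in general position with respect to the height function, is read from
bottom to top as a word of slices.  A slice is one local maximum, local minimum or crossing;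
all other strands of the slice are vertical.  The strands at a fixed height are numbered
`0, 1, 2, …` from left to right. -/

/-- The elementary pieces of an oriented link diagram.
* `cup b`: a local minimum, creating two neighbouring strands; the left one of them is
  directed upwards if `b = true` and downwards if `b = false` (and the right one oppositely).
* `cap`: a local maximum, joining two neighbouring strands.
* `cross s`: a crossing of two neighbouring strands; the strand running from the lower left to
  the upper right passes over the other one if `s = true`, and under it if `s = false`. -/
inductive Piece where
  | cup (b : Bool)
  | cap
  | cross (s : Bool)
  deriving DecidableEq

namespace Piece

/-- The number of strands entering a piece from below. -/
def dom : Piece → ℕ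
  | cup _ => 0
  | cap => 2
  | cross _ => 2

/-- The number of strands leaving a piece at its top. -/
def cod : Piece → ℕ
  | cup _ => 2
  | cap => 0
  | cross _ => 2

/-- Is the piece a crossing? -/
def isCross : Piece → Bool
  | cross _ => true
  | _ => false

end Piece

/-- A piece together with the number of strands to the left of it. -/
structure Slice where
  piece : Piece
  pos : ℕ
  deriving DecidableEq

/-- The slices of a diagram, from bottom to top. -/
abbrev Word := List Slice

/-- Given the directions (`true` = upwards) of the strands below a slice, the directions of the
strands above it; `none` if the slice does not fit there, that is, if there are too few strands
or a cap would join two strands that are both directed upwards or both downwards. -/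
def step : Slice → List Bool → Option (List Bool)
  | ⟨.cup b, i⟩, L => if i ≤ L.length then some (L.take i ++ b :: (!b) :: L.drop i) else none
  | ⟨.cap, i⟩, L =>
    match L.drop i with
    | x :: y :: R => if x ≠ y then some (L.take i ++ R) else none
    | _ => none
  | ⟨.cross _, i⟩, L =>
    match L.drop i with
    | x :: y :: R => some (L.take i ++ y :: x :: R)
    | _ => none

/-- The directions of the strands at the top of a word, given those at its bottom. -/
def run : Word → List Bool → Option (List Bool)
  | [], L => some L
  | g :: w, L => (step g L).bind (run w)

/-- The word is an oriented link diagram: all slices fit, and there are no loose ends. -/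
def IsLinkDiagram (w : Word) : Prop := run w [] = some []

/-- The sign of a crossing `cross s` whose lower strands have the directions `x` and `y`. -/
def crossSign (s x y : Bool) : ℤ := if (x == y) = s then 1 else -1

/-- The sum of the signs of the crossings of a word, given the directions of the strands at its
bottom. -/
def writheFrom : Word → List Bool → ℤ
  | [], _ => 0
  | g :: w, L =>
    (match g.piece, L.drop g.pos with
      | .cross s, x :: y :: _ => crossSign s x y
      | _, _ => 0) +
    writheFrom w ((step g L).getD [])

/-- The writhe of an oriented link diagram. -/
def writhe (w : Word) : ℤ := writheFrom w []

/-- The number of crossings. -/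
def crossings (w : Word) : ℕ := w.countP fun g => g.piece.isCross

/-! ### Circuits and components -/

/-- Pieces of unoriented flat curves; `swap` is a transversal intersection. -/
inductive Flat where
  | cup (i : ℕ)
  | cap (i : ℕ)
  | swap (i : ℕ)

/-- The number of closed curves completed by a flat word.  While sweeping from bottom to top, every
strand carries a label, and two strands have the same label if and only if they are connected by
the part of the curves already swept; `n` is a label that is not yet in use.  A cup creates two
strands with the new label.  A cap completes a closed curve if the two strands have equal labels,
and otherwise merges the two labels. -/
def circuitsFrom : List Flat → ℕ → List ℕ → ℕ
  | [], _, _ => 0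
  | .cup i :: w, n, L => circuitsFrom w (n + 1) (L.take i ++ n :: n :: L.drop i)
  | .cap i :: w, n, L =>
    match L.drop i with
    | x :: y :: R =>
      (if x = y then 1 else 0) +
        circuitsFrom w n ((L.take i ++ R).map fun z => if z = y then x else z)
    | _ => 0
  | .swap i :: w, n, L =>
    match L.drop i with
    | x :: y :: R => circuitsFrom w n (L.take i ++ y :: x :: R)
    | _ => 0

/-- The number of closed curves in a flat word. -/
def circuits (w : List Flat) : ℕ := circuitsFrom w 0 []

/-- The projection of a diagram, forgetting over and under. -/
def shadow (w : Word) : List Flat :=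
  w.map fun g => match g.piece with
    | .cup _ => .cup g.pos
    | .cap => .cap g.pos
    | .cross _ => .swap g.pos

/-- The number of components of a link diagram. -/
def components (w : Word) : ℕ := circuits (shadow w)

/-- A state of a diagram: a choice of a splitting at every crossing (numbered from bottom to top),
where `true` is the positive and `false` the negative splitting. -/
abbrev State (w : Word) := Fin (crossings w) → Bool

/-- The effect of a list of splittings on a diagram.  The positive splitting joins the two regions
that the over strand sweeps when it is turned counterclockwise: at `cross true` these are the regions
below and above the crossing, which leaves two vertical strands, and at `cross false` those
to the left and to the right of it, which leaves a cap below a cup. -/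
def resolve : Word → List Bool → List Flat
  | [], _ => []
  | ⟨.cup _, i⟩ :: w, s => .cup i :: resolve w s
  | ⟨.cap, i⟩ :: w, s => .cap i :: resolve w s
  | ⟨.cross a, i⟩ :: w, b :: s =>
    (if b = a then [] else [.cap i, .cup i]) ++ resolve w s
  | ⟨.cross _, _⟩ :: w, [] => resolve w []

/-- The number `|sD|` of circuits produced by a state. -/
def stateCircuits (w : Word) (s : State w) : ℕ := circuits (resolve w (List.ofFn s))

/-- The sum of the values `±1` of a state. -/
def stateSum (w : Word) (s : State w) : ℤ := ∑ c, if s c then 1 else -1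

/-- `|s₊D| > |sD|` for all states `s` that are negative at exactly one crossing. -/
def PlusAdequate (w : Word) : Prop :=
  ∀ s : State w, stateSum w s = crossings w - 2 →
    stateCircuits w s < stateCircuits w fun _ => true

/-- `|s₋D| > |sD|` for all states `s` that are positive at exactly one crossing. -/
def MinusAdequate (w : Word) : Prop :=
  ∀ s : State w, stateSum w s = -crossings w + 2 →
    stateCircuits w s < stateCircuits w fun _ => false

/-- A diagram with at least one crossing that is both plus-adequate and minus-adequate. -/
def Adequate (w : Word) : Prop := 1 ≤ crossings w ∧ PlusAdequate w ∧ MinusAdequate w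

/-! ### The Jones polynomial -/

open LaurentPolynomial in
/-- The Kauffman bracket, a Laurent polynomial in `A = T 1`. -/
noncomputable def bracket (w : Word) : LaurentPolynomial ℤ :=
  ∑ s : State w, T (stateSum w s) * (-T (-2) - T 2) ^ (stateCircuits w s - 1)

open LaurentPolynomial in
/-- The Jones polynomial `(-A⁻³) ^ writhe * bracket`, rewritten in the variable `t` with
`t ^ (-1/2) = A ^ 2`.  It is an element of the group ring of `ℚ`, the exponents being those
of `t`. -/
noncomputable def jones (w : Word) : AddMonoidAlgebra ℤ ℚ :=
  AddMonoidAlgebra.mapDomain (fun k : ℤ => -(k : ℚ) / 4)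
    (C ((writhe w).negOnePow : ℤ) * T (-3 * writhe w) * bracket w)

/-- The difference of the largest and the smallest exponent (`0` for the zero polynomial). -/
noncomputable def breadth (p : AddMonoidAlgebra ℤ ℚ) : ℚ :=
  if h : p.coeff.support.Nonempty then p.coeff.support.max' h - p.coeff.support.min' h else 0

/-! ### Parallels and cables -/

/-- The slices that replace one slice when every strand is replaced by `r` parallel strands: `r`
nested cups or caps, or a grid of `r ^ 2` crossings in which each of the `r` strands coming from the
lower left crosses each of the `r` strands coming from the lower right. -/
def parallelSlice (r : ℕ) : Slice → Word
  | ⟨.cup b, i⟩ => (List.range r).map fun a => ⟨.cup b, r * i + a⟩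
  | ⟨.cap, i⟩ => (List.range r).reverse.map fun a => ⟨.cap, r * i + a⟩
  | ⟨.cross s, i⟩ =>
    (List.range r).reverse.flatMap fun a =>
      (List.range r).map fun c => ⟨.cross s, r * i + a + c⟩

/-- The (blackboard) `r`-parallel of a diagram, all copies being oriented as the original. -/
def parallel (r : ℕ) (w : Word) : Word := w.flatMap (parallelSlice r)

/-- `m` full twists on the leftmost `r` strands, that is, the braid of the torus link `T(m r, r)`.
If these strands are oriented in parallel, then the crossings are positive for `0 < m` and
negative for `m < 0`. -/
def fullTwists (r : ℕ) (m : ℤ) : Word :=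
  (List.replicate (m.natAbs * r)
    ((List.range (r - 1)).map fun a => (⟨.cross (decide (0 < m)), a⟩ : Slice))).flatten

/-- The `r`-cable of a knot diagram, that is, its `r`-parallel with framing `0`: the blackboard
`r`-parallel with `-writhe` full twists added to the bundle of `r` parallel strands on the left of
the first local minimum. -/
def cable (r : ℕ) (w : Word) : Word :=
  parallel r (w.take 1) ++ fullTwists r (-writhe w) ++ parallel r (w.drop 1)

/-! ### Knots -/

/-- The local moves which generate isotopy of oriented links: planar isotopy of diagrams (`exchange`
of distant slices, `zigzag` cancellation of a local minimum with a local maximum, `swing` of a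
crossing past a local extremum) and the three Reidemeister moves. -/
inductive LocalMove : Word → Word → Prop
  | exchange (g h : Piece) (i d : ℕ) :
      LocalMove [⟨h, i + g.dom + d⟩, ⟨g, i⟩] [⟨g, i⟩, ⟨h, i + g.cod + d⟩]
  | zigzagLeft (b : Bool) (i : ℕ) : LocalMove [⟨.cup b, i⟩, ⟨.cap, i + 1⟩] []
  | zigzagRight (b : Bool) (i : ℕ) : LocalMove [⟨.cup b, i + 1⟩, ⟨.cap, i⟩] []
  | swingCup (b s : Bool) (i : ℕ) :
      LocalMove [⟨.cup b, i⟩, ⟨.cross s, i + 1⟩] [⟨.cup b, i + 1⟩, ⟨.cross !s, i⟩]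
  | swingCap (s : Bool) (i : ℕ) :
      LocalMove [⟨.cross s, i + 1⟩, ⟨.cap, i⟩] [⟨.cross !s, i⟩, ⟨.cap, i + 1⟩]
  | reidemeisterOneCup (b s : Bool) (i : ℕ) :
      LocalMove [⟨.cup b, i⟩, ⟨.cross s, i⟩] [⟨.cup !b, i⟩]
  | reidemeisterOneCap (s : Bool) (i : ℕ) :
      LocalMove [⟨.cross s, i⟩, ⟨.cap, i⟩] [⟨.cap, i⟩]
  | reidemeisterTwo (s : Bool) (i : ℕ) : LocalMove [⟨.cross s, i⟩, ⟨.cross !s, i⟩] []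
  | reidemeisterThree (a b c : Bool) (i : ℕ) (h : a = b ∨ b = c) :
      LocalMove [⟨.cross a, i⟩, ⟨.cross b, i + 1⟩, ⟨.cross c, i⟩]
        [⟨.cross c, i + 1⟩, ⟨.cross b, i⟩, ⟨.cross a, i + 1⟩]

/-- A local move performed inside a diagram. -/
def Move (v w : Word) : Prop :=
  ∃ p q x y : Word, LocalMove x y ∧ v = p ++ x ++ q ∧ w = p ++ y ++ q

/-- Oriented knot diagrams: oriented link diagrams with one component. -/
def KnotDiagram : Type := {w : Word // IsLinkDiagram w ∧ components w = 1}

/-- Oriented knots: oriented knot diagrams up to the equivalence generated by the moves. -/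
def Knot : Type := Quot fun D E : KnotDiagram => Move D.1 E.1

/-- `D` is a diagram of the oriented knot `K`. -/
def IsDiagramOf (D : KnotDiagram) (K : Knot) : Prop := Quot.mk _ D = K

end SlicedLink

namespace SlicedLink

/-! ### Temperley–Lieb systems on infinitely many strands -/

/-! Write `n` for the number of crossings of the adequate diagram `D` and `s₊`, `s₋` for its
constant states. The bracket is multiplied by the loop value `δ = -A² - A⁻²` (`fullBracket`) and
computed in a Temperley–Lieb system, where a crossing is a combination of the identity and a hook. A
closed planar word is worth `δ` to the number of its circuits (`TL.evF_eq_pow`), so a closed diagram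
is worth its bracket (`TL.ev_eq_fullBracket`). In `TL.model` over the rational functions in `A`
scalars embed faithfully, and identities between values are identities between Laurent polynomials.

Parallels and cables are compared through coloured brackets, in which a Jones–Wenzl element on `c`
strands is inserted into the `c`-parallel. Three facts carry the proof.

Expansion (`TL.decor_twist`, `fullBracket_cable`). The `r`-parallel with `m` full twists is a sum
over the colours `j = r - 2d`, with coefficient a natural number (`twistCoeff`, equal to `1` for `d
= 0`) times `A` to the power `m (j (j - 1) - 6 d)`. Indeed a Jones–Wenzl element turns a full twist
into a scalar, and the terms of its recursion that contain a hook reduce, by a trace and a partial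
trace (`TL.trace_comm`, `TL.partial_trace`), to the parallel with two strands fewer.

Invariance (`TL.colored_invariant`). A first Reidemeister move multiplies the coloured value by
`(-1)^c A^(c² + 2c)` or its inverse, and the other moves preserve it. A knot diagram has one
component, so a hook anywhere in the parallel slides along it to the Jones–Wenzl element, which
kills it (`TL.annihilates`). The crossings that untwist the parallel of a curl thus become scalars.

Extreme terms (`extreme_coloredBracket`). For adequate `D` the coloured bracket has the extreme
exponents `c² n + 2 c |s₊D|` and `-(c² n + 2 c |s₋D|)`, both with coefficient `1` or `-1`. Adequacy
is restated as a colouring condition: in a constant state the two arcs at any crossing can be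
coloured differently (`circuits_hook`). Colourings pass to parallels (`Separated.parallel`), whose
constant states have `c` times as many circuits (`circuits_smoothing_parallel`).

Now expand the cable of `E` and replace its coloured brackets by those of `D`. The summand of colour
`j` has its extreme exponents shifted by `3 r w(E) - (j² + 2j) w(D)`. All `j` have the parity of
`r`, so at either end the extreme coefficients of all summands have the same sign and cannot cancel
(`Extreme.exists_sum`). Hence both ends of the cable lie at least as far out as those of the summand
`j = r`, which are the ends of the bracket of `D^r` up to a common shift. -/

/-- Cups `u i` and caps `c i` on infinitely many strands, numbered from the left; products are read
from bottom to top. -/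
structure TL (k 𝒜 : Type*) [CommRing k] [Ring 𝒜] [Algebra k 𝒜] (δ : k) where
  u : ℕ → 𝒜
  c : ℕ → 𝒜
  loop : ∀ i, u i * c i = algebraMap k 𝒜 δ
  zigL : ∀ i, u i * c (i + 1) = 1
  zigR : ∀ i, u (i + 1) * c i = 1
  uu : ∀ i j, i ≤ j → u j * u i = u i * u (j + 2)
  cu : ∀ i j, i ≤ j → c j * u i = u i * c (j + 2)
  uc : ∀ i j, i ≤ j → u (j + 2) * c i = c i * u j
  cc : ∀ i j, i ≤ j → c (j + 2) * c i = c i * c j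

namespace TL

section Hook
variable {k 𝒜 : Type*} [CommRing k] [Ring 𝒜] [Algebra k 𝒜] {δ : k} (t : TL k 𝒜 δ)

/-- The hook: a cap below a cup. -/
def e (i : ℕ) : 𝒜 := t.c i * t.u i

end Hook

/-! A faithful system: vectors are functions of infinite sequences of bits. -/

section Model
variable {k : Type*} [Field k]

/-- Insert two bits at position `i`. -/
def ins (i : ℕ) (a b : Bool) (s : ℕ → Bool) : ℕ → Bool :=
  fun m => if m < i then s m else if m = i then a else if m = i + 1 then b else s (m - 2)

/-- Delete the two bits at the positions `i` and `i + 1`. -/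
def del (i : ℕ) (s : ℕ → Bool) : ℕ → Bool := fun m => if m < i then s m else s (m + 2)

/-- These identities between insertions and deletions are the Temperley–Lieb relations at the level
of bit sequences. Infinite sequences allow one algebra to serve for every number of strands. -/
lemma del_ins (i : ℕ) (a b : Bool) (s : ℕ → Bool) : del i (ins i a b s) = s := by
  funext m; simp only [del, ins]; grind

lemma ins_apply_left (i : ℕ) (a b : Bool) (s : ℕ → Bool) : ins i a b s i = a := by simp [ins]

lemma ins_apply_right (i : ℕ) (a b : Bool) (s : ℕ → Bool) : ins i a b s (i + 1) = b := by
  simp [ins]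

lemma ins_apply_add_two (i j : ℕ) (h : i ≤ j) (a b : Bool) (s : ℕ → Bool) :
    ins i a b s (j + 2) = s j := by
  simp only [ins]; grind

lemma ins_apply_lt (i j : ℕ) (h : j < i) (a b : Bool) (s : ℕ → Bool) :
    ins i a b s j = s j := by
  simp only [ins]; grind

lemma ins_ins (i j : ℕ) (h : i ≤ j) (a b a' b' : Bool) (s : ℕ → Bool) :
    ins i a b (ins j a' b' s) = ins (j + 2) a' b' (ins i a b s) := by
  funext m; simp only [ins]; grind

lemma del_del (i j : ℕ) (h : i ≤ j) (s : ℕ → Bool) :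
    del i (del (j + 2) s) = del j (del i s) := by
  funext m; simp only [del]; grind

lemma del_ins_of_le (i j : ℕ) (h : i ≤ j) (a b : Bool) (s : ℕ → Bool) :
    del (j + 2) (ins i a b s) = ins i a b (del j s) := by
  funext m; simp only [del, ins]; grind

lemma del_ins_of_le' (i j : ℕ) (h : i ≤ j) (a b : Bool) (s : ℕ → Bool) :
    del i (ins (j + 2) a b s) = ins j a b (del i s) := by
  funext m; simp only [del, ins]; grind

lemma del_apply_lt (i j : ℕ) (h : j < i) (s : ℕ → Bool) : del i s j = s j := by
  simp [del, h]

lemma del_apply_le (i j : ℕ) (h : i ≤ j) (s : ℕ → Bool) : del i s j = s (j + 2) := by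
  simp [del, h]

lemma del_succ_ins (i : ℕ) (a b : Bool) (s : ℕ → Bool) (h : s i = a) :
    del (i + 1) (ins i a b s) = s := by
  subst h
  funext m; simp only [del, ins]; grind

lemma del_ins_succ (i : ℕ) (a b : Bool) (s : ℕ → Bool) (h : s i = b) :
    del i (ins (i + 1) a b s) = s := by
  subst h
  funext m; simp only [del, ins]; grind

variable (A : k)

/-- The cup of the model. -/
def modelCup (i : ℕ) : Module.End k ((ℕ → Bool) → k) where
  toFun ξ s := A * ξ (ins i false true s) - A⁻¹ * ξ (ins i true false s)
  map_add' ξ η := by funext s; simp; ring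
  map_smul' r ξ := by funext s; simp; ring

/-- The cap of the model. -/
def modelCap (i : ℕ) : Module.End k ((ℕ → Bool) → k) where
  toFun ξ s := if s (i + 1) = !(s i) then (if s i then A⁻¹ else -A) * ξ (del i s) else 0
  map_add' ξ η := by funext s; simp only [Pi.add_apply]; split_ifs <;> ring
  map_smul' r ξ := by
    funext s; simp only [Pi.smul_apply, smul_eq_mul, RingHom.id_apply]; split_ifs <;> ring

lemma modelCup_apply (i : ℕ) (ξ : (ℕ → Bool) → k) (s : ℕ → Bool) :
    modelCup A i ξ s = A * ξ (ins i false true s) - A⁻¹ * ξ (ins i true false s) := rfl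

lemma modelCap_apply (i : ℕ) (ξ : (ℕ → Bool) → k) (s : ℕ → Bool) :
    modelCap A i ξ s =
      if s (i + 1) = !(s i) then (if s i then A⁻¹ else -A) * ξ (del i s) else 0 := rfl

/-- The Temperley–Lieb system with loop value `-A² - A⁻²`. -/
def model (hA : A ≠ 0) :
    TL k (Module.End k ((ℕ → Bool) → k)) (-A ^ 2 - A⁻¹ ^ 2) where
  u := modelCup A
  c := modelCap A
  -- The two bit patterns of the cup contribute `A * (-A)` and `-A⁻¹ * A⁻¹`.
  loop i := by
    ext ξ s
    rw [Module.algebraMap_end_apply]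
    simp [modelCup_apply, modelCap_apply, ins_apply_left, ins_apply_right, del_ins]
    ring
  zigL i := by
    ext ξ s
    have h := ins_apply_add_two i i le_rfl
    simp only [Module.End.mul_apply, modelCup_apply, modelCap_apply, ins_apply_right, h,
      Module.End.one_apply, show i + 1 + 1 = i + 2 from rfl]
    cases hs : s i
    · simp [del_succ_ins i false true s hs, hA]
    · simp [del_succ_ins i true false s hs, hA]
  zigR i := by
    ext ξ s
    simp only [Module.End.mul_apply, modelCup_apply, modelCap_apply, ins_apply_left,
      ins_apply_lt (i + 1) i (Nat.lt_succ_self i), Module.End.one_apply]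
    cases hs : s i
    · simp [del_ins_succ i true false s hs, hA]
    · simp [del_ins_succ i false true s hs, hA]
  uu i j h := by
    ext ξ s
    simp only [Module.End.mul_apply, modelCup_apply, ins_ins i j h]
    ring
  cu i j h := by
    ext ξ s
    simp only [Module.End.mul_apply, modelCup_apply, modelCap_apply, del_ins_of_le i j h,
      ins_apply_add_two i j h, show j + 2 + 1 = (j + 1) + 2 by ring,
      ins_apply_add_two i (j + 1) (by omega)]
    split_ifs <;> ring
  uc i j h := by
    ext ξ s
    simp only [Module.End.mul_apply, modelCup_apply, modelCap_apply, del_ins_of_le' i j h,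
      ins_apply_lt (j + 2) i (by omega), ins_apply_lt (j + 2) (i + 1) (by omega)]
    split_ifs <;> ring
  cc i j h := by
    ext ξ s
    simp only [Module.End.mul_apply, modelCap_apply, del_del i j h,
      del_apply_le i j h, del_apply_le i (j + 1) (by omega),
      del_apply_lt (j + 2) i (by omega), del_apply_lt (j + 2) (i + 1) (by omega),
      show j + 1 + 2 = j + 2 + 1 by ring]
    split_ifs <;> ring

end Model

/-- The system in which every diagram is a sign. -/
def sign : TL ℤ ℤ (-1) where
  u i := (-1) ^ i
  c i := (-1) ^ (i + 1)
  loop i := by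
    rw [← pow_add]; exact Odd.neg_one_pow ⟨i, by ring⟩
  zigL i := by rw [← pow_add]; exact Even.neg_one_pow ⟨i + 1, by ring⟩
  zigR i := by rw [← pow_add]; exact Even.neg_one_pow ⟨i + 1, by ring⟩
  uu i j _ := by ring
  cu i j _ := by ring
  uc i j _ := by ring
  cc i j _ := by ring

end TL

/-! ### Counting circuits -/

lemma exists_append_of_le {α : Type*} {i : ℕ} {L : List α} (h : i ≤ L.length) :
    ∃ L₁ L₂, L = L₁ ++ L₂ ∧ L₁.length = i :=
  ⟨L.take i, L.drop i, (List.take_append_drop i L).symm, by simp [h]⟩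

lemma exists_append_cons_of_lt {α : Type*} {i : ℕ} {L : List α} (h : i + 1 ≤ L.length) :
    ∃ L₁ x L₂, L = L₁ ++ x :: L₂ ∧ L₁.length = i := by
  obtain ⟨L₁, L₂, rfl, h₁⟩ := exists_append_of_le (i := i) (L := L) (by omega)
  rcases L₂ with _ | ⟨x, L₂⟩
  · simp at h; omega
  · exact ⟨L₁, x, L₂, rfl, h₁⟩

lemma exists_append_cons_cons_of_lt {α : Type*} {i : ℕ} {L : List α} (h : i + 2 ≤ L.length) :
    ∃ L₁ x y L₂, L = L₁ ++ x :: y :: L₂ ∧ L₁.length = i := by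
  obtain ⟨L₁, x, L₂, rfl, h₁⟩ := exists_append_cons_of_lt (i := i) (L := L) (by omega)
  rcases L₂ with _ | ⟨y, L₂⟩
  · simp at h; omega
  · exact ⟨L₁, x, y, L₂, rfl, h₁⟩

lemma circuitsFrom_cup (w : List Flat) (n : ℕ) (L₁ L₂ : List ℕ) :
    circuitsFrom (.cup L₁.length :: w) n (L₁ ++ L₂) =
      circuitsFrom w (n + 1) (L₁ ++ n :: n :: L₂) := by
  simp [circuitsFrom]

lemma circuitsFrom_cap (w : List Flat) (n : ℕ) (L₁ L₂ : List ℕ) (x y : ℕ) :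
    circuitsFrom (.cap L₁.length :: w) n (L₁ ++ x :: y :: L₂) =
      (if x = y then 1 else 0) +
        circuitsFrom w n ((L₁ ++ L₂).map fun z => if z = y then x else z) := by
  simp [circuitsFrom]

lemma circuitsFrom_swap (w : List Flat) (n : ℕ) (L₁ L₂ : List ℕ) (x y : ℕ) :
    circuitsFrom (.swap L₁.length :: w) n (L₁ ++ x :: y :: L₂) =
      circuitsFrom w n (L₁ ++ y :: x :: L₂) := by
  simp [circuitsFrom]

/-- Only the pattern of equal labels matters. -/
lemma circuitsFrom_map (w : List Flat) : ∀ (n n' : ℕ) (L : List ℕ) (f : ℕ → ℕ),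
    (∀ x ∈ L, ∀ y ∈ L, f x = f y → x = y) → (∀ x ∈ L, x < n) → (∀ x ∈ L, f x < n') →
    circuitsFrom w n' (L.map f) = circuitsFrom w n L := by
  induction w with
  | nil => intros; rfl
  | cons g w ih =>
    intro n n' L f hf hn hn'
    rcases g with i | i | i
    · simp only [circuitsFrom]
      -- The renaming `f` is extended by sending the fresh label `n` to the fresh label `n'`.
      have key : (L.map f).take i ++ n' :: n' :: (L.map f).drop i =
          (L.take i ++ n :: n :: L.drop i).map (fun x => if x = n then n' else f x) := by
        have h1 : ∀ M : List ℕ, (∀ x ∈ M, x ∈ L) →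
            M.map (fun x => if x = n then n' else f x) = M.map f := by
          intro M hM
          apply List.map_congr_left
          intro x hx
          have := hn x (hM x hx)
          simp [this.ne]
        simp only [List.map_append, List.map_cons, if_true]
        rw [h1 _ (fun x => List.mem_of_mem_take), h1 _ (fun x => List.mem_of_mem_drop),
          List.map_take, List.map_drop]
      have hmem : ∀ x ∈ L.take i ++ n :: n :: L.drop i, x = n ∨ x ∈ L := by
        intro x hx
        simp only [List.mem_append, List.mem_cons] at hx
        rcases hx with h | h | h | h
        · exact .inr (List.mem_of_mem_take h)
        · exact .inl h
        · exact .inl h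
        · exact .inr (List.mem_of_mem_drop h)
      rw [key]
      apply ih
      · intro x hx y hy
        rcases hmem x hx with h1 | h1 <;> rcases hmem y hy with h2 | h2
        · simp [h1, h2]
        · have := hn y h2; have := hn' y h2; grind
        · have := hn x h1; have := hn' x h1; grind
        · simp only [(hn x h1).ne, (hn y h2).ne, if_false]; exact hf x h1 y h2
      · intro x hx
        rcases hmem x hx with rfl | hx
        · omega
        · have := hn x hx; omega
      · intro x hx
        rcases hmem x hx with rfl | hx
        · simp
        · have := hn x hx; have := hn' x hx; simp only [(hn x hx).ne, if_false]; omega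
    · by_cases hl : i + 2 ≤ L.length
      · obtain ⟨L₁, x, y, L₂, rfl, rfl⟩ := exists_append_cons_cons_of_lt hl
        rw [circuitsFrom_cap, List.map_append, List.map_cons, List.map_cons]
        have := circuitsFrom_cap w n' (L₁.map f) (L₂.map f) (f x) (f y)
        rw [List.length_map] at this
        rw [this]
        have hxy : (f x = f y) ↔ (x = y) := ⟨hf x (by simp) y (by simp), fun h => by rw [h]⟩
        simp only [hxy]
        congr 1
        rw [← List.map_append, List.map_map]
        have h3 : (L₁ ++ L₂).map ((fun z => if z = f y then f x else z) ∘ f) =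
            ((L₁ ++ L₂).map (fun z => if z = y then x else z)).map f := by
          rw [List.map_map]
          apply List.map_congr_left
          intro z hz
          have hz' : z ∈ L₁ ++ x :: y :: L₂ := by simp at hz ⊢; tauto
          have : f z = f y ↔ z = y := ⟨hf z hz' y (by simp), fun h => by rw [h]⟩
          simp only [Function.comp, this]; split_ifs <;> rfl
        rw [h3]
        have hmem : ∀ z ∈ (L₁ ++ L₂).map (fun z => if z = y then x else z),
            z ∈ L₁ ++ x :: y :: L₂ := by
          intro z hz
          simp only [List.mem_map, List.mem_append] at hz
          obtain ⟨a, ha, rfl⟩ := hz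
          split_ifs <;> simp <;> tauto
        exact ih _ _ _ _ (fun a ha b hb => hf a (hmem a ha) b (hmem b hb))
          (fun a ha => hn a (hmem a ha)) (fun a ha => hn' a (hmem a ha))
      -- A cap that does not fit ends the sweep with the default value `0` for both labellings.
      · have h1 : ∀ M : List ℕ, ¬ i + 2 ≤ M.length → circuitsFrom (.cap i :: w) n M = 0 ∧
            circuitsFrom (.cap i :: w) n' M = 0 := by
          intro M hM
          have : (M.drop i).length < 2 := by simp; omega
          rcases h : M.drop i with _ | ⟨a, _ | ⟨b, R⟩⟩
          · simp [circuitsFrom, h]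
          · simp [circuitsFrom, h]
          · rw [h] at this; simp at this
        rw [(h1 _ (by simpa using hl)).2, (h1 _ hl).1]
    · by_cases hl : i + 2 ≤ L.length
      · obtain ⟨L₁, x, y, L₂, rfl, rfl⟩ := exists_append_cons_cons_of_lt hl
        rw [circuitsFrom_swap, List.map_append, List.map_cons, List.map_cons]
        have := circuitsFrom_swap w n' (L₁.map f) (L₂.map f) (f x) (f y)
        rw [List.length_map] at this
        rw [this, ← List.map_cons, ← List.map_cons, ← List.map_append]
        have hmem : ∀ z ∈ L₁ ++ y :: x :: L₂, z ∈ L₁ ++ x :: y :: L₂ := by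
          intro z hz; simp at hz ⊢; tauto
        exact ih _ _ _ _ (fun a ha b hb => hf a (hmem a ha) b (hmem b hb))
          (fun a ha => hn a (hmem a ha)) (fun a ha => hn' a (hmem a ha))
      · have h1 : ∀ M : List ℕ, ¬ i + 2 ≤ M.length → circuitsFrom (.swap i :: w) n M = 0 ∧
            circuitsFrom (.swap i :: w) n' M = 0 := by
          intro M hM
          have : (M.drop i).length < 2 := by simp; omega
          rcases h : M.drop i with _ | ⟨a, _ | ⟨b, R⟩⟩
          · simp [circuitsFrom, h]
          · simp [circuitsFrom, h]
          · rw [h] at this; simp at this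
        rw [(h1 _ (by simpa using hl)).2, (h1 _ hl).1]

/-- A flat word without intersections leads from `n` strands to `m` strands. -/
def Planar : List Flat → ℕ → ℕ → Prop
  | [], n, m => n = m
  | .cup i :: w, n, m => i ≤ n ∧ Planar w (n + 2) m
  | .cap i :: w, n, m => i + 2 ≤ n ∧ Planar w (n - 2) m
  | .swap _ :: _, _, _ => False

lemma planar_append (v w : List Flat) : ∀ n m, Planar (v ++ w) n m ↔
    ∃ l, Planar v n l ∧ Planar w l m := by
  induction v with
  | nil => intro n m; simp [Planar]
  | cons g v ih =>
    intro n m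
    rcases g with i | i | i <;> simp [Planar, ih, and_assoc]

/-- Sweeping a prefix. -/
lemma exists_sweep (v : List Flat) : ∀ (n m : ℕ) (L : List ℕ), Planar v L.length m →
    (∀ x ∈ L, x < n) → ∃ (N k : ℕ) (M : List ℕ), M.length = m ∧ (∀ x ∈ M, x < N) ∧
      ∀ w, circuitsFrom (v ++ w) n L = k + circuitsFrom w N M := by
  induction v with
  | nil =>
    intro n m L h hL
    exact ⟨n, 0, L, h, hL, fun w => by simp⟩
  | cons g v ih =>
    intro n m L h hL
    rcases g with i | i | i
    · obtain ⟨h1, h2⟩ := h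
      obtain ⟨L₁, L₂, rfl, rfl⟩ := exists_append_of_le h1
      obtain ⟨N, k, M, hM, hN, hw⟩ := ih (n + 1) m (L₁ ++ n :: n :: L₂)
        (by convert h2 using 1; simp; omega) (by
          intro x hx
          simp only [List.mem_append, List.mem_cons] at hx hL
          rcases hx with h | h | h | h
          · have := hL x (.inl h); omega
          · omega
          · omega
          · have := hL x (.inr h); omega)
      exact ⟨N, k, M, hM, hN, fun w => by rw [List.cons_append, circuitsFrom_cup, hw]⟩
    · obtain ⟨h1, h2⟩ := h
      obtain ⟨L₁, x, y, L₂, rfl, rfl⟩ := exists_append_cons_cons_of_lt h1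
      obtain ⟨N, k, M, hM, hN, hw⟩ := ih n m ((L₁ ++ L₂).map fun z => if z = y then x else z)
        (by convert h2 using 1; simp; omega) (by
          intro z hz
          simp only [List.mem_map] at hz
          obtain ⟨a, ha, rfl⟩ := hz
          split_ifs
          · exact hL x (by simp)
          · exact hL a (by simp at ha ⊢; tauto))
      exact ⟨N, (if x = y then 1 else 0) + k, M, hM, hN, fun w => by
        rw [List.cons_append, circuitsFrom_cap, hw, add_assoc]⟩
    · exact h.elim

/-- The counting of circuits obeys the Temperley–Lieb relations. This lemma and the next four treat
a cup followed by a cap in all relative positions. -/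
lemma circuitsFrom_loop (w : List Flat) (n i : ℕ) (L : List ℕ) (hi : i ≤ L.length)
    (hL : ∀ x ∈ L, x < n) :
    circuitsFrom (.cup i :: .cap i :: w) n L = 1 + circuitsFrom w n L := by
  obtain ⟨L₁, L₂, rfl, rfl⟩ := exists_append_of_le hi
  rw [circuitsFrom_cup, circuitsFrom_cap, if_pos rfl]
  congr 1
  rw [← circuitsFrom_map w n (n + 1) (L₁ ++ L₂) id (by simp) hL
    (fun x hx => (hL x hx).trans (Nat.lt_succ_self n))]
  congr 1
  apply List.map_congr_left
  intro z _
  split_ifs with h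
  · exact h.symm
  · rfl

/-- The cap renames the neighbouring label `y` to the fresh label `n`, which leaves the pattern of
equal labels unchanged; `circuitsFrom_map` then applies. -/
lemma circuitsFrom_zigL (w : List Flat) (n i : ℕ) (L : List ℕ) (hi : i + 1 ≤ L.length)
    (hL : ∀ x ∈ L, x < n) :
    circuitsFrom (.cup i :: .cap (i + 1) :: w) n L = circuitsFrom w n L := by
  obtain ⟨L₁, y, L₂, rfl, rfl⟩ := exists_append_cons_of_lt hi
  rw [circuitsFrom_cup]
  have h := circuitsFrom_cap w (n + 1) (L₁ ++ [n]) L₂ n y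
  simp only [List.length_append, List.length_singleton, List.append_assoc,
    List.singleton_append] at h
  have hy := hL y (by simp)
  rw [h, if_neg hy.ne', zero_add,
    ← circuitsFrom_map w n (n + 1) (L₁ ++ y :: L₂) (fun z => if z = y then n else z)]
  · congr 1
    simp [hy.ne']
  · intro a ha b hb
    have := hL a ha; have := hL b hb
    grind
  · exact hL
  · intro a ha
    have := hL a ha
    grind

lemma circuitsFrom_zigR (w : List Flat) (n i : ℕ) (L : List ℕ) (hi : i + 1 ≤ L.length)
    (hL : ∀ x ∈ L, x < n) :
    circuitsFrom (.cup (i + 1) :: .cap i :: w) n L = circuitsFrom w n L := by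
  obtain ⟨L₁, x, L₂, rfl, rfl⟩ := exists_append_cons_of_lt hi
  have h := circuitsFrom_cup (.cap L₁.length :: w) n (L₁ ++ [x]) L₂
  simp only [List.length_append, List.length_singleton, List.append_assoc,
    List.singleton_append] at h
  have hx := hL x (by simp)
  rw [h, circuitsFrom_cap, if_neg hx.ne, zero_add,
    ← circuitsFrom_map w n (n + 1) (L₁ ++ x :: L₂) id (by simp) hL
    (fun x hx => (hL x hx).trans (Nat.lt_succ_self n))]
  congr 1
  have h1 : ∀ M : List ℕ, (∀ z ∈ M, z ∈ L₁ ++ x :: L₂) →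
      M.map (fun z => if z = n then x else z) = M := by
    intro M hM
    conv_rhs => rw [← List.map_id M]
    apply List.map_congr_left
    intro z hz
    have := hL z (hM z hz)
    simp [this.ne]
  simp only [List.map_append, List.map_cons, if_true, List.map_id, id]
  rw [h1 L₁ (by simp +contextual), h1 L₂ (by simp +contextual)]

lemma circuitsFrom_cup_cap (w : List Flat) (n i j : ℕ) (hij : i ≤ j) (L : List ℕ)
    (hj : j + 2 ≤ L.length) (hL : ∀ x ∈ L, x < n) :
    circuitsFrom (.cup i :: .cap (j + 2) :: w) n L = circuitsFrom (.cap j :: .cup i :: w) n L := by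
  obtain ⟨M, x, y, L₂, rfl, rfl⟩ := exists_append_cons_cons_of_lt hj
  obtain ⟨L₁, M, rfl, rfl⟩ := exists_append_of_le hij
  rw [circuitsFrom_cap, List.append_assoc, circuitsFrom_cup]
  have h1 := circuitsFrom_cap w (n + 1) (L₁ ++ n :: n :: M) L₂ x y
  simp only [List.length_append, List.length_cons, List.append_assoc, List.cons_append] at h1 ⊢
  rw [show L₁.length + M.length + 2 = L₁.length + (M.length + 1 + 1) by omega, h1, List.map_append, List.map_append]
  have h2 := circuitsFrom_cup w n (L₁.map fun z => if z = y then x else z)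
    ((M ++ L₂).map fun z => if z = y then x else z)
  rw [List.length_map] at h2
  have hy := hL y (by simp)
  rw [h2]
  simp [hy.ne']

lemma circuitsFrom_cup_cap' (w : List Flat) (n i j : ℕ) (hij : j ≤ i) (L : List ℕ)
    (hi : i + 2 ≤ L.length) (hL : ∀ x ∈ L, x < n) :
    circuitsFrom (.cup (i + 2) :: .cap j :: w) n L = circuitsFrom (.cap j :: .cup i :: w) n L := by
  obtain ⟨L₁, x, y, L₂, rfl, rfl⟩ := exists_append_cons_cons_of_lt (hij |> fun h => by omega :
    j + 2 ≤ L.length)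
  obtain ⟨M, L₂, rfl, hM⟩ := exists_append_of_le (i := i - L₁.length) (L := L₂)
    (by simp at hi; omega)
  obtain rfl : i = L₁.length + M.length := by omega
  rw [circuitsFrom_cap]
  have h0 := circuitsFrom_cup (.cap L₁.length :: w) n (L₁ ++ x :: y :: M) L₂
  simp only [List.length_append, List.length_cons, List.append_assoc, List.cons_append,
    ← add_assoc] at h0 ⊢
  rw [show L₁.length + M.length + 2 = L₁.length + M.length + 1 + 1 from rfl, h0,
    circuitsFrom_cap, ← List.append_assoc, ← List.append_assoc, List.map_append (l₁ := L₁ ++ M),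
    List.map_append (l₁ := L₁ ++ M)]
  have h2 := circuitsFrom_cup w n ((L₁ ++ M).map fun z => if z = y then x else z)
    (L₂.map fun z => if z = y then x else z)
  rw [List.length_map, List.length_append] at h2
  have hy := hL y (by simp)
  rw [h2]
  simp [hy.ne']

variable {k 𝒜 : Type*} [CommRing k] [Ring 𝒜] [Algebra k 𝒜] {δ : k}

namespace TL
variable (t : TL k 𝒜 δ)

/-- The value of a flat piece. -/
def flat : Flat → 𝒜
  | .cup i => t.u i
  | .cap i => t.c i
  | .swap _ => 1

/-- The value of a flat word. -/
def evF (w : List Flat) : 𝒜 := (w.map t.flat).prod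

lemma evF_append (v w : List Flat) : t.evF (v ++ w) = t.evF v * t.evF w := by
  simp [evF]

lemma evF_cons (g : Flat) (w : List Flat) : t.evF (g :: w) = t.flat g * t.evF w := by
  simp [evF]

@[simp] lemma evF_nil : t.evF [] = 1 := rfl

end TL

lemma exists_first_cap (w : List Flat) : ∀ n, Planar w n 0 → w ≠ [] →
    ∃ (p : List ℕ) (j : ℕ) (q : List Flat), w = p.map Flat.cup ++ .cap j :: q := by
  induction w with
  | nil => intro n _ h; exact (h rfl).elim
  | cons g w ih =>
    intro n h _
    rcases g with i | i | i
    · rcases w with _ | ⟨g', w⟩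
      · simp [Planar] at h
      · obtain ⟨p, j, q, hw⟩ := ih _ h.2 (by simp)
        exact ⟨i :: p, j, q, by simp [hw]⟩
    · exact ⟨[], i, w, rfl⟩
    · exact h.elim

/-- A closed flat word is worth the loop value to the number of its circuits. -/
theorem TL.evF_eq_pow (t : TL k 𝒜 δ) (w : List Flat) (hw : Planar w 0 0) :
    t.evF w = algebraMap k 𝒜 (δ ^ circuits w) ∧ (w ≠ [] → 1 ≤ circuits w) := by
  suffices H : ∀ N, ∀ w : List Flat, w.length = N → Planar w 0 0 →
      t.evF w = algebraMap k 𝒜 (δ ^ circuits w) ∧ (w ≠ [] → 1 ≤ circuits w) from H _ w rfl hw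
  intro N
  induction N using Nat.strong_induction_on with
  | _ N ihN =>
  -- A nonempty closed word has a first cap, and only cups precede it. An inner induction on these
  -- cups moves the cap downwards until it meets a cup with which it cancels; then the word gets
  -- shorter.
  suffices H : ∀ (p : List ℕ) (j : ℕ) (q : List Flat),
      (p.map Flat.cup ++ .cap j :: q).length = N → Planar (p.map Flat.cup ++ .cap j :: q) 0 0 →
      t.evF (p.map Flat.cup ++ .cap j :: q) =
        algebraMap k 𝒜 (δ ^ circuits (p.map Flat.cup ++ .cap j :: q)) ∧
        1 ≤ circuits (p.map Flat.cup ++ .cap j :: q) by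
    intro w hN hw
    by_cases h0 : w = []
    · subst h0
      simp [circuits, circuitsFrom]
    · obtain ⟨p, j, q, rfl⟩ := exists_first_cap w 0 hw h0
      obtain ⟨h1, h2⟩ := H p j q hN hw
      exact ⟨h1, fun _ => h2⟩
  intro p
  induction p using List.reverseRecOn with
  | nil => intro j q _ h; simp [Planar] at h
  | append_singleton p i ihp =>
    intro j q hN hw
    simp only [List.map_append, List.map_cons, List.map_nil, List.append_assoc,
      List.cons_append, List.nil_append] at hN hw ⊢
    obtain ⟨l, hl, hi, hj, hq⟩ := (planar_append _ _ _ _).1 hw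
    obtain ⟨n, k', L, hLl, hL, hc⟩ := exists_sweep _ 0 l [] hl (by simp)
    subst hLl
    have hc' : ∀ w, circuits (p.map Flat.cup ++ w) = k' + circuitsFrom w n L := hc
    rw [hc']
    have hlen : ∀ w : List Flat, (p.map Flat.cup ++ w).length = p.length + w.length := by simp
    rw [hlen] at hN
    simp only [List.length_cons] at hN
    have hpar : ∀ w : List Flat, Planar w L.length 0 → Planar (p.map Flat.cup ++ w) 0 0 :=
      fun w h => (planar_append _ _ _ _).2 ⟨_, hl, h⟩
    simp only [Nat.add_sub_cancel] at hq
    obtain h | h | h | h | h : j = i ∨ j = i + 1 ∨ i = j + 1 ∨ i + 2 ≤ j ∨ j + 2 ≤ i := by omega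
    · subst h
      obtain ⟨h1, h2⟩ := ihN _ (by rw [hlen]; omega) _ rfl (hpar q hq)
      rw [circuitsFrom_loop _ _ _ _ hi hL]
      rw [hc'] at h1
      refine ⟨?_, by omega⟩
      rw [TL.evF_append] at h1 ⊢
      rw [TL.evF_cons, TL.evF_cons, ← mul_assoc (t.flat _)]
      change _ * (t.u j * t.c j * _) = _
      rw [t.loop, Algebra.left_comm, h1, ← map_mul]
      congr 1; ring
    · subst h
      obtain ⟨h1, h2⟩ := ihN _ (by rw [hlen]; omega) _ rfl (hpar q hq)
      rw [circuitsFrom_zigL _ _ _ _ (by omega) hL]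
      rw [hc'] at h1 h2
      constructor
      · rw [TL.evF_append] at h1 ⊢
        rw [TL.evF_cons, TL.evF_cons, ← mul_assoc (t.flat _)]
        change _ * (t.u i * t.c (i + 1) * _) = _
        rw [t.zigL, one_mul, h1]
      · apply h2
        -- Straightening a zigzag never leaves the empty word, since a zigzag needs a strand that is
        -- already present.
        intro h
        simp only [List.append_eq_nil_iff, List.map_eq_nil_iff] at h
        obtain ⟨rfl, rfl⟩ := h
        simp [Planar] at hl hj
        omega
    · subst h
      obtain ⟨h1, h2⟩ := ihN _ (by rw [hlen]; omega) _ rfl (hpar q hq)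
      rw [circuitsFrom_zigR _ _ _ _ (by omega) hL]
      rw [hc'] at h1 h2
      constructor
      · rw [TL.evF_append] at h1 ⊢
        rw [TL.evF_cons, TL.evF_cons, ← mul_assoc (t.flat _)]
        change _ * (t.u (j + 1) * t.c j * _) = _
        rw [t.zigR, one_mul, h1]
      · apply h2
        intro h
        simp only [List.append_eq_nil_iff, List.map_eq_nil_iff] at h
        obtain ⟨rfl, rfl⟩ := h
        simp [Planar] at hl hi
        omega
    · obtain ⟨j, rfl⟩ : ∃ j', j = j' + 2 := ⟨j - 2, by omega⟩
      obtain ⟨h1, h2⟩ := ihp j (.cup i :: q) (by simp; omega) (hpar _ ⟨by omega, by omega, by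
        convert hq using 1; omega⟩)
      rw [circuitsFrom_cup_cap _ _ _ _ (by omega) _ (by omega) hL]
      rw [hc'] at h1 h2
      refine ⟨?_, h2⟩
      rw [← h1, TL.evF_append, TL.evF_append]
      simp only [TL.evF_cons, ← mul_assoc, TL.flat]
      rw [mul_assoc _ (t.u i), mul_assoc _ (t.c j), t.cu i j (by omega)]
    · obtain ⟨i, rfl⟩ : ∃ j', i = j' + 2 := ⟨i - 2, by omega⟩
      obtain ⟨h1, h2⟩ := ihp j (.cup i :: q) (by simp; omega) (hpar _ ⟨by omega, by omega, by
        convert hq using 1; omega⟩)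
      rw [circuitsFrom_cup_cap' _ _ _ _ (by omega) _ (by omega) hL]
      rw [hc'] at h1 h2
      refine ⟨?_, h2⟩
      rw [← h1, TL.evF_append, TL.evF_append]
      simp only [TL.evF_cons, ← mul_assoc, TL.flat]
      rw [mul_assoc _ (t.u _), mul_assoc _ (t.c j), t.uc j i (by omega)]


/-! ### The bracket as a value in a Temperley–Lieb system -/

/-- A sum over all lists of `n` bits. -/
def sumBool {M : Type*} [AddCommMonoid M] : ℕ → (List Bool → M) → M
  | 0, G => G []
  | n + 1, G => sumBool n (fun l => G (true :: l)) + sumBool n (fun l => G (false :: l))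

lemma sum_ofFn_eq_sumBool {M : Type*} [AddCommMonoid M] : ∀ (n : ℕ) (G : List Bool → M),
    ∑ s : Fin n → Bool, G (List.ofFn s) = sumBool n G := by
  intro n
  induction n with
  | zero => intro G; simp [sumBool]
  | succ n ih =>
    intro G
    rw [← (Fin.consEquiv fun _ => Bool).sum_comp, Fintype.sum_prod_type]
    simp only [Fintype.sum_bool, sumBool, ← ih]
    simp [Fin.consEquiv]

lemma sumBool_congr {M : Type*} [AddCommMonoid M] : ∀ (n : ℕ) (G G' : List Bool → M),
    (∀ l, l.length = n → G l = G' l) → sumBool n G = sumBool n G' := by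
  intro n
  induction n with
  | zero => intro G G' h; exact h [] rfl
  | succ n ih =>
    intro G G' h
    simp only [sumBool]
    rw [ih _ (fun l => G' (true :: l)) fun l hl => h _ (by simp [hl]),
      ih _ (fun l => G' (false :: l)) fun l hl => h _ (by simp [hl])]

lemma map_sumBool {M N : Type*} [AddCommMonoid M] [AddCommMonoid N] (f : M →+ N) :
    ∀ (n : ℕ) (G : List Bool → M), f (sumBool n G) = sumBool n fun l => f (G l) := by
  intro n
  induction n with
  | zero => intro G; rfl
  | succ n ih => intro G; simp only [sumBool, map_add, ih]

lemma mul_sumBool {M : Type*} [NonUnitalNonAssocSemiring M] (x : M) (n : ℕ) (G : List Bool → M) :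
    x * sumBool n G = sumBool n fun l => x * G l :=
  map_sumBool (AddMonoidHom.mulLeft x) n G

/-- The sum of the values `±1` of a list of bits. -/
def pmSum (l : List Bool) : ℤ := (l.map fun b => if b then (1 : ℤ) else -1).sum

lemma stateSum_eq (w : Word) (s : State w) : stateSum w s = pmSum (List.ofFn s) := by
  simp [stateSum, pmSum, List.map_ofFn, List.sum_ofFn]

/-- The lengths of the strands fit: the word leads from `n` strands to `m` strands. -/
def Fits : Word → ℕ → ℕ → Prop
  | [], n, m => n = m
  | ⟨.cup _, i⟩ :: w, n, m => i ≤ n ∧ Fits w (n + 2) m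
  | ⟨.cap, i⟩ :: w, n, m => i + 2 ≤ n ∧ Fits w (n - 2) m
  | ⟨.cross _, i⟩ :: w, n, m => i + 2 ≤ n ∧ Fits w n m

lemma fits_append (v w : Word) : ∀ n m, Fits (v ++ w) n m ↔
    ∃ l, Fits v n l ∧ Fits w l m := by
  induction v with
  | nil => intro n m; simp [Fits]
  | cons g v ih =>
    intro n m
    rcases g with ⟨_ | _ | _, i⟩ <;> simp [Fits, ih, and_assoc]

lemma planar_resolve (w : Word) : ∀ (l : List Bool) n m, Fits w n m → l.length = crossings w →
    Planar (resolve w l) n m := by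
  induction w with
  | nil => intro l n m h _; exact h
  | cons g w ih =>
    intro l n m h hl
    rcases g with ⟨_ | _ | a, i⟩
    · exact ⟨h.1, ih _ _ _ h.2 (by simpa [crossings, Piece.isCross] using hl)⟩
    · exact ⟨h.1, ih _ _ _ h.2 (by simpa [crossings, Piece.isCross] using hl)⟩
    · rcases l with _ | ⟨b, l⟩
      · simp [crossings, Piece.isCross] at hl
      · have hl' : l.length = crossings w := by
          simpa [crossings, Piece.isCross] using hl
        simp only [resolve]
        obtain ⟨h1, h2⟩ := h
        split_ifs
        · exact ih _ _ _ h2 hl'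
        · refine ⟨h1, by omega, ?_⟩
          rw [Nat.sub_add_cancel (by omega)]
          exact ih _ _ _ h2 hl'

open LaurentPolynomial in
/-- The loop value. -/
noncomputable def loopValue : LaurentPolynomial ℤ := -T (-2) - T 2

open LaurentPolynomial in
/-- The bracket in the normalization where the unknot is worth one loop. -/
noncomputable def fullBracket (w : Word) : LaurentPolynomial ℤ :=
  sumBool (crossings w) fun l => T (pmSum l) * loopValue ^ circuits (resolve w l)

open LaurentPolynomial in
lemma fullBracket_eq_sum (w : Word) : fullBracket w =
    ∑ s : State w, T (stateSum w s) * loopValue ^ stateCircuits w s := by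
  simp only [stateSum_eq, stateCircuits]
  exact (sum_ofFn_eq_sumBool (crossings w) fun l => T (pmSum l) * loopValue ^ circuits (resolve w l)).symm

/-- A closed diagram cannot begin with a crossing, as there are no strands yet; so its first slice
survives every splitting. -/
lemma resolve_ne_nil (w : Word) (hw : Fits w 0 0) (h : w ≠ []) (l : List Bool) :
    resolve w l ≠ [] := by
  rcases w with _ | ⟨g, w⟩
  · exact (h rfl).elim
  · rcases g with ⟨_ | _ | a, i⟩
    · simp [resolve]
    · simp [resolve]
    · have := hw.1; omega

/-- Every state of a nonempty closed diagram has a circuit, so the truncated exponent `|sD| - 1`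
loses nothing. -/
lemma loopValue_mul_bracket (w : Word) (hw : Fits w 0 0) (h : w ≠ []) :
    loopValue * bracket w = fullBracket w := by
  rw [fullBracket_eq_sum, bracket, Finset.mul_sum]
  refine Finset.sum_congr rfl fun s _ => ?_
  have h1 : 1 ≤ stateCircuits w s :=
    (TL.sign.evF_eq_pow _ (planar_resolve w (List.ofFn s) 0 0 hw (by simp))).2
      (resolve_ne_nil w hw h _)
  rw [mul_left_comm]
  congr 1
  change loopValue * loopValue ^ _ = _
  rw [← pow_succ']
  congr 1
  omega

variable {k 𝒜 : Type*} [Field k] [Ring 𝒜] [Algebra k 𝒜] {δ : k}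

namespace TL

section
variable (t : TL k 𝒜 δ)

/-- The value of a crossing with parameter `a`. -/
def cr (a : k) (i : ℕ) : 𝒜 := a • 1 + a⁻¹ • t.e i

/-- The parameter of a crossing. -/
def par (A : k) (s : Bool) : k := if s then A else A⁻¹

/-- The value of a slice. -/
def slice (A : k) : Slice → 𝒜
  | ⟨.cup _, i⟩ => t.u i
  | ⟨.cap, i⟩ => t.c i
  | ⟨.cross s, i⟩ => t.cr (par A s) i

/-- The value of a word. -/
def ev (A : k) (w : Word) : 𝒜 := (w.map (t.slice A)).prod

lemma ev_append (A : k) (v w : Word) : t.ev A (v ++ w) = t.ev A v * t.ev A w := by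
  simp [ev]

lemma ev_cons (A : k) (g : Slice) (w : Word) : t.ev A (g :: w) = t.slice A g * t.ev A w := by
  simp [ev]

@[simp] lemma ev_nil (A : k) : t.ev A [] = 1 := rfl

-- The two summands of a crossing are its two splittings, so multiplying out the product runs over
-- all states.
open LaurentPolynomial in
lemma ev_eq_sumBool (A : k) (hA : A ≠ 0) (w : Word) :
    t.ev A w = sumBool (crossings w) fun l => (A ^ pmSum l) • t.evF (resolve w l) := by
  induction w with
  | nil => simp [crossings, sumBool, pmSum, resolve]
  | cons g w ih =>
    rw [ev_cons, ih]
    rcases g with ⟨_ | _ | a, i⟩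
    · have : crossings (⟨.cup ‹_›, i⟩ :: w) = crossings w := by simp [crossings, Piece.isCross]
      rw [this, mul_sumBool]
      apply sumBool_congr
      intro l _
      simp [resolve, evF_cons, slice, flat]
    · have : crossings (⟨.cap, i⟩ :: w) = crossings w := by simp [crossings, Piece.isCross]
      rw [this, mul_sumBool]
      apply sumBool_congr
      intro l _
      simp [resolve, evF_cons, slice, flat]
    · have : crossings (⟨.cross a, i⟩ :: w) = crossings w + 1 := by simp [crossings, Piece.isCross]
      rw [this]
      simp only [sumBool, slice, cr, add_mul]
      have h1 : ∀ l, pmSum (true :: l) = 1 + pmSum l := fun l => by simp [pmSum]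
      have h2 : ∀ l, pmSum (false :: l) = -1 + pmSum l := fun l => by simp [pmSum]
      cases a
      -- At `cross false` the parameter is `A⁻¹`, so the hook carries `A`: the positive splitting is
      -- the second summand of the crossing.
      · rw [add_comm]
        congr 1
        · rw [mul_sumBool]
          apply sumBool_congr
          intro l _
          simp [resolve, evF_cons, flat, par, h1, zpow_add₀ hA, smul_smul, e, mul_assoc, mul_comm]
        · rw [mul_sumBool]
          apply sumBool_congr
          intro l _
          simp [resolve, par, h2, zpow_add₀ hA, smul_smul, mul_comm]
      · congr 1
        · rw [mul_sumBool]
          apply sumBool_congr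
          intro l _
          simp [resolve, par, h1, zpow_add₀ hA, smul_smul, mul_comm]
        · rw [mul_sumBool]
          apply sumBool_congr
          intro l _
          simp [resolve, evF_cons, flat, par, h2, zpow_add₀ hA, smul_smul, e, mul_assoc, mul_comm]

end

open LaurentPolynomial in
/-- The value of a closed diagram is its bracket. -/
theorem ev_eq_fullBracket (A : k) (hA : A ≠ 0) (t : TL k 𝒜 (-A ^ 2 - A⁻¹ ^ 2))
    (ι : LaurentPolynomial ℤ →+* k) (hι : ∀ n, ι (T n) = A ^ n) (w : Word) (hw : Fits w 0 0) :
    t.ev A w = algebraMap k 𝒜 (ι (fullBracket w)) := by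
  rw [ev_eq_sumBool t A hA, fullBracket]
  have h2 := map_sumBool (((algebraMap k 𝒜).comp ι : LaurentPolynomial ℤ →+* 𝒜) :
    LaurentPolynomial ℤ →+ 𝒜) (crossings w)
    fun l => T (pmSum l) * loopValue ^ circuits (resolve w l)
  refine Eq.trans ?_ h2.symm
  apply sumBool_congr
  intro l hl
  rw [(t.evF_eq_pow _ (planar_resolve w l 0 0 hw hl)).1]
  have h3 : ι loopValue = -A ^ 2 - A⁻¹ ^ 2 := by
    simp only [loopValue, map_sub, map_neg, hι]
    rw [zpow_neg, inv_pow]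
    norm_cast
    ring
  simp [hι, h3, Algebra.smul_def, Algebra.commutes]

end TL
namespace TL

/-! ### Locality -/

section Locality
variable {k 𝒜 : Type*} [CommRing k] [Ring 𝒜] [Algebra k 𝒜] {δ : k} (t : TL k 𝒜 δ)

/-- Everything to the right of the strand `p` below `x` passes to the right of the strand `q`
above `x`. -/
def RP (x : 𝒜) (p q : ℕ) : Prop :=
  ∀ j, t.u (p + j) * x = x * t.u (q + j) ∧ t.c (p + j) * x = x * t.c (q + j)

/-- A family of elements, indexed by the position, which consists of pieces to the right of that
position. -/
def Loc (X : ℕ → 𝒜) : Prop := ∀ p q y, t.RP y p q → X p * y = y * X q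

variable {t}

lemma RP.one (p : ℕ) : t.RP 1 p p := fun j => by simp

lemma RP.mul {x y : 𝒜} {p q r : ℕ} (hx : t.RP x p q) (hy : t.RP y q r) : t.RP (x * y) p r :=
  fun j => by
    constructor
    · rw [← mul_assoc, (hx j).1, mul_assoc, (hy j).1, mul_assoc]
    · rw [← mul_assoc, (hx j).2, mul_assoc, (hy j).2, mul_assoc]

lemma RP.add {x y : 𝒜} {p q : ℕ} (hx : t.RP x p q) (hy : t.RP y p q) : t.RP (x + y) p q :=
  fun j => by simp only [mul_add, add_mul, (hx j).1, (hx j).2, (hy j).1, (hy j).2, and_self]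

lemma RP.smul {x : 𝒜} {p q : ℕ} (a : k) (hx : t.RP x p q) : t.RP (a • x) p q :=
  fun j => by simp only [mul_smul_comm, smul_mul_assoc, (hx j).1, (hx j).2, and_self]

lemma RP.mono {x : 𝒜} {p q : ℕ} (hx : t.RP x p q) (p' q' d : ℕ) (hp : p' = p + d)
    (hq : q' = q + d) : t.RP x p' q' := fun j => by
  subst hp hq
  have := hx (d + j)
  simpa only [add_assoc] using this

lemma rp_u (i j : ℕ) (h : i ≤ j) : t.RP (t.u i) j (j + 2) := fun l => by
  rw [add_right_comm]
  exact ⟨t.uu i (j + l) (by omega), t.cu i (j + l) (by omega)⟩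

lemma rp_c (i j : ℕ) (h : i ≤ j) : t.RP (t.c i) (j + 2) j := fun l => by
  rw [add_right_comm]
  exact ⟨t.uc i (j + l) (by omega), t.cc i (j + l) (by omega)⟩

lemma rp_e (i j : ℕ) (h : i + 2 ≤ j) : t.RP (t.e i) j j := by
  obtain ⟨d, rfl⟩ := Nat.exists_eq_add_of_le' h
  exact ((rp_c i _ (by omega)).mul (rp_u i (d + i) (by omega)) : t.RP _ (d + i + 2) _)

/-- `Loc` is closed under products, sums, scalar multiples and shifts. Far commutation of nested
cups, bundles of crossings and the like thus reduces to that of single cups and caps. -/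
lemma Loc.one : t.Loc fun _ => 1 := fun _ _ _ _ => by simp

lemma Loc.mul {X Y : ℕ → 𝒜} (hX : t.Loc X) (hY : t.Loc Y) : t.Loc fun p => X p * Y p :=
  fun p q y h => by
    dsimp only
    rw [mul_assoc, hY p q y h, ← mul_assoc, hX p q y h, mul_assoc]

lemma Loc.add {X Y : ℕ → 𝒜} (hX : t.Loc X) (hY : t.Loc Y) : t.Loc fun p => X p + Y p :=
  fun p q y h => by
    dsimp only
    rw [add_mul, mul_add, hX p q y h, hY p q y h]

lemma Loc.smul {X : ℕ → 𝒜} (a : k) (hX : t.Loc X) : t.Loc fun p => a • X p :=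
  fun p q y h => by
    dsimp only
    rw [smul_mul_assoc, mul_smul_comm, hX p q y h]

lemma Loc.shift {X : ℕ → 𝒜} (hX : t.Loc X) (d : ℕ) : t.Loc fun p => X (p + d) :=
  fun p q y h => hX _ _ _ (h.mono _ _ d rfl rfl)

lemma loc_u : t.Loc t.u := fun _ _ _ h => (h 0).1
lemma loc_c : t.Loc t.c := fun _ _ _ h => (h 0).2
lemma loc_e : t.Loc t.e := loc_c.mul loc_u

variable (t)

lemma e_comm (i j : ℕ) (h : i + 2 ≤ j) : t.e j * t.e i = t.e i * t.e j :=
  loc_e _ _ _ (rp_e i j h)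

lemma e_mul_e (i : ℕ) : t.e i * t.e i = algebraMap k 𝒜 δ * t.e i := by
  rw [e, mul_assoc, ← mul_assoc (t.u i), t.loop, Algebra.left_comm]

lemma u_mul_e (i : ℕ) : t.u i * t.e i = algebraMap k 𝒜 δ * t.u i := by
  rw [e, ← mul_assoc, t.loop]

lemma e_mul_c (i : ℕ) : t.e i * t.c i = algebraMap k 𝒜 δ * t.c i := by
  rw [e, mul_assoc, t.loop, Algebra.commutes]

lemma u_mul_e_succ (i : ℕ) : t.u i * t.e (i + 1) = t.u (i + 1) := by
  rw [e, ← mul_assoc, t.zigL, one_mul]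

lemma u_succ_mul_e (i : ℕ) : t.u (i + 1) * t.e i = t.u i := by
  rw [e, ← mul_assoc, t.zigR, one_mul]

lemma e_succ_mul_c (i : ℕ) : t.e (i + 1) * t.c i = t.c (i + 1) := by
  rw [e, mul_assoc, t.zigR, mul_one]

lemma e_mul_c_succ (i : ℕ) : t.e i * t.c (i + 1) = t.c i := by
  rw [e, mul_assoc, t.zigL, mul_one]

lemma e_succ_e_e_succ (i : ℕ) : t.e (i + 1) * t.e i * t.e (i + 1) = t.e (i + 1) := by
  change t.c (i + 1) * t.u (i + 1) * t.e i * t.e (i + 1) = t.c (i + 1) * t.u (i + 1)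
  rw [mul_assoc (t.c _), t.u_succ_mul_e, mul_assoc, t.u_mul_e_succ]

/-! ### Nested cups and caps -/

/-- Nested cups. -/
def U : ℕ → ℕ → 𝒜
  | 0, _ => 1
  | r + 1, p => t.u p * U r (p + 1)

/-- Nested caps. -/
def C : ℕ → ℕ → 𝒜
  | 0, _ => 1
  | r + 1, p => C r (p + 1) * t.c p

lemma U_snoc (r : ℕ) : ∀ p, t.U (r + 1) p = t.U r p * t.u (p + r) := by
  induction r with
  | zero => intro p; simp [U]
  | succ r ih =>
    intro p
    rw [U, ih, U, mul_assoc]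
    congr 3; omega

lemma C_cons (r : ℕ) : ∀ p, t.C (r + 1) p = t.c (p + r) * t.C r p := by
  induction r with
  | zero => intro p; simp [C]
  | succ r ih =>
    intro p
    rw [C, ih, C, mul_assoc]
    congr 2; omega

variable {t}

lemma loc_U (r : ℕ) : t.Loc (t.U r) := by
  induction r with
  | zero => exact Loc.one
  | succ r ih => exact loc_u.mul (ih.shift 1)

lemma loc_C (r : ℕ) : t.Loc (t.C r) := by
  induction r with
  | zero => exact Loc.one
  | succ r ih => exact (ih.shift 1).mul loc_c

lemma rp_U (r : ℕ) : ∀ p q, p ≤ q → t.RP (t.U r p) q (q + 2 * r) := by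
  induction r with
  | zero => intro p q _; exact RP.one _
  | succ r ih =>
    intro p q h
    exact ((rp_u p q h).mul (ih (p + 1) (q + 2) (by omega))).mono _ _ 0 (by omega) (by omega)

lemma rp_C (r : ℕ) : ∀ p q, p ≤ q → t.RP (t.C r p) (q + 2 * r) q := by
  induction r with
  | zero => intro p q _; exact RP.one _
  | succ r ih =>
    intro p q h
    exact ((ih (p + 1) (q + 2) (by omega)).mul (rp_c p q h)).mono _ _ 0 (by omega) (by omega)

variable (t)

lemma U_mul_C (r : ℕ) : ∀ p, t.U r p * t.C r p = algebraMap k 𝒜 (δ ^ r) := by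
  induction r with
  | zero => intro p; simp [U, C]
  | succ r ih =>
    intro p
    rw [U, C, mul_assoc, ← mul_assoc (t.U r _), ih, Algebra.left_comm, t.loop, ← map_mul, pow_succ]

/-- The outermost cup is straightened first: its cap is moved down through the inner cups, and
`t.zigL` applies. -/
lemma U_zigL (r : ℕ) : ∀ p, t.U r p * t.C r (p + r) = 1 := by
  induction r with
  | zero => intro p; simp [U, C]
  | succ r ih =>
    intro p
    rw [U, C_cons, mul_assoc, ← mul_assoc (t.U r _)]
    have h := (rp_U r (p + 1) (p + 1) le_rfl : t.RP _ _ _) 0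
    rw [show p + (r + 1) + r = p + 1 + 2 * r + 0 by ring, ← h.2, mul_assoc, ← mul_assoc (t.u p)]
    rw [show p + 1 + 0 = p + 1 by ring, t.zigL, one_mul, show p + (r + 1) = p + 1 + r by ring, ih]

lemma U_zigR (r : ℕ) : ∀ p, t.U r (p + r) * t.C r p = 1 := by
  induction r with
  | zero => intro p; simp [U, C]
  | succ r ih =>
    intro p
    rw [U, C_cons, mul_assoc, ← mul_assoc (t.U r _)]
    have h := loc_U (t := t) r _ _ _ (rp_c (p + r) (p + r) le_rfl)
    rw [show p + (r + 1) + 1 = p + r + 2 by ring, h, mul_assoc, ← mul_assoc (t.u _),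
      show p + (r + 1) = p + r + 1 by ring, t.zigR, one_mul, ih]

/-- Replacing every strand by `r` parallel strands. -/
def cable (r : ℕ) : TL k 𝒜 (δ ^ r) where
  u i := t.U r (r * i)
  c i := t.C r (r * i)
  loop i := t.U_mul_C r _
  zigL i := t.U_zigL r _
  zigR i := t.U_zigR r _
  uu i j h := loc_U r _ _ _
    ((rp_U r _ _ (Nat.mul_le_mul_left r h)).mono _ _ 0 rfl (by ring))
  cu i j h := loc_C r _ _ _
    ((rp_U r _ _ (Nat.mul_le_mul_left r h)).mono _ _ 0 rfl (by ring))
  uc i j h := loc_U r _ _ _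
    ((rp_C r _ _ (Nat.mul_le_mul_left r h)).mono _ _ 0 (by ring) rfl)
  cc i j h := loc_C r _ _ _
    ((rp_C r _ _ (Nat.mul_le_mul_left r h)).mono _ _ 0 (by ring) rfl)

/-! Bending nested cups and caps. -/

/-- Joining two neighbouring left legs by a cap connects their partners on the right to a single
arc, which is a cup between the remaining right legs. -/
lemma U_mul_c_left (r : ℕ) : ∀ p l, l ≤ r →
    t.U (r + 2) p * t.c (p + l) = t.U r p * t.u (p + 2 * r - l) := by
  induction r with
  | zero =>
    intro p l h
    obtain rfl : l = 0 := by omega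
    simp only [U, mul_one, one_mul, mul_assoc, add_zero, t.zigR]
    simp
  | succ r ih =>
    intro p l h
    rcases l with _ | l
    · have h1 := loc_U (t := t) (r + 1) _ _ _ (rp_c p p le_rfl)
      rw [U, U, mul_assoc, mul_assoc]
      simp only [add_zero]
      rw [show p + 1 + 1 = p + 2 by ring, h1, ← mul_assoc (t.u (p + 1)), t.zigR, one_mul]
      have h2 := (rp_U (r + 1) p p le_rfl : t.RP _ _ _) 0
      exact h2.1
    · rw [U, mul_assoc, show p + (l + 1) = p + 1 + l by ring, ih _ _ (by omega), U, mul_assoc]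
      congr 3; omega

lemma U_mul_c_right (r : ℕ) : ∀ p l, l ≤ r →
    t.U (r + 2) p * t.c (p + 2 * r + 2 - l) = t.U r p * t.u (p + l) := by
  intro p l
  induction l generalizing r p with
  | zero =>
    intro _
    have h1 := (rp_U r (p + 2) (p + 2) le_rfl : t.RP _ _ _) 0
    rw [U, U, mul_assoc, mul_assoc, show p + 2 * r + 2 - 0 = p + 2 + 2 * r + 0 by omega,
      show p + 1 + 1 = p + 2 by ring, ← h1.2, ← mul_assoc (t.u (p + 1)),
      show p + 2 + 0 = p + 1 + 1 by ring, t.zigL, one_mul, add_zero]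
    exact (loc_U r _ _ _ (rp_u p p le_rfl)).symm
  | succ l ih =>
    intro h
    obtain ⟨r, rfl⟩ : ∃ r', r = r' + 1 := ⟨r - 1, by omega⟩
    rw [U, mul_assoc, show p + 2 * (r + 1) + 2 - (l + 1) = p + 1 + 2 * r + 2 - l by omega,
      ih r _ (by omega), U, mul_assoc]
    congr 3; omega

lemma u_mul_C_left (r : ℕ) : ∀ p l, l ≤ r →
    t.u (p + l) * t.C (r + 2) p = t.c (p + 2 * r - l) * t.C r p := by
  intro p l
  induction l generalizing r p with
  | zero =>
    intro _
    have h1 := loc_C (t := t) (r + 1) _ _ _ (rp_u p p le_rfl)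
    rw [C, C, add_zero, mul_assoc, show p + 1 + 1 = p + 2 by ring, ← mul_assoc,
      ← loc_C (t := t) r _ _ _ (rp_u p p le_rfl), mul_assoc, ← mul_assoc (t.u p), t.zigL, one_mul]
    have h2 := (rp_C r p p le_rfl : t.RP _ _ _) 0
    exact h2.2.symm
  | succ l ih =>
    intro h
    obtain ⟨r, rfl⟩ : ∃ r', r = r' + 1 := ⟨r - 1, by omega⟩
    rw [C, ← mul_assoc, show p + (l + 1) = p + 1 + l by ring,
      ih r _ (by omega), C, mul_assoc]
    congr 2; omega

lemma u_mul_C_right (r : ℕ) : ∀ p l, l ≤ r →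
    t.u (p + 2 * r + 2 - l) * t.C (r + 2) p = t.c (p + l) * t.C r p := by
  intro p l
  induction l generalizing r p with
  | zero =>
    intro _
    have h1 := (rp_C r (p + 2) (p + 2) le_rfl : t.RP _ _ _) 0
    rw [C, C, mul_assoc, ← mul_assoc, show p + 2 * r + 2 - 0 = p + 2 + 2 * r + 0 by omega,
      show p + 1 + 1 = p + 2 by ring, h1.1, mul_assoc, ← mul_assoc (t.u _),
      show p + 2 + 0 = p + 1 + 1 by ring, t.zigR, one_mul, add_zero]
    exact loc_C r _ _ _ (rp_c p p le_rfl)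
  | succ l ih =>
    intro h
    obtain ⟨r, rfl⟩ : ∃ r', r = r' + 1 := ⟨r - 1, by omega⟩
    rw [C, ← mul_assoc, show p + 2 * (r + 1) + 2 - (l + 1) = p + 1 + 2 * r + 2 - l by omega,
      ih r _ (by omega), C, mul_assoc]
    congr 2; omega

/-- A hook on the left legs of nested cups slides to the right legs. -/
lemma U_mul_e (r p l : ℕ) (h : l ≤ r) :
    t.U (r + 2) p * t.e (p + l) = t.U (r + 2) p * t.e (p + 2 * r + 2 - l) := by
  rw [e, e, ← mul_assoc, ← mul_assoc, t.U_mul_c_left r p l h, t.U_mul_c_right r p l h,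
    mul_assoc, mul_assoc, t.uu (p + l) (p + 2 * r - l) (by omega)]
  congr 3; omega

lemma e_mul_C (r p l : ℕ) (h : l ≤ r) :
    t.e (p + l) * t.C (r + 2) p = t.e (p + 2 * r + 2 - l) * t.C (r + 2) p := by
  rw [e, e, mul_assoc, mul_assoc, t.u_mul_C_left r p l h, t.u_mul_C_right r p l h,
    ← mul_assoc, ← mul_assoc, ← t.cc (p + l) (p + 2 * r - l) (by omega)]
  congr 3; omega

end Locality
end TL
namespace TL

/-! ### Crossings of bundles -/

section Crossings
variable {k 𝒜 : Type*} [Field k] [Ring 𝒜] [Algebra k 𝒜] {δ : k} {t : TL k 𝒜 δ}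

lemma rp_cr (a : k) (i j : ℕ) (h : i + 2 ≤ j) : t.RP (t.cr a i) j j :=
  ((RP.one j).smul a).add ((rp_e i j h).smul a⁻¹)

lemma loc_cr (a : k) : t.Loc (t.cr a) := (Loc.one.smul a).add (loc_e.smul a⁻¹)

variable (t)

/-- A crossing is a polynomial in a hook, so whatever slides past hooks slides past crossings. This
is how Reidemeister moves for bundles reduce to sliding hooks. -/
lemma cr_intertwine (a : k) (x : 𝒜) (i j : ℕ) (h : t.e i * x = x * t.e j) :
    t.cr a i * x = x * t.cr a j := by
  simp only [cr, add_mul, mul_add, smul_mul_assoc, mul_smul_comm, one_mul, mul_one, h]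

variable {a : k} (ha : a ≠ 0) (hδ : δ = -a ^ 2 - a⁻¹ ^ 2)

-- The second Reidemeister move: the coefficient of the hook is `a² + a⁻² + δ`, which vanishes for
-- this loop value.
include ha hδ in
lemma cr_mul_cr_inv (i : ℕ) : t.cr a i * t.cr a⁻¹ i = 1 := by
  simp only [cr, add_mul, mul_add, smul_mul_assoc, mul_smul_comm, one_mul, mul_one, inv_inv,
    e_mul_e, smul_smul, ← Algebra.smul_def, hδ, smul_add]
  match_scalars <;> field_simp <;> ring

include ha hδ in
lemma u_mul_cr (i : ℕ) : t.u i * t.cr a i = (-a⁻¹ ^ 3) • t.u i := by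
  simp only [cr, mul_add, mul_smul_comm, mul_one, u_mul_e, ← Algebra.smul_def, smul_smul, hδ,
    ← add_smul]
  congr 1; field_simp; ring

include ha hδ in
lemma cr_mul_c (i : ℕ) : t.cr a i * t.c i = (-a⁻¹ ^ 3) • t.c i := by
  simp only [cr, add_mul, smul_mul_assoc, one_mul, e_mul_c, ← Algebra.smul_def, smul_smul, hδ,
    ← add_smul]
  congr 1; field_simp; ring

-- A cup is pulled across a strand. All naturality statements for bundles rest on this lemma and its
-- three variants.
include ha hδ in
lemma u_succ_mul_cr_cr (i : ℕ) : t.u (i + 1) * (t.cr a i * t.cr a (i + 1)) = t.u i := by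
  have h : t.u (i + 1) * t.cr a i = a • t.u (i + 1) + a⁻¹ • t.u i := by
    simp [cr, mul_add, u_succ_mul_e]
  rw [← mul_assoc, h]
  simp only [cr, mul_add, add_mul, smul_mul_assoc, mul_smul_comm, mul_one, u_mul_e, u_mul_e_succ,
    ← Algebra.smul_def, smul_smul, hδ, smul_add]
  match_scalars <;> field_simp <;> ring

include ha hδ in
lemma u_mul_cr_cr (i : ℕ) : t.u i * (t.cr a (i + 1) * t.cr a i) = t.u (i + 1) := by
  have h : t.u i * t.cr a (i + 1) = a • t.u i + a⁻¹ • t.u (i + 1) := by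
    simp [cr, mul_add, u_mul_e_succ]
  rw [← mul_assoc, h]
  simp only [cr, mul_add, add_mul, smul_mul_assoc, mul_smul_comm, mul_one, u_mul_e, u_succ_mul_e,
    ← Algebra.smul_def, smul_smul, hδ, smul_add]
  match_scalars <;> field_simp <;> ring

include ha hδ in
lemma cr_cr_mul_c (i : ℕ) : t.cr a i * (t.cr a (i + 1) * t.c i) = t.c (i + 1) := by
  have h : t.cr a (i + 1) * t.c i = a • t.c i + a⁻¹ • t.c (i + 1) := by
    simp [cr, add_mul, e_succ_mul_c]
  rw [h]
  simp only [cr, mul_add, add_mul, smul_mul_assoc, mul_smul_comm, one_mul, e_mul_c, e_mul_c_succ,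
    ← Algebra.smul_def, smul_smul, hδ, smul_add]
  match_scalars <;> field_simp <;> ring

include ha hδ in
lemma cr_cr_mul_c_succ (i : ℕ) : t.cr a (i + 1) * (t.cr a i * t.c (i + 1)) = t.c i := by
  have h : t.cr a i * t.c (i + 1) = a • t.c (i + 1) + a⁻¹ • t.c i := by
    simp [cr, add_mul, e_mul_c_succ]
  rw [h]
  simp only [cr, mul_add, add_mul, smul_mul_assoc, mul_smul_comm, one_mul, e_mul_c, e_succ_mul_c,
    ← Algebra.smul_def, smul_smul, hδ, smul_add]
  match_scalars <;> field_simp <;> ring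

/-- One strand crossing `n` strands. -/
def row (a : k) : ℕ → ℕ → 𝒜
  | _, 0 => 1
  | p, n + 1 => t.cr a p * row a (p + 1) n

/-- A bundle of `m` strands crossing a bundle of `n` strands. -/
def B (a : k) : ℕ → ℕ → ℕ → 𝒜
  | _, 0, _ => 1
  | p, m + 1, n => B a (p + 1) m n * t.row a p n

/-- A bundle of `m` strands crossing one strand. -/
def col (a : k) : ℕ → ℕ → 𝒜
  | _, 0 => 1
  | p, m + 1 => col a (p + 1) m * t.cr a p

lemma row_snoc (a : k) (n : ℕ) : ∀ p, t.row a p (n + 1) = t.row a p n * t.cr a (p + n) := by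
  induction n with
  | zero => intro p; simp [row]
  | succ n ih =>
    intro p
    rw [row, ih, row, mul_assoc]
    congr 3; omega

lemma col_cons (a : k) (n : ℕ) : ∀ p, t.col a p (n + 1) = t.cr a (p + n) * t.col a p n := by
  induction n with
  | zero => intro p; simp [col]
  | succ n ih =>
    intro p
    rw [col, ih, col, mul_assoc]
    congr 2; omega

lemma row_add (a : k) (n n' : ℕ) : ∀ p, t.row a p (n + n') = t.row a p n * t.row a (p + n) n' := by
  induction n with
  | zero => intro p; simp [row]
  | succ n ih =>
    intro p
    rw [Nat.add_right_comm, row, ih, row, mul_assoc]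
    congr 3; omega

lemma col_add (a : k) (n n' : ℕ) : ∀ p, t.col a p (n + n') = t.col a (p + n) n' * t.col a p n := by
  induction n with
  | zero => intro p; simp [col]
  | succ n ih =>
    intro p
    rw [Nat.add_right_comm, col, ih, col, mul_assoc]
    congr 2; omega

lemma B_add (a : k) (m m' n : ℕ) : ∀ p, t.B a p (m + m') n = t.B a (p + m) m' n * t.B a p m n := by
  induction m with
  | zero => intro p; simp [B]
  | succ n ih =>
    intro p
    rw [Nat.add_right_comm, B, ih, B, mul_assoc]
    congr 2; omega

variable {t}

lemma loc_row (a : k) (n : ℕ) : t.Loc fun p => t.row a p n := by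
  induction n with
  | zero => exact Loc.one
  | succ r ih => exact (loc_cr a).mul (ih.shift 1)

lemma loc_col (a : k) (n : ℕ) : t.Loc fun p => t.col a p n := by
  induction n with
  | zero => exact Loc.one
  | succ r ih => exact (ih.shift 1).mul (loc_cr a)

lemma loc_B (a : k) (m n : ℕ) : t.Loc fun p => t.B a p m n := by
  induction m with
  | zero => exact Loc.one
  | succ r ih => exact (ih.shift 1).mul (loc_row a n)

lemma rp_row (a : k) (n : ℕ) : ∀ p q, p + n + 1 ≤ q → t.RP (t.row a p n) q q := by
  induction n with
  | zero => intro p q _; exact RP.one _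
  | succ n ih => intro p q h; exact (rp_cr a p q (by omega)).mul (ih _ _ (by omega))

lemma rp_col (a : k) (n : ℕ) : ∀ p q, p + n + 1 ≤ q → t.RP (t.col a p n) q q := by
  induction n with
  | zero => intro p q _; exact RP.one _
  | succ n ih => intro p q h; exact (ih _ _ (by omega)).mul (rp_cr a p q (by omega))

lemma rp_B (a : k) (m n : ℕ) : ∀ p q, p + m + n ≤ q → t.RP (t.B a p m n) q q := by
  induction m with
  | zero => intro p q _; exact RP.one _
  | succ m ih => intro p q h; exact (ih _ _ (by omega)).mul (rp_row a n p q (by omega))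

variable (t)

/-- `B` is built from rows; this and `B_succ_left` decompose it into columns, which gives induction
on the second bundle. -/
lemma B_succ_right (a : k) (m n : ℕ) :
    ∀ p, t.B a p m (n + 1) = t.B a p m n * t.col a (p + n) m := by
  induction m with
  | zero => intro p; simp [B, col]
  | succ m ih =>
    intro p
    have h := loc_col (t := t) a m _ _ _ (rp_row (t := t) a n p (p + n + 1) le_rfl)
    dsimp only at h
    rw [B, ih, B, col, row_snoc, mul_assoc, ← mul_assoc (t.col _ _ _),
      show p + 1 + n = p + n + 1 by ring, h, mul_assoc, mul_assoc]

lemma B_succ_left (a : k) (m n : ℕ) :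
    ∀ p, t.B a p m (n + 1) = t.col a p m * t.B a (p + 1) m n := by
  induction m with
  | zero => intro p; simp [B, col]
  | succ m ih =>
    intro p
    have h := loc_B (t := t) a m n _ _ _ (rp_cr (t := t) a p (p + 2) le_rfl)
    dsimp only at h
    rw [B, ih, B, col, row, mul_assoc, ← mul_assoc (t.B _ _ _ _),
      show p + 1 + 1 = p + 2 by ring, h, mul_assoc, mul_assoc]

lemma B_zero (a : k) (m : ℕ) : ∀ p, t.B a p m 0 = 1 := by
  induction m with
  | zero => intro p; rfl
  | succ m ih => intro p; simp [B, ih, row]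

lemma B_one_right (a : k) (m p : ℕ) : t.B a p m 1 = t.col a p m := by
  rw [B_succ_left, B_zero, mul_one]

lemma B_add_right (a : k) (m n n' : ℕ) (p : ℕ) :
    t.B a p m (n + n') = t.B a p m n * t.B a (p + n) m n' := by
  induction n' with
  | zero => simp [B_zero]
  | succ n' ih => rw [← add_assoc, B_succ_right, ih, B_succ_right, mul_assoc, add_assoc]

/-! Naturality. -/

include ha hδ

/-- If the cup sits on the first two of the crossed strands, it is pulled across by
`u_succ_mul_cr_cr`; otherwise the first crossing lies to the left of the cup and can be split off.
-/
lemma u_row (n : ℕ) : ∀ p l, l ≤ n →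
    t.u (p + 1 + l) * t.row a p (n + 2) = t.row a p n * t.u (p + l) := by
  intro p l
  induction l generalizing p n with
  | zero =>
    intro _
    have h := loc_row (t := t) a n _ _ _ (rp_u p p le_rfl)
    dsimp only at h
    rw [row, row, ← mul_assoc (t.cr a p), ← mul_assoc, add_zero, add_zero,
      t.u_succ_mul_cr_cr ha hδ, h]
  | succ l ih =>
    intro h
    obtain ⟨n, rfl⟩ : ∃ n', n = n' + 1 := ⟨n - 1, by omega⟩
    have h1 := (rp_cr (t := t) a p (p + 2) le_rfl) l
    rw [show n + 1 + 2 = (n + 2) + 1 by ring, row, ← mul_assoc,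
      show p + 1 + (l + 1) = p + 2 + l by ring, h1.1, mul_assoc,
      show p + 2 + l = p + 1 + 1 + l by ring, ih n _ (by omega), row, mul_assoc]
    congr 3; omega

lemma c_row (n : ℕ) : ∀ p l, l ≤ n →
    t.c (p + 1 + l) * t.row a p n = t.row a p (n + 2) * t.c (p + l) := by
  intro p l
  induction l generalizing p n with
  | zero =>
    intro _
    have h := loc_row (t := t) a n _ _ _ (rp_c p p le_rfl)
    dsimp only at h
    rw [row, row, mul_assoc, mul_assoc, add_zero, add_zero, show p + 1 + 1 = p + 2 by ring, h,
      ← mul_assoc (t.cr a (p + 1)), ← mul_assoc, t.cr_cr_mul_c ha hδ]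
  | succ l ih =>
    intro h
    obtain ⟨n, rfl⟩ : ∃ n', n = n' + 1 := ⟨n - 1, by omega⟩
    have h1 := (rp_cr (t := t) a p (p + 2) le_rfl) l
    have h2 := ih n (p + 1) (by omega)
    rw [show p + 1 + 1 + l = p + 2 + l by ring] at h2
    rw [row, ← mul_assoc, show p + 1 + (l + 1) = p + 2 + l by ring, h1.2, mul_assoc, h2,
      show n + 1 + 2 = (n + 2) + 1 by ring,
      show t.row a p (n + 2 + 1) = t.cr a p * t.row a (p + 1) (n + 2) from rfl, mul_assoc]
    congr 3; omega

lemma u_col (m : ℕ) : ∀ p l, l ≤ m →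
    t.u (p + l) * t.col a p (m + 2) = t.col a p m * t.u (p + 1 + l) := by
  intro p l
  induction m generalizing l with
  | zero =>
    intro h
    obtain rfl : l = 0 := by omega
    simpa [col] using t.u_mul_cr_cr ha hδ p
  | succ m ih =>
    intro h
    rcases Nat.lt_or_ge l (m + 1) with h1 | h1
    · have h2 := loc_cr (t := t) a _ _ _ (rp_u (p + l) (p + m) (by omega))
      rw [col_cons, ← mul_assoc, show p + (m + 1 + 1) = p + m + 2 by ring, ← h2, mul_assoc,
        ih l (by omega), col_cons, mul_assoc]
    · obtain rfl : l = m + 1 := by omega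
      have h3 := (rp_col (t := t) a (m + 1) p (p + (m + 1) + 1) le_rfl) 0
      rw [col_cons, col_cons, ← mul_assoc (t.cr a _), ← mul_assoc,
        show p + (m + 1 + 1) = p + (m + 1) + 1 by ring, t.u_mul_cr_cr ha hδ]
      rw [show p + 1 + (m + 1) = p + (m + 1) + 1 + 0 by ring, ← h3.1]

lemma c_col (m : ℕ) : ∀ p l, l ≤ m →
    t.c (p + l) * t.col a p m = t.col a p (m + 2) * t.c (p + 1 + l) := by
  intro p l
  induction m generalizing l with
  | zero =>
    intro h
    obtain rfl : l = 0 := by omega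
    simpa [col, mul_assoc] using (t.cr_cr_mul_c_succ ha hδ p).symm
  | succ m ih =>
    intro h
    rcases Nat.lt_or_ge l (m + 1) with h1 | h1
    · have h2 := loc_cr (t := t) a _ _ _ (rp_c (p + l) (p + m) (by omega))
      rw [col_cons _ a m, ← mul_assoc, ← h2, mul_assoc,
        ih l (by omega), col_cons _ a (m + 2), mul_assoc]
      congr 2
    · obtain rfl : l = m + 1 := by omega
      have h3 := (rp_col (t := t) a (m + 1) p (p + (m + 1) + 1) le_rfl) 0
      rw [col_cons _ a (m + 1 + 1), col_cons _ a (m + 1), mul_assoc, mul_assoc,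
        show p + 1 + (m + 1) = p + (m + 1) + 1 + 0 by ring, ← h3.2,
        show p + (m + 1 + 1) = p + (m + 1) + 1 by ring, add_zero,
        ← mul_assoc (t.cr a (p + (m + 1))), ← mul_assoc, t.cr_cr_mul_c_succ ha hδ]

lemma u_B_right (m n : ℕ) : ∀ p l, l ≤ n →
    t.u (p + m + l) * t.B a p m (n + 2) = t.B a p m n * t.u (p + l) := by
  induction m with
  | zero => intro p l _; simp [B]
  | succ m ih =>
    intro p l h
    rw [B, ← mul_assoc, show p + (m + 1) + l = p + 1 + m + l by ring, ih _ _ h, mul_assoc,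
      t.u_row ha hδ n p l h, ← mul_assoc]
    rfl

lemma c_B_right (m n : ℕ) : ∀ p l, l ≤ n →
    t.c (p + m + l) * t.B a p m n = t.B a p m (n + 2) * t.c (p + l) := by
  induction m with
  | zero => intro p l _; simp [B]
  | succ m ih =>
    intro p l h
    rw [B, ← mul_assoc, show p + (m + 1) + l = p + 1 + m + l by ring, ih _ _ h, mul_assoc,
      t.c_row ha hδ n p l h, ← mul_assoc]
    rfl

lemma u_B_left (m n : ℕ) : ∀ p l, l ≤ m →
    t.u (p + l) * t.B a p (m + 2) n = t.B a p m n * t.u (p + n + l) := by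
  induction n with
  | zero => intro p l _; simp [B_zero]
  | succ n ih =>
    intro p l h
    rw [B_succ_right, ← mul_assoc, ih p l h, mul_assoc, t.u_col ha hδ m _ l h, ← mul_assoc,
      ← B_succ_right]
    rfl

lemma c_B_left (m n : ℕ) : ∀ p l, l ≤ m →
    t.c (p + l) * t.B a p m n = t.B a p (m + 2) n * t.c (p + n + l) := by
  induction n with
  | zero => intro p l _; simp [B_zero]
  | succ n ih =>
    intro p l h
    rw [B_succ_right, ← mul_assoc, ih p l h, mul_assoc, t.c_col ha hδ m _ l h, ← mul_assoc,
      ← B_succ_right]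
    rfl

lemma e_B_right (m n p l : ℕ) (h : l + 2 ≤ n) :
    t.e (p + m + l) * t.B a p m n = t.B a p m n * t.e (p + l) := by
  obtain ⟨n, rfl⟩ : ∃ n', n = n' + 2 := ⟨n - 2, by omega⟩
  rw [e, e, mul_assoc, t.u_B_right ha hδ m n p l (by omega), ← mul_assoc,
    t.c_B_right ha hδ m n p l (by omega), mul_assoc]

lemma e_B_left (m n p l : ℕ) (h : l + 2 ≤ m) :
    t.e (p + l) * t.B a p m n = t.B a p m n * t.e (p + n + l) := by
  obtain ⟨m, rfl⟩ : ∃ n', m = n' + 2 := ⟨m - 2, by omega⟩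
  rw [e, e, mul_assoc, t.u_B_left ha hδ m n p l (by omega), ← mul_assoc,
    t.c_B_left ha hδ m n p l (by omega), mul_assoc]

lemma U_B_right (r m n : ℕ) : ∀ p l, l ≤ n →
    t.U r (p + m + l) * t.B a p m (n + 2 * r) = t.B a p m n * t.U r (p + l) := by
  induction r generalizing n with
  | zero => intro p l _; simp [U]
  | succ r ih =>
    intro p l h
    rw [U, U, mul_assoc, show n + 2 * (r + 1) = n + 2 + 2 * r by ring,
      show p + m + l + 1 = p + m + (l + 1) by ring, ih _ _ _ (by omega), ← mul_assoc,
      t.u_B_right ha hδ m n p l h, mul_assoc]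
    rfl

lemma C_B_right (r m n : ℕ) : ∀ p l, l ≤ n →
    t.C r (p + m + l) * t.B a p m n = t.B a p m (n + 2 * r) * t.C r (p + l) := by
  induction r generalizing n with
  | zero => intro p l _; simp [C]
  | succ r ih =>
    intro p l h
    rw [C, C, mul_assoc, t.c_B_right ha hδ m n p l h, ← mul_assoc,
      show n + 2 * (r + 1) = n + 2 + 2 * r by ring,
      show p + m + l + 1 = p + m + (l + 1) by ring, ih _ _ _ (by omega), mul_assoc]
    rfl

lemma U_B_left (r m n : ℕ) : ∀ p l, l ≤ m →
    t.U r (p + l) * t.B a p (m + 2 * r) n = t.B a p m n * t.U r (p + n + l) := by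
  induction r generalizing m with
  | zero => intro p l _; simp [U]
  | succ r ih =>
    intro p l h
    rw [U, U, mul_assoc, show m + 2 * (r + 1) = m + 2 + 2 * r by ring,
      show p + l + 1 = p + (l + 1) by ring, ih _ _ _ (by omega), ← mul_assoc,
      t.u_B_left ha hδ m n p l h, mul_assoc]
    rfl

omit hδ ha in
lemma row_intertwine (b : k) (x : 𝒜) (n : ℕ) : ∀ i j : ℕ,
    (∀ l < n, t.e (i + l) * x = x * t.e (j + l)) → t.row b i n * x = x * t.row b j n := by
  induction n with
  | zero => intro i j _; simp [row]
  | succ n ih =>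
    intro i j h
    rw [row, row, mul_assoc, ih _ (j + 1), ← mul_assoc, t.cr_intertwine b x i j (h 0 (by omega)),
      mul_assoc]
    intro l hl
    have := h (l + 1) (by omega)
    rwa [show i + (l + 1) = i + 1 + l by ring, show j + (l + 1) = j + 1 + l by ring] at this

-- The analogue of `cr_intertwine` for a bundle crossing, with all hooks inside the `m + n` strands.
omit hδ ha in
lemma B_intertwine (b : k) (x : 𝒜) (m n : ℕ) : ∀ i j : ℕ,
    (∀ l, l + 2 ≤ m + n → t.e (i + l) * x = x * t.e (j + l)) →
      t.B b i m n * x = x * t.B b j m n := by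
  induction m with
  | zero => intro i j _; simp [B]
  | succ m ih =>
    intro i j h
    rw [B, B, mul_assoc, t.row_intertwine b x n i j, ← mul_assoc, ih _ (j + 1), mul_assoc]
    · intro l hl
      have := h (l + 1) (by omega)
      rwa [show i + (l + 1) = i + 1 + l by ring, show j + (l + 1) = j + 1 + l by ring] at this
    · intro l hl
      exact h l (by omega)

lemma row_mul_col (n : ℕ) : ∀ p, t.row a p n * t.col a⁻¹ p n = 1 := by
  induction n with
  | zero => intro p; simp [row, col]
  | succ n ih =>
    intro p
    rw [row_snoc, col_cons, mul_assoc, ← mul_assoc (t.cr a _), t.cr_mul_cr_inv ha hδ, one_mul, ih]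

/-- The second Reidemeister move for bundles. -/
lemma B_mul_B_inv (m n : ℕ) : ∀ p, t.B a p m n * t.B a⁻¹ p n m = 1 := by
  induction m with
  | zero => intro p; simp [B, B_zero]
  | succ m ih =>
    intro p
    rw [B, B_succ_left, mul_assoc, ← mul_assoc (t.row _ _ _), t.row_mul_col ha hδ, one_mul, ih]

/-- Two adjacent bundle crossings with equal parameters form one crossing of a bundle with a bundle
of double width. Hooks on the wide bundle slide through it, and so does any crossing inside that
bundle, whatever its parameter `b`. -/
lemma B_three_left (b : k) (r p : ℕ) :
    t.B a p r r * t.B a (p + r) r r * t.B b p r r =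
      t.B b (p + r) r r * t.B a p r r * t.B a (p + r) r r := by
  rw [mul_assoc (t.B b _ _ _), ← B_add_right]
  refine (t.B_intertwine b _ r r _ _ fun l hl => ?_).symm
  exact t.e_B_right ha hδ r (r + r) p l hl

lemma B_three_right (b : k) (r p : ℕ) :
    t.B b p r r * t.B a (p + r) r r * t.B a p r r =
      t.B a (p + r) r r * t.B a p r r * t.B b (p + r) r r := by
  rw [mul_assoc, ← B_add]
  refine t.B_intertwine b _ r r _ _ fun l hl => ?_
  exact t.e_B_left ha hδ (r + r) r p l hl

/-- Nested cups are pulled across a whole bundle, which creates two grids of inverse crossings; one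
of them cancels against the given grid. -/
lemma B_swingCup (r p : ℕ) :
    t.U r p * t.B a (p + r) r r = t.U r (p + r) * t.B a⁻¹ p r r := by
  have hδ' : δ = -a⁻¹ ^ 2 - a⁻¹⁻¹ ^ 2 := by rw [hδ, inv_inv]; ring
  have h := t.U_B_right (inv_ne_zero ha) hδ' r r 0 p 0 le_rfl
  rw [B_zero, one_mul, zero_add, two_mul, B_add_right, add_zero, add_zero] at h
  rw [← h, mul_assoc, mul_assoc]
  have h2 := t.B_mul_B_inv (inv_ne_zero ha) hδ' r r (p + r)
  rw [inv_inv] at h2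
  rw [h2, mul_one]

lemma B_swingCap (r p : ℕ) :
    t.B a (p + r) r r * t.C r p = t.B a⁻¹ p r r * t.C r (p + r) := by
  have hδ' : δ = -a⁻¹ ^ 2 - a⁻¹⁻¹ ^ 2 := by rw [hδ, inv_inv]; ring
  have h := t.C_B_right ha hδ r r 0 p 0 le_rfl
  rw [B_zero, mul_one, zero_add, two_mul, B_add_right, add_zero, add_zero] at h
  rw [h, mul_assoc, ← mul_assoc (t.B a⁻¹ _ _ _)]
  have h2 := t.B_mul_B_inv (inv_ne_zero ha) hδ' r r p
  rw [inv_inv] at h2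
  rw [h2, one_mul]

end Crossings
end TL
namespace TL

/-! ### Parallels -/

section Parallels
variable {k 𝒜 : Type*} [Field k] [Ring 𝒜] [Algebra k 𝒜] {δ : k} (t : TL k 𝒜 δ)

lemma row_eq_prod (a : k) (n : ℕ) :
    ∀ p, t.row a p n = ((List.range n).map fun l => t.cr a (p + l)).prod := by
  induction n with
  | zero => intro p; simp [row]
  | succ n ih =>
    intro p
    rw [row_snoc, ih, List.range_succ]; simp

lemma col_eq_prod (a : k) (n : ℕ) :
    ∀ p, t.col a p n = ((List.range n).reverse.map fun l => t.cr a (p + l)).prod := by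
  induction n with
  | zero => intro p; simp [col]
  | succ n ih =>
    intro p
    rw [col_cons, ih, List.range_succ]; simp

lemma U_eq_prod (r : ℕ) :
    ∀ p, t.U r p = ((List.range r).map fun l => t.u (p + l)).prod := by
  induction r with
  | zero => intro p; simp [U]
  | succ n ih =>
    intro p
    rw [U_snoc, ih, List.range_succ]; simp

lemma C_eq_prod (r : ℕ) :
    ∀ p, t.C r p = ((List.range r).reverse.map fun l => t.c (p + l)).prod := by
  induction r with
  | zero => intro p; simp [C]
  | succ n ih =>
    intro p
    rw [C_cons, ih, List.range_succ]; simp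

lemma B_eq_prod (a : k) (n m : ℕ) :
    ∀ p, t.B a p m n = ((List.range m).reverse.map fun l => t.row a (p + l) n).prod := by
  induction m with
  | zero => intro p; simp [B]
  | succ m ih =>
    intro p
    have h := B_add t a m 1 n p
    rw [show t.B a (p + m) 1 n = t.row a (p + m) n by simp [B]] at h
    rw [h, ih, List.range_succ]; simp

/-- The value of the `r`-parallel of a piece. -/
def cabP (A : k) (r : ℕ) : Piece → ℕ → 𝒜
  | .cup _ => t.U r
  | .cap => t.C r
  | .cross s => fun p => t.B (par A s) p r r

/-- The value of the `r`-parallel of a slice. -/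
def cabS (A : k) (r : ℕ) (g : Slice) : 𝒜 := t.cabP A r g.piece (r * g.pos)

/-- The value of the `r`-parallel of a word. -/
def cabW (A : k) (r : ℕ) (w : Word) : 𝒜 := (w.map (t.cabS A r)).prod

lemma cabW_append (A : k) (r : ℕ) (v w : Word) :
    t.cabW A r (v ++ w) = t.cabW A r v * t.cabW A r w := by simp [cabW]

lemma cabW_cons (A : k) (r : ℕ) (g : Slice) (w : Word) :
    t.cabW A r (g :: w) = t.cabS A r g * t.cabW A r w := by simp [cabW]

@[simp] lemma cabW_nil (A : k) (r : ℕ) : t.cabW A r [] = 1 := rfl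

lemma ev_parallelSlice (A : k) (r : ℕ) (g : Slice) :
    t.ev A (parallelSlice r g) = t.cabS A r g := by
  rcases g with ⟨_ | _ | s, i⟩
  · simp only [parallelSlice, ev, List.map_map, cabS, cabP, U_eq_prod]
    rfl
  · simp only [parallelSlice, ev, List.map_map, cabS, cabP, C_eq_prod]
    rfl
  · simp only [cabS, cabP, B_eq_prod, row_eq_prod]
    rw [parallelSlice, ev, List.flatMap_def, List.map_flatten, List.prod_flatten, List.map_map,
      List.map_map]
    congr 1
    refine List.map_congr_left fun l _ => ?_
    rw [Function.comp_apply, Function.comp_apply, List.map_map]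
    rfl

lemma ev_parallel (A : k) (r : ℕ) (w : Word) : t.ev A (parallel r w) = t.cabW A r w := by
  induction w with
  | nil => rfl
  | cons g w ih =>
    rw [cabW_cons, ← ih, ← ev_parallelSlice, ← ev_append]; rfl

variable {t}

lemma loc_cabP (A : k) (r : ℕ) (g : Piece) : t.Loc (t.cabP A r g) := by
  rcases g with _ | _ | s
  · exact loc_U r
  · exact loc_C r
  · exact loc_B _ r r

lemma rp_cabP (A : k) (r : ℕ) (g : Piece) (p q : ℕ) (h : p ≤ q) :
    t.RP (t.cabP A r g p) (q + r * g.dom) (q + r * g.cod) := by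
  rcases g with _ | _ | s
  · exact (rp_U r p q h).mono _ _ 0 (by simp [Piece.dom]) (by simp [Piece.cod]; ring)
  · exact (rp_C r p q h).mono _ _ 0 (by simp [Piece.dom]; ring) (by simp [Piece.cod])
  · exact (rp_B _ r r p (p + r * 2) (by omega)).mono _ _ (q - p)
      (by simp only [Piece.dom]; omega) (by simp only [Piece.cod]; omega)

variable (t)

lemma cabW_exchange (A : k) (r : ℕ) (g h : Piece) (i d : ℕ) :
    t.cabW A r [⟨h, i + g.dom + d⟩, ⟨g, i⟩] = t.cabW A r [⟨g, i⟩, ⟨h, i + g.cod + d⟩] := by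
  simp only [cabW, cabS, List.map_cons, List.map_nil, List.prod_cons, List.prod_nil, mul_one]
  exact loc_cabP A r h _ _ _ ((rp_cabP A r g (r * i) (r * i + r * d) (by omega)).mono _ _ 0
    (by ring) (by ring))

/-- The words of a move, other than a first Reidemeister move, have parallels of the same value. -/
theorem cabW_localMove {A : k} (hA : A ≠ 0) (hδ : δ = -A ^ 2 - A⁻¹ ^ 2) (r : ℕ) {x y : Word}
    (h : LocalMove x y) : t.cabW A r x = t.cabW A r y ∨
      (∃ b s i, x = [⟨.cup b, i⟩, ⟨.cross s, i⟩] ∧ y = [⟨.cup !b, i⟩]) ∨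
      (∃ s i, x = [⟨.cross s, i⟩, ⟨.cap, i⟩] ∧ y = [⟨.cap, i⟩]) := by
  have ha : ∀ s, par A s ≠ 0 := fun s => by cases s <;> simp [par, hA]
  have hd : ∀ s, δ = -par A s ^ 2 - (par A s)⁻¹ ^ 2 := fun s => by
    cases s
    · simp only [par, hδ, inv_inv, Bool.false_eq_true, if_false]; ring
    · simp [par, hδ]
  have hn : ∀ s, par A (!s) = (par A s)⁻¹ := fun s => by cases s <;> simp [par]
  cases h with
  | exchange g h i d => exact .inl (t.cabW_exchange A r g h i d)
  | zigzagLeft b i =>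
    left
    simp only [cabW, cabS, cabP, List.map_cons, List.map_nil, List.prod_cons, List.prod_nil,
      mul_one]
    rw [mul_add, mul_one, t.U_zigL]
  | zigzagRight b i =>
    left
    simp only [cabW, cabS, cabP, List.map_cons, List.map_nil, List.prod_cons, List.prod_nil,
      mul_one]
    rw [mul_add, mul_one, t.U_zigR]
  | swingCup b s i =>
    left
    simp only [cabW, cabS, cabP, List.map_cons, List.map_nil, List.prod_cons, List.prod_nil,
      mul_one]
    rw [mul_add, mul_one, hn, t.B_swingCup (ha s) (hd s)]
  | swingCap s i =>
    left
    simp only [cabW, cabS, cabP, List.map_cons, List.map_nil, List.prod_cons, List.prod_nil,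
      mul_one]
    rw [mul_add, mul_one, hn, t.B_swingCap (ha s) (hd s)]
  | reidemeisterOneCup b s i => exact .inr (.inl ⟨b, s, i, rfl, rfl⟩)
  | reidemeisterOneCap s i => exact .inr (.inr ⟨s, i, rfl, rfl⟩)
  | reidemeisterTwo s i =>
    left
    simp only [cabW, cabS, cabP, List.map_cons, List.map_nil, List.prod_cons, List.prod_nil,
      mul_one]
    rw [hn, t.B_mul_B_inv (ha s) (hd s)]
  | reidemeisterThree a b c i h =>
    left
    simp only [cabW, cabS, cabP, List.map_cons, List.map_nil, List.prod_cons, List.prod_nil,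
      mul_one]
    rw [mul_add, mul_one, ← mul_assoc, ← mul_assoc]
    rcases h with rfl | rfl
    · exact t.B_three_left (ha a) (hd a) _ r _
    · exact t.B_three_right (ha b) (hd b) _ r _

/-! ### Curls -/

/-- Indices of the crossings which undo the twisting in the parallel of a curl. -/
def curlIdx : ℕ → ℕ → List ℕ
  | 0, _ => []
  | m + 1, p => (List.range m).map (p + m + 1 + ·) ++
      ((List.range m).reverse.map (p + ·) ++ curlIdx m (p + 1))

/-- The same indices in the opposite order. -/
def curlIdx' : ℕ → ℕ → List ℕ
  | 0, _ => []
  | m + 1, p => curlIdx' m (p + 1) ++ ((List.range m).map (p + ·) ++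
      (List.range m).reverse.map (p + m + 1 + ·))

lemma mem_curlIdx (r : ℕ) : ∀ p, ∀ l ∈ curlIdx r p,
    (p ≤ l ∧ l + 2 ≤ p + r) ∨ (p + r ≤ l ∧ l + 2 ≤ p + 2 * r) := by
  induction r with
  | zero => simp [curlIdx]
  | succ m ih =>
    intro p l hl
    simp only [curlIdx, List.mem_append, List.mem_map, List.mem_reverse, List.mem_range] at hl
    rcases hl with ⟨x, hx, rfl⟩ | ⟨x, hx, rfl⟩ | h
    · omega
    · omega
    · have := ih _ _ h; omega

lemma mem_curlIdx' (r : ℕ) : ∀ p, ∀ l ∈ curlIdx' r p,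
    (p ≤ l ∧ l + 2 ≤ p + r) ∨ (p + r ≤ l ∧ l + 2 ≤ p + 2 * r) := by
  induction r with
  | zero => simp [curlIdx']
  | succ m ih =>
    intro p l hl
    simp only [curlIdx', List.mem_append, List.mem_map, List.mem_reverse, List.mem_range] at hl
    rcases hl with h | ⟨x, hx, rfl⟩ | ⟨x, hx, rfl⟩
    · have := ih _ _ h; omega
    · omega
    · omega

lemma length_curlIdx (r : ℕ) : ∀ p, (curlIdx r p).length = r * (r - 1) := by
  induction r with
  | zero => simp [curlIdx]
  | succ m ih =>
    intro p
    simp only [curlIdx, List.length_append, List.length_map, List.length_reverse,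
      List.length_range, ih]
    cases m <;> simp; ring

lemma length_curlIdx' (r : ℕ) : ∀ p, (curlIdx' r p).length = r * (r - 1) := by
  induction r with
  | zero => simp [curlIdx']
  | succ m ih =>
    intro p
    simp only [curlIdx', List.length_append, List.length_map, List.length_reverse,
      List.length_range, ih]
    cases m <;> simp; ring

lemma prod_cr_intertwine (a : k) (x : 𝒜) (L : List ℕ) (h : ∀ l ∈ L, t.e l * x = x * t.e l) :
    (L.map (t.cr a)).prod * x = x * (L.map (t.cr a)).prod := by
  induction L with
  | nil => simp
  | cons l L ih =>
    simp only [List.map_cons, List.prod_cons]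
    rw [mul_assoc, ih (fun l hl => h l (by simp [hl])), ← mul_assoc,
      t.cr_intertwine a x l l (h l (by simp)), mul_assoc]

lemma prod_curlIdx (a : k) (m p : ℕ) : ((curlIdx (m + 1) p).map (t.cr a)).prod =
    t.row a (p + m + 1) m * (t.col a p m * ((curlIdx m (p + 1)).map (t.cr a)).prod) := by
  simp only [curlIdx, List.map_append, List.prod_append, List.map_map, row_eq_prod, col_eq_prod]
  rfl

lemma prod_curlIdx' (a : k) (m p : ℕ) : ((curlIdx' (m + 1) p).map (t.cr a)).prod =
    ((curlIdx' m (p + 1)).map (t.cr a)).prod * (t.row a p m * t.col a (p + m + 1) m) := by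
  simp only [curlIdx', List.map_append, List.prod_append, List.map_map, row_eq_prod, col_eq_prod]
  rfl

variable {a : k} (ha : a ≠ 0) (hδ : δ = -a ^ 2 - a⁻¹ ^ 2)
include ha hδ

lemma e_row (n p l : ℕ) (h : l + 2 ≤ n) :
    t.e (p + 1 + l) * t.row a p n = t.row a p n * t.e (p + l) := by
  have := t.e_B_right ha hδ 1 n p l h
  simpa [B] using this

lemma e_col (n p l : ℕ) (h : l + 2 ≤ n) :
    t.e (p + l) * t.col a p n = t.col a p n * t.e (p + 1 + l) := by
  have := t.e_B_left ha hδ n 1 p l h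
  simpa [B_one_right] using this

/-- The row takes a strand across its neighbours to the right and the column brings it back, so the
two shifts of an inner hook cancel. -/
lemma e_row_col (m p l : ℕ) (h : p + 1 ≤ l ∧ l + 1 ≤ p + 2 * m) :
    t.e l * (t.row a p (2 * m + 1) * t.col a p (2 * m)) =
      t.row a p (2 * m + 1) * t.col a p (2 * m) * t.e l := by
  obtain ⟨d, rfl⟩ := Nat.exists_eq_add_of_le h.1
  rw [← mul_assoc, t.e_row ha hδ _ _ _ (by omega), mul_assoc, t.e_col ha hδ _ _ _ (by omega),
    mul_assoc]

lemma e_row_col' (m p l : ℕ) (h : p + 1 ≤ l ∧ l + 1 ≤ p + 2 * m) :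
    t.e l * (t.row a p (2 * m) * t.col a p (2 * m + 1)) =
      t.row a p (2 * m) * t.col a p (2 * m + 1) * t.e l := by
  obtain ⟨d, rfl⟩ := Nat.exists_eq_add_of_le h.1
  rw [← mul_assoc, t.e_row ha hδ _ _ _ (by omega), mul_assoc, t.e_col ha hδ _ _ _ (by omega),
    mul_assoc]

/-- The grid splits into the inner grid, a column and a row. The added row prolongs the row to `2 *
m + 1` crossings; the column slides through this long row and joins the added column to one of `2 *
m` crossings. -/
lemma B_mul_twist (m p : ℕ) :
    t.B a p (m + 1) (m + 1) * (t.row a (p + m + 1) m * t.col a p m) =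
      t.B a (p + 1) m m * (t.row a p (2 * m + 1) * t.col a p (2 * m)) := by
  have h1 : t.col a (p + 1 + m) m * t.row a p (2 * m + 1) =
      t.row a p (2 * m + 1) * t.col a (p + m) m := by
    have hc : ∀ q n, t.col a q n = t.B a q n 1 := fun q n => (t.B_one_right a n q).symm
    rw [hc, hc]
    refine t.B_intertwine a _ m 1 _ _ fun l hl => ?_
    rw [show p + 1 + m + l = p + 1 + (m + l) by ring, t.e_row ha hδ _ _ _ (by omega), add_assoc]
  rw [B, B_succ_right]
  have h2 : t.row a p (m + 1) * t.row a (p + m + 1) m = t.row a p (2 * m + 1) := by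
    rw [show 2 * m + 1 = m + 1 + m by ring]
    exact (t.row_add a (m + 1) m p).symm
  calc _ = t.B a (p + 1) m m * (t.col a (p + 1 + m) m *
        (t.row a p (m + 1) * t.row a (p + m + 1) m)) * t.col a p m := by simp only [mul_assoc]
    _ = _ := by
      rw [h2, h1, two_mul m, col_add]; simp only [mul_assoc]

lemma twist_mul_B (m p : ℕ) :
    t.row a p m * t.col a (p + m + 1) m * t.B a p (m + 1) (m + 1) =
      t.row a p (2 * m) * t.col a p (2 * m + 1) * t.B a (p + 1) m m := by
  have h1 : t.row a (p + m) m * t.col a (p + m) (m + 1) =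
      t.col a (p + m) (m + 1) * t.row a (p + m + 1) m := by
    have hc : ∀ q n, t.row a q n = t.B a q 1 n := fun q n => by simp [B]
    rw [hc, hc]
    refine t.B_intertwine a _ 1 m _ _ fun l hl => ?_
    rw [t.e_col ha hδ _ _ _ (by omega)]
  have h3 : t.B a (p + 1) (m + 1) m = t.row a (p + m + 1) m * t.B a (p + 1) m m := by
    have := B_add t a m 1 m (p + 1)
    rw [this]; simp [B]; congr 2; omega
  have h4 : t.row a (p + m + 1) m * t.col a p m = t.col a p m * t.row a (p + m + 1) m :=
    loc_row (t := t) a m _ _ _ (rp_col (t := t) a m p (p + m + 1) le_rfl)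
  rw [B_succ_left, h3, col_cons]
  have h5 : t.col a (p + m + 1) m * t.cr a (p + m) = t.col a (p + m) (m + 1) := rfl
  calc _ = t.row a p m * ((t.col a (p + m + 1) m * t.cr a (p + m)) *
        (t.col a p m * t.row a (p + m + 1) m)) * t.B a (p + 1) m m := by simp only [mul_assoc]
    _ = t.row a p m * ((t.col a (p + m) (m + 1) * t.row a (p + m + 1) m) * t.col a p m) *
        t.B a (p + 1) m m := by rw [← h4, h5]; simp only [mul_assoc]
    _ = _ := by
      rw [← h1, show 2 * m + 1 = m + (m + 1) by ring, two_mul m,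
        t.col_add a m (m + 1) p, t.row_add a m m p]
      simp only [mul_assoc]

/-- The inner cups are pulled across the outermost strand twice, in opposite directions. What
remains is one crossing on a single cup, a curl worth `-a⁻³`. -/
lemma U_row_col (m p : ℕ) :
    t.U (m + 1) p * (t.row a p (2 * m + 1) * t.col a p (2 * m)) = (-a⁻¹ ^ 3) • t.U (m + 1) p := by
  have h1 : t.U m (p + 1) * t.row a p (2 * m) = t.U m p := by
    have := t.U_B_right ha hδ m 1 0 p 0 le_rfl
    simpa [B, row] using this
  have h2 : t.u p * t.U m p = t.U m p * t.u (p + 2 * m) := ((rp_U m p p le_rfl : t.RP _ _ _) 0).1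
  have h3 : t.U m p * t.col a p (2 * m) = t.U m (p + 1) := by
    have := t.U_B_left ha hδ m 0 1 p 0 le_rfl
    simpa [B, B_one_right] using this
  calc _ = t.u p * (t.U m (p + 1) * t.row a p (2 * m)) * t.cr a (p + 2 * m) *
        t.col a p (2 * m) := by rw [U, row_snoc]; simp only [mul_assoc]
    _ = t.U m p * (t.u (p + 2 * m) * t.cr a (p + 2 * m)) * t.col a p (2 * m) := by
        rw [h1, h2]; simp only [mul_assoc]
    _ = (-a⁻¹ ^ 3) • (t.u p * (t.U m p * t.col a p (2 * m))) := by
        rw [t.u_mul_cr ha hδ, mul_smul_comm, smul_mul_assoc, ← h2, mul_assoc]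
    _ = _ := by rw [h3, U]

lemma row_col_C (m p : ℕ) :
    t.row a p (2 * m) * t.col a p (2 * m + 1) * t.C (m + 1) p = (-a⁻¹ ^ 3) • t.C (m + 1) p := by
  have h1 : t.row a p (2 * m) * t.C m p = t.C m (p + 1) := by
    have := t.C_B_right ha hδ m 1 0 p 0 le_rfl
    simpa [B, row] using this.symm
  have h2 : t.c (p + 2 * m) * t.C m p = t.C m p * t.c p := ((rp_C m p p le_rfl : t.RP _ _ _) 0).2
  have h3 : t.col a p (2 * m) * t.C m (p + 1) = t.C m p := by
    have hc : ∀ n : ℕ, ∀ l, l ≤ 0 → t.C n (p + l) * t.B a p 0 1 =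
        t.B a p (2 * n) 1 * t.C n (p + 1 + l) := by
      suffices H : ∀ n i : ℕ, ∀ l, l ≤ i → t.C n (p + l) * t.B a p i 1 =
        t.B a p (i + 2 * n) 1 * t.C n (p + 1 + l) by
        intro n l hl; simpa using H n 0 l hl
      intro n
      induction n with
      | zero => intro i l _; simp [C]
      | succ n ih =>
        intro i l h
        rw [C, C, mul_assoc, t.c_B_left ha hδ i 1 p l h, ← mul_assoc,
          show i + 2 * (n + 1) = i + 2 + 2 * n by ring,
          show p + l + 1 = p + (l + 1) by ring, ih _ _ (by omega), mul_assoc]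
        rfl
    have := hc m 0 le_rfl
    simpa [B, B_one_right] using this.symm
  calc _ = t.row a p (2 * m) * t.cr a (p + 2 * m) * (t.col a p (2 * m) * t.C m (p + 1)) *
        t.c p := by rw [C, col_cons]; simp only [mul_assoc]
    _ = t.row a p (2 * m) * ((t.cr a (p + 2 * m) * t.c (p + 2 * m)) * t.C m p) := by
        rw [h3]; simp only [mul_assoc]; rw [h2]
    _ = (-a⁻¹ ^ 3) • ((t.row a p (2 * m) * t.C m p) * t.c p) := by
        rw [t.cr_mul_c ha hδ, smul_mul_assoc, mul_smul_comm, h2, mul_assoc]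
    _ = _ := by rw [h1, C]

/-- The parallel of a curl at a minimum. -/
theorem U_curl (r : ℕ) : ∀ p, t.U r p * t.B a p r r * ((curlIdx r p).map (t.cr a)).prod =
    (-a⁻¹ ^ 3) ^ r • t.U r p := by
  induction r with
  | zero => intro p; simp [U, B, curlIdx]
  | succ m ih =>
    intro p
    rw [prod_curlIdx]
    -- The correcting crossings of the inner strands commute with the long loop of the outermost
    -- strand, which exposes the inner parallel curl for the induction.
    have h1 := t.prod_cr_intertwine a (t.row a p (2 * m + 1) * t.col a p (2 * m))
      (curlIdx m (p + 1)) fun l hl => by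
        have := mem_curlIdx m _ l hl
        exact t.e_row_col ha hδ m p l (by omega)
    calc _ = t.U (m + 1) p * (t.B a p (m + 1) (m + 1) *
          (t.row a (p + m + 1) m * t.col a p m)) * ((curlIdx m (p + 1)).map (t.cr a)).prod := by
          simp only [mul_assoc]
      _ = t.u p * ((t.U m (p + 1) * t.B a (p + 1) m m *
          ((curlIdx m (p + 1)).map (t.cr a)).prod) *
          (t.row a p (2 * m + 1) * t.col a p (2 * m))) := by
          rw [t.B_mul_twist ha hδ, mul_assoc _ _ (t.row a p (2 * m + 1) * t.col a p (2 * m)), h1, U]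
          simp only [mul_assoc]
      _ = _ := by
          rw [ih, smul_mul_assoc, mul_smul_comm, ← mul_assoc]
          change _ • (t.U (m + 1) p * _) = _
          rw [t.U_row_col ha hδ, smul_smul, pow_succ (-a⁻¹ ^ 3) m]

/-- The parallel of a curl at a maximum. -/
theorem C_curl (r : ℕ) : ∀ p, ((curlIdx' r p).map (t.cr a)).prod * t.B a p r r * t.C r p =
    (-a⁻¹ ^ 3) ^ r • t.C r p := by
  induction r with
  | zero => intro p; simp [C, B, curlIdx']
  | succ m ih =>
    intro p
    rw [prod_curlIdx']
    have h1 := t.prod_cr_intertwine a (t.row a p (2 * m) * t.col a p (2 * m + 1))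
      (curlIdx' m (p + 1)) fun l hl => by
        have := mem_curlIdx' m _ l hl
        exact t.e_row_col' ha hδ m p l (by omega)
    have h1' : ∀ z, t.row a p (2 * m) * (t.col a p (2 * m + 1) *
        (((curlIdx' m (p + 1)).map (t.cr a)).prod * z)) =
        ((curlIdx' m (p + 1)).map (t.cr a)).prod * (t.row a p (2 * m) *
          (t.col a p (2 * m + 1) * z)) := fun z => by
      rw [← mul_assoc, ← mul_assoc, ← h1]; simp only [mul_assoc]
    calc _ = ((curlIdx' m (p + 1)).map (t.cr a)).prod * ((t.row a p m * t.col a (p + m + 1) m *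
          t.B a p (m + 1) (m + 1)) * t.C (m + 1) p) := by
          simp only [mul_assoc]
      _ = (t.row a p (2 * m) * t.col a p (2 * m + 1)) * (((curlIdx' m (p + 1)).map (t.cr a)).prod *
          t.B a (p + 1) m m * t.C m (p + 1)) * t.c p := by
          rw [t.twist_mul_B ha hδ, C]
          simp only [mul_assoc]
          rw [h1']
      _ = _ := by
          rw [ih, mul_smul_comm, smul_mul_assoc, mul_assoc]
          change _ • (_ * t.C (m + 1) p) = _
          rw [t.row_col_C ha hδ, smul_smul, pow_succ (-a⁻¹ ^ 3) m]

end Parallels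
end TL

/-! ### Coloured runs -/

/-- `ColRun w M M'`: the strands of the flat word `w`, coloured by `M` at the bottom, can be coloured
such that both ends of every cup and cap agree, with the colours `M'` at the top. -/
inductive ColRun {α : Type*} : List Flat → List α → List α → Prop
  | nil (M : List α) : ColRun [] M M
  | cup (x : α) (P Q M : List α) (w : List Flat) (h : ColRun w (P ++ x :: x :: Q) M) :
      ColRun (.cup P.length :: w) (P ++ Q) M
  | cap (x : α) (P Q M : List α) (w : List Flat) (h : ColRun w (P ++ Q) M) :
      ColRun (.cap P.length :: w) (P ++ x :: x :: Q) M
  | swap (x y : α) (P Q M : List α) (w : List Flat) (h : ColRun w (P ++ y :: x :: Q) M) :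
      ColRun (.swap P.length :: w) (P ++ x :: y :: Q) M

namespace ColRun
variable {α : Type*}

lemma append {v w : List Flat} {M M' M'' : List α} (h : ColRun v M M') (h' : ColRun w M' M'') :
    ColRun (v ++ w) M M'' := by
  induction h with
  | nil => exact h'
  | cup x P Q M w _ ih => exact .cup x P Q _ _ (ih h')
  | cap x P Q M w _ ih => exact .cap x P Q _ _ (ih h')
  | swap x y P Q M w _ ih => exact .swap x y P Q _ _ (ih h')

/-- Every arc has two ends of the same colour, on the bottom or the top line. -/
lemma even_count [DecidableEq α] (z : α) {w : List Flat} {M M' : List α} (h : ColRun w M M') :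
    Even (M.count z + M'.count z) := by
  induction h with
  | nil => exact ⟨_, rfl⟩
  | cup x P Q M w _ ih =>
    simp only [List.count_append, List.count_cons] at ih ⊢
    split_ifs at ih <;> grind
  | cap x P Q M w _ ih =>
    simp only [List.count_append, List.count_cons] at ih ⊢
    split_ifs <;> grind
  | swap x y P Q M w _ ih =>
    simp only [List.count_append, List.count_cons] at ih ⊢
    grind

/-- The two ends of an arc have the same colour. -/
lemma eq_of_pair {w : List Flat} {x y : α} (h : ColRun w [x, y] []) : x = y := by
  classical
  by_contra hn
  have := h.even_count x
  simp [List.count_cons, Ne.symm hn] at this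

open Classical in
/-- There are at least as many circuits as colours. -/
lemma card_le_circuitsFrom_append (v : List Flat) {w : List Flat} {M M' : List α}
    (hv : ∀ (n : ℕ) (L : List ℕ) (f : ℕ → α), M' = L.map f → (∀ z ∈ L, z < n) →
      (∀ z, Even (L.count z)) → M'.toFinset.card ≤ circuitsFrom v n L)
    (h : ColRun w M M') : ∀ (n : ℕ) (L : List ℕ) (f : ℕ → α), M = L.map f → (∀ z ∈ L, z < n) →
      (∀ z, Even (L.count z)) →
      (M.toFinset ∪ M'.toFinset).card ≤ circuitsFrom (w ++ v) n L := by
  induction h with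
  | nil M => intro n L f h1 h2 h3; simpa using hv n L f h1 h2 h3
  | cup x P Q M w _ ih =>
    intro n L f h1 h2 h3
    obtain ⟨L₁, L₂, rfl, rfl, rfl⟩ := List.map_eq_append_iff.1 h1.symm
    have h4 := circuitsFrom_cup (w ++ v) n L₁ L₂
    rw [List.length_map, List.cons_append, h4]
    -- The fresh label `n` receives the colour of the new arc; older labels are smaller and keep
    -- theirs.
    have hlt : ∀ L ⊆ L₁ ++ L₂, L.map f = L.map (Function.update f n x) := fun L hL =>
      List.map_congr_left fun z hz => by
        rw [Function.update_of_ne]; have := h2 z (hL hz); omega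
    refine le_trans (Finset.card_le_card ?_) (ih hv (n + 1) (L₁ ++ n :: n :: L₂)
      (Function.update f n x) ?_ ?_ ?_)
    · intro z; simp only [Finset.mem_union, List.mem_toFinset, List.mem_append, List.mem_cons,
        Finset.mem_insert]; tauto
    · simp [← hlt L₁ (by simp), ← hlt L₂ (by simp)]
    · intro z hz
      simp only [List.mem_append, List.mem_cons] at hz
      have := h2 z
      simp only [List.mem_append] at this
      rcases hz with hz | rfl | rfl | hz
      · have := this (.inl hz); omega
      · omega
      · omega
      · have := this (.inr hz); omega
    · intro z
      have := h3 z
      simp only [List.count_append, List.count_cons] at this ⊢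
      split_ifs <;> grind
  | cap x P Q M w _ ih =>
    intro n L f h1 h2 h3
    obtain ⟨L₁, L', rfl, rfl, h5⟩ := List.map_eq_append_iff.1 h1.symm
    obtain ⟨l, L', rfl, rfl, h7⟩ := List.map_eq_cons_iff.1 h5
    obtain ⟨l', L₂, rfl, h6, rfl⟩ := List.map_eq_cons_iff.1 h7
    have h4 := circuitsFrom_cap (w ++ v) n L₁ L₂ l l'
    rw [List.length_map, List.cons_append, h4]
    have hm : (L₁ ++ L₂).map f = ((L₁ ++ L₂).map fun z => if z = l' then l else z).map f := by
      rw [List.map_map]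
      refine List.map_congr_left fun z _ => ?_
      simp only [Function.comp_apply]
      split_ifs with hz
      · rw [hz, h6]
      · rfl
    have hc : ∀ z, ((L₁ ++ L₂).map fun z => if z = l' then l else z).count z =
        if z = l then (L₁ ++ L₂).count l + (if l' = l then 0 else (L₁ ++ L₂).count l')
        else if z = l' then 0 else (L₁ ++ L₂).count z := by
      intro z
      induction L₁ ++ L₂ with
      | nil => simp
      | cons y Y ih => simp only [List.map_cons, List.count_cons, ih]; grind
    have := ih hv n ((L₁ ++ L₂).map fun z => if z = l' then l else z) f
      (by rw [← hm, List.map_append]) (by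
        intro z hz
        obtain ⟨y, hy, rfl⟩ := List.mem_map.1 hz
        split_ifs
        · exact h2 l (by simp)
        · exact h2 y (by simp only [List.mem_append, List.mem_cons] at hy ⊢; tauto)) (by
        intro z
        rw [hc]
        have e1 := h3 z; have e2 := h3 l; have e3 := h3 l'
        simp only [List.count_append, List.count_cons, beq_iff_eq] at e1 e2 e3 ⊢
        grind)
    refine le_trans ?_ (Nat.add_le_add_left this _)
    split_ifs with hl
    · refine le_trans (Finset.card_le_card (t := insert (f l) ((L₁.map f ++ L₂.map f).toFinset ∪
        M.toFinset)) ?_) ((Finset.card_insert_le _ _).trans (by omega))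
      intro z; simp only [Finset.mem_union, List.mem_toFinset, List.mem_append, List.mem_cons,
        Finset.mem_insert]; tauto
    · rw [zero_add]
      refine Finset.card_le_card ?_
      -- Each label occurs an even number of times and the cap uses one occurrence of `l`, so
      -- another one remains and its colour is not lost.
      have hmem : l ∈ L₁ ++ L₂ := by
        by_contra hmem
        have e2 := h3 l
        have := List.count_eq_zero.2 hmem
        rw [List.count_append] at this
        rw [List.count_append, List.count_cons_self, List.count_cons_of_ne (Ne.symm hl)] at e2
        grind
      have : f l ∈ (L₁ ++ L₂).map f := List.mem_map_of_mem hmem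
      rw [List.map_append] at this
      intro z
      simp only [Finset.mem_union, List.mem_toFinset, List.mem_append, List.mem_cons] at this ⊢
      rintro ((h | rfl | rfl | h) | h) <;> tauto
  | swap x y P Q M w _ ih =>
    intro n L f h1 h2 h3
    obtain ⟨L₁, L', rfl, rfl, h5⟩ := List.map_eq_append_iff.1 h1.symm
    obtain ⟨l, L', rfl, rfl, h7⟩ := List.map_eq_cons_iff.1 h5
    obtain ⟨l', L₂, rfl, rfl, rfl⟩ := List.map_eq_cons_iff.1 h7
    have h4 := circuitsFrom_swap (w ++ v) n L₁ L₂ l l'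
    rw [List.length_map, List.cons_append, h4]
    refine le_trans (Finset.card_le_card ?_) (ih hv n (L₁ ++ l' :: l :: L₂) f ?_ ?_ ?_)
    · intro z; simp only [Finset.mem_union, List.mem_toFinset, List.mem_append, List.mem_cons,
        Finset.mem_insert]; tauto
    · simp
    · intro z hz; exact h2 z (by simp at hz ⊢; tauto)
    · intro z
      have := h3 z
      simp only [List.count_append, List.count_cons] at this ⊢
      grind

end ColRun

/-! ### Steps and runs -/

/-- The three kinds of steps. -/
inductive Step : Slice → List Bool → List Bool → Prop
  | cup (b : Bool) (P Q : List Bool) : Step ⟨.cup b, P.length⟩ (P ++ Q) (P ++ b :: (!b) :: Q)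
  | cap (x : Bool) (P Q : List Bool) : Step ⟨.cap, P.length⟩ (P ++ x :: (!x) :: Q) (P ++ Q)
  | cross (s x y : Bool) (P Q : List Bool) :
      Step ⟨.cross s, P.length⟩ (P ++ x :: y :: Q) (P ++ y :: x :: Q)

lemma step_iff {g : Slice} {O O' : List Bool} : step g O = some O' ↔ Step g O O' := by
  constructor
  · intro h
    rcases g with ⟨_ | _ | _, i⟩
    · simp only [step] at h
      split_ifs at h with hi
      obtain ⟨P, Q, rfl, rfl⟩ := exists_append_of_le hi
      simp only [List.take_left', List.drop_left', Option.some.injEq] at h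
      subst h
      exact .cup _ _ _
    · have hi : i + 2 ≤ O.length := by
        by_contra hi
        have : (O.drop i).length < 2 := by simp; omega
        rcases hd : O.drop i with _ | ⟨a, _ | ⟨b, R⟩⟩
        · simp [step, hd] at h
        · simp [step, hd] at h
        · rw [hd] at this; simp at this
      obtain ⟨P, x, y, Q, rfl, rfl⟩ := exists_append_cons_cons_of_lt hi
      simp only [step, List.take_left', List.drop_left'] at h
      split_ifs at h with hxy
      simp only [Option.some.injEq] at h
      subst h
      obtain rfl : y = !x := by cases x <;> cases y <;> simp_all
      exact .cap _ _ _
    · have hi : i + 2 ≤ O.length := by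
        by_contra hi
        have : (O.drop i).length < 2 := by simp; omega
        rcases hd : O.drop i with _ | ⟨a, _ | ⟨b, R⟩⟩
        · simp [step, hd] at h
        · simp [step, hd] at h
        · rw [hd] at this; simp at this
      obtain ⟨P, x, y, Q, rfl, rfl⟩ := exists_append_cons_cons_of_lt hi
      simp only [step, List.take_left', List.drop_left', Option.some.injEq] at h
      subst h
      exact .cross _ _ _ _ _
  · intro h
    cases h with
    | cup b P Q => simp [step]
    | cap x P Q => simp [step]
    | cross s x y P Q => simp [step]

lemma run_append (v w : Word) : ∀ O, run (v ++ w) O = (run v O).bind (run w) := by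
  induction v with
  | nil => intro O; rfl
  | cons g v ih =>
    intro O
    simp only [List.cons_append, run]
    cases step g O <;> simp [ih]

lemma run_append_eq_some {v w : Word} {O O' : List Bool} :
    run (v ++ w) O = some O' ↔ ∃ M, run v O = some M ∧ run w M = some O' := by
  rw [run_append, Option.bind_eq_some_iff]

lemma run_cons_eq_some {g : Slice} {w : Word} {O O' : List Bool} :
    run (g :: w) O = some O' ↔ ∃ M, Step g O M ∧ run w M = some O' := by
  simp only [run, Option.bind_eq_some_iff, step_iff]

lemma fits_of_run {w : Word} : ∀ {O O' : List Bool}, run w O = some O' →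
    Fits w O.length O'.length := by
  induction w with
  | nil => intro O O' h; simp only [run, Option.some.injEq] at h; subst h; rfl
  | cons g w ih =>
    intro O O' h
    obtain ⟨M, h1, h2⟩ := run_cons_eq_some.1 h
    have := ih h2
    cases h1 <;> simp only [List.length_append, List.length_cons] at this ⊢
    · exact ⟨by omega, this⟩
    · refine ⟨by omega, ?_⟩
      convert this using 1
      omega
    · exact ⟨by omega, this⟩

/-- A knot diagram starts with a local minimum. -/
lemma KnotDiagram.exists_cons (D : KnotDiagram) : ∃ b w, D.1 = ⟨.cup b, 0⟩ :: w ∧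
    run w [b, !b] = some [] := by
  obtain ⟨w, h1, h2⟩ := D
  rcases w with _ | ⟨g, w⟩
  · simp [components, circuits, shadow, circuitsFrom] at h2
  · obtain ⟨M, h3, h4⟩ := run_cons_eq_some.1 h1
    generalize hO : ([] : List Bool) = O at h3
    cases h3 with
    | cup b P Q =>
      obtain ⟨rfl, rfl⟩ := List.append_eq_nil_iff.1 hO.symm
      exact ⟨b, w, rfl, h4⟩
    | cap x P Q => simp at hO
    | cross s x y P Q => simp at hO

/-- The projection of a slice. -/
def Slice.flat (g : Slice) : Flat :=
  match g.piece with
    | .cup _ => .cup g.pos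
    | .cap => .cap g.pos
    | .cross _ => .swap g.pos

lemma shadow_cons (g : Slice) (w : Word) : shadow (g :: w) = g.flat :: shadow w := rfl
lemma shadow_append (v w : Word) : shadow (v ++ w) = shadow v ++ shadow w := List.map_append

/-! ### Sliding along the strands -/

section Slides
variable {𝒜 : Type*} [Ring 𝒜] (Φ : Bool → ℕ → 𝒜)

/-- The values of the products `a * Φ d j * y` for the strands `j` with directions `d`. -/
def cols (a y : 𝒜) : ℕ → List Bool → List 𝒜
  | _, [] => []
  | j, d :: O => a * Φ d j * y :: cols a y (j + 1) O

lemma cols_append (a y : 𝒜) (P Q : List Bool) : ∀ j,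
    cols Φ a y j (P ++ Q) = cols Φ a y j P ++ cols Φ a y (j + P.length) Q := by
  induction P with
  | nil => intro j; rfl
  | cons d P ih =>
    intro j
    simp only [List.cons_append, cols, ih, List.length_cons]
    rw [add_assoc, add_comm 1]

lemma length_cols (a y : 𝒜) (O : List Bool) : ∀ j, (cols Φ a y j O).length = O.length := by
  induction O with
  | nil => intro j; rfl
  | cons d O ih => intro j; simp [cols, ih]

lemma cols_congr (a y a' y' : 𝒜) (O : List Bool) (j j' : ℕ)
    (h : ∀ d, ∀ l < O.length, a * Φ d (j + l) * y = a' * Φ d (j' + l) * y') :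
    cols Φ a y j O = cols Φ a' y' j' O := by
  induction O generalizing j j' with
  | nil => rfl
  | cons d O ih =>
    simp only [cols]
    congr 1
    · exact h d 0 (by simp)
    · refine ih _ _ fun d l hl => ?_
      have := h d (l + 1) (by simp; omega)
      rwa [← add_assoc, ← add_assoc, add_right_comm, add_right_comm j'] at this

/-- The elements `Φ d j` can be moved along the strands through the element `x` which stands for
the slice `g`. -/
structure Slides (g : Slice) (x : 𝒜) : Prop where
  left : ∀ d j, j < g.pos → Φ d j * x = x * Φ d j
  right : ∀ d j, Φ d (g.pos + g.piece.dom + j) * x = x * Φ d (g.pos + g.piece.cod + j)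
  cup : ∀ b, g.piece = .cup b → x * Φ b g.pos = x * Φ (!b) (g.pos + 1)
  cap : g.piece = .cap → ∀ d, Φ d g.pos * x = Φ (!d) (g.pos + 1) * x
  cross : ∀ s, g.piece = .cross s → ∀ d, Φ d g.pos * x = x * Φ d (g.pos + 1) ∧
    Φ d (g.pos + 1) * x = x * Φ d g.pos

variable {Φ}

/-- The only value of `Φ` that need not commute with `z` is the one with direction `!b` on the left
leg, and this leg has direction `b`. -/
lemma Slides.mul_of_cup {g : Slice} {x z : 𝒜} (h : Slides Φ g x) {b : Bool}
    (hg : g.piece = .cup b) (hz : ∀ d j, d = b ∨ j ≠ g.pos → Φ d j * z = z * Φ d j) :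
    Slides Φ g (x * z) where
  left d j hj := by rw [← mul_assoc, h.left d j hj, mul_assoc, hz _ _ (.inr (by omega)), mul_assoc]
  right d j := by
    rw [← mul_assoc, h.right d j, mul_assoc, hz _ _ (.inr (by rw [hg, Piece.cod]; omega)),
      mul_assoc]
  cup b' hb := by
    obtain rfl : b = b' := by rw [hg] at hb; cases hb; rfl
    rw [mul_assoc, mul_assoc, ← hz _ _ (.inl rfl), ← hz _ _ (.inr (by omega)), ← mul_assoc,
      h.cup b hb, mul_assoc]
  cap hb := by rw [hg] at hb; cases hb
  cross s hs := by rw [hg] at hs; cases hs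

/-- The ring elements obtained by inserting `Φ` on the various strands serve as colours. That `Φ`
slides along a strand says exactly that this colour is constant along the strand. -/
lemma Slides.colRun {g : Slice} {x : 𝒜} (h : Slides Φ g x) {O O' : List Bool} (hs : Step g O O')
    (a y : 𝒜) : ColRun [g.flat] (cols Φ a (x * y) 0 O) (cols Φ (a * x) y 0 O') := by
  have hl : ∀ P : List Bool, P.length ≤ g.pos →
      cols Φ a (x * y) 0 P = cols Φ (a * x) y 0 P := fun P hP =>
    cols_congr _ _ _ _ _ _ _ _ fun d l hl => by
      have := h.left d (0 + l) (by omega)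
      rw [mul_assoc, ← mul_assoc _ x, this]; simp only [mul_assoc]
  have hr : ∀ Q : List Bool, cols Φ a (x * y) (g.pos + g.piece.dom) Q =
      cols Φ (a * x) y (g.pos + g.piece.cod) Q := fun Q =>
    cols_congr _ _ _ _ _ _ _ _ fun d l _ => by
      rw [mul_assoc, ← mul_assoc _ x, h.right d l]; simp only [mul_assoc]
  cases hs with
  | cup b P Q =>
    have e1 := hl P le_rfl
    have e2 := hr Q
    have e3 := h.cup b rfl
    simp only [Piece.dom, Piece.cod, add_zero] at e1 e2 e3
    rw [cols_append, cols_append, cols, cols, zero_add, e1, e2, mul_assoc a x, e3, ← mul_assoc a x]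
    have := ColRun.cup (a * x * Φ (!b) (P.length + 1) * y) (cols Φ (a * x) y 0 P)
      (cols Φ (a * x) y (P.length + 2) Q) _ [] (.nil _)
    rw [length_cols] at this
    exact this
  | cap b P Q =>
    have e1 := hl P le_rfl
    have e2 := hr Q
    have e3 := h.cap rfl b
    simp only [Piece.dom, Piece.cod, add_zero] at e1 e2 e3
    rw [cols_append, cols_append, cols, cols, zero_add, e1, e2, mul_assoc a, ← mul_assoc _ x, e3]
    have := ColRun.cap (a * (Φ (!b) (P.length + 1) * x * y)) (cols Φ (a * x) y 0 P)
      (cols Φ (a * x) y P.length Q) _ [] (.nil _)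
    rw [length_cols] at this
    simp only [mul_assoc] at this ⊢
    exact this
  | cross s b c P Q =>
    have e1 := hl P le_rfl
    have e2 := hr Q
    have e3 := (h.cross s rfl b).1
    have e4 := (h.cross s rfl c).2
    simp only [Piece.dom, Piece.cod, add_zero] at e1 e2 e3 e4
    rw [cols_append, cols_append, cols, cols, cols, cols, zero_add, e1, e2, mul_assoc a x,
      mul_assoc a x, ← e3, ← e4]
    have := ColRun.swap (a * Φ b P.length * (x * y)) (a * Φ c (P.length + 1) * (x * y))
      (cols Φ (a * x) y 0 P) (cols Φ (a * x) y (P.length + 2) Q) _ [] (.nil _)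
    rw [length_cols] at this
    simp only [mul_assoc] at this ⊢
    exact this

lemma colRun_of_slides (G : List (Slice × 𝒜)) : ∀ {O O' : List Bool} (a y : 𝒜),
    (∀ g ∈ G, Slides Φ g.1 g.2) → run (G.map Prod.fst) O = some O' →
    ColRun (shadow (G.map Prod.fst)) (cols Φ a ((G.map Prod.snd).prod * y) 0 O)
      (cols Φ (a * (G.map Prod.snd).prod) y 0 O') := by
  induction G with
  | nil =>
    intro O O' a y _ h
    simp only [List.map_nil, run, Option.some.injEq] at h
    subst h
    simp only [List.map_nil, List.prod_nil, one_mul, mul_one]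
    exact ColRun.nil _
  | cons g G ih =>
    intro O O' a y hG h
    obtain ⟨M, h1, h2⟩ := run_cons_eq_some.1 h
    have e1 := (hG g (by simp)).colRun h1 a ((G.map Prod.snd).prod * y)
    have e2 := ih (a * g.2) y (fun g hg => hG g (by simp [hg])) h2
    have := e1.append e2
    simp only [List.map_cons, List.prod_cons, mul_assoc, shadow_cons] at this ⊢
    exact this

/-- Both ends of an arc. -/
theorem slide_ends (G : List (Slice × 𝒜)) (b : Bool) (hG : ∀ g ∈ G, Slides Φ g.1 g.2)
    (h : run (G.map Prod.fst) [b, !b] = some []) :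
    Φ b 0 * (G.map Prod.snd).prod = Φ (!b) 1 * (G.map Prod.snd).prod := by
  have := (colRun_of_slides G 1 1 hG h).eq_of_pair
  simpa using this

open Classical in
/-- In a knot diagram, an element can be moved from anywhere to the first local minimum. -/
theorem slide_to_start (a x : 𝒜) (G H : List (Slice × 𝒜)) (b d : Bool) (P Q : List Bool)
    (hG : ∀ g ∈ G ++ H, Slides Φ g.1 g.2) (ha : a * Φ b 0 = a * Φ (!b) 1)
    (h1 : run (G.map Prod.fst) [b, !b] = some (P ++ d :: Q))
    (h2 : run (H.map Prod.fst) (P ++ d :: Q) = some [])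
    (hc : circuits (.cup 0 :: shadow ((G ++ H).map Prod.fst)) = 1)
    (hx : ∀ d j, j ≠ P.length → Φ d j * x = x * Φ d j) :
    a * (G.map Prod.snd).prod * x * Φ d P.length * (H.map Prod.snd).prod =
      a * Φ b 0 * ((G.map Prod.snd).prod * x * (H.map Prod.snd).prod) := by
  set y := (H.map Prod.snd).prod
  set g := (G.map Prod.snd).prod
  have e1 := colRun_of_slides G a (x * y) (fun g hg => hG g (by simp [hg])) h1
  have e2 := colRun_of_slides H (a * g * x) 1 (fun g hg => hG g (by simp [hg])) h2
  rw [mul_one] at e2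
  change ColRun _ (cols Φ a (g * (x * y)) 0 _) (cols Φ (a * g) (x * y) 0 _) at e1
  change ColRun _ (cols Φ (a * g * x) y 0 _) [] at e2
  have hP : cols Φ (a * g * x) y 0 P = cols Φ (a * g) (x * y) 0 P :=
    cols_congr _ _ _ _ _ _ _ _ fun d l hl => by
      have := hx d (0 + l) (by omega)
      rw [mul_assoc (a * g) x, ← this]; simp only [mul_assoc]
  have hQ : cols Φ (a * g * x) y (P.length + 1) Q = cols Φ (a * g) (x * y) (P.length + 1) Q :=
    cols_congr _ _ _ _ _ _ _ _ fun d l hl => by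
      have := hx d (P.length + 1 + l) (by omega)
      rw [mul_assoc (a * g) x, ← this]; simp only [mul_assoc]
  have hM : ∀ a y, cols Φ a y 0 (P ++ d :: Q) =
      cols Φ a y 0 P ++ a * Φ d P.length * y :: cols Φ a y (P.length + 1) Q := fun a y => by
    rw [cols_append, cols, zero_add]
  rw [hM] at e1 e2
  rw [hP, hQ] at e2
  -- The colours just below and just above `x` agree except possibly on the strand `P.length`. On
  -- both sides every colour occurs an even number of times, by `even_count`, so they agree there as
  -- well.
  have hcut : a * g * x * Φ d P.length * y = a * g * Φ d P.length * (x * y) := by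
    by_contra hne
    have p1 := e1.even_count (a * g * x * Φ d P.length * y)
    have p2 := e2.even_count (a * g * x * Φ d P.length * y)
    have p3 : cols Φ a (g * (x * y)) 0 [b, !b] =
      [a * Φ b 0 * (g * (x * y)), a * Φ b 0 * (g * (x * y))] := by simp [cols, ha]
    rw [p3] at p1
    simp only [List.count_append, List.count_cons, beq_self_eq_true, if_true, List.count_nil,
      beq_iff_eq, Ne.symm hne, if_false] at p1 p2
    split_ifs at p1 <;> grind
  rw [hcut] at e2 ⊢
  -- The two runs now fit together to a colouring of the whole projection. It has one circuit, hence
  -- one colour.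
  have h3 := ColRun.card_le_circuitsFrom_append _ (fun n L f h1 h2 h3 => by
    have := ColRun.card_le_circuitsFrom_append [] (fun n L f h1 h2 h3 => by simp) e2 n L f h1 h2 h3
    simpa using this) e1 1 [0, 0] (fun _ => a * Φ b 0 * (g * (x * y)))
      (by simp [cols, ha]) (by simp) (by intro z; simp only [List.count_cons]; grind)
  rw [circuits] at hc
  change circuitsFrom _ 1 [0, 0] = 1 at hc
  rw [List.map_append, shadow_append] at hc
  rw [hc] at h3
  rw [mul_assoc g x y]
  refine Finset.card_le_one.1 h3 _ ?_ _ ?_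
  · rw [Finset.mem_union, List.mem_toFinset, List.mem_toFinset]
    right; simp
  · rw [Finset.mem_union, List.mem_toFinset, List.mem_toFinset]
    left; simp [cols]

end Slides
namespace TL

/-! ### Hooks in parallels: sliding, annihilation, trace and partial trace. -/

section Coupons
variable {k 𝒜 : Type*} [Field k] [Ring 𝒜] [Algebra k 𝒜] {δ : k} (t : TL k 𝒜 δ)

/-- A hook on two of the `r + 2` parallel copies of the strand `j`, which are chosen by `κ`
depending on the direction of that strand. -/
def hook (r : ℕ) (κ : Bool → ℕ) (d : Bool) (j : ℕ) : 𝒜 := t.e ((r + 2) * j + κ d)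

variable {A : k} (hA : A ≠ 0) (hδ : δ = -A ^ 2 - A⁻¹ ^ 2) {r : ℕ} {κ : Bool → ℕ}
  (hκ : ∀ d, κ d + κ (!d) = r)

lemma hook_comm (hκ : ∀ d, κ d + κ (!d) = r) (d d' : Bool) (j j' : ℕ) (h : d = d' ∨ j ≠ j') :
    t.hook r κ d j * t.hook r κ d' j' = t.hook r κ d' j' * t.hook r κ d j := by
  have h1 := hκ d; have h2 := hκ d'
  simp only [hook]
  rcases lt_trichotomy j j' with hj | rfl | hj
  · have := Nat.mul_le_mul_left (r + 2) (show j + 1 ≤ j' from hj)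
    rw [mul_add, mul_one] at this
    exact (t.e_comm _ _ (by omega)).symm
  · obtain rfl := h.resolve_right (by simp)
    rfl
  · have := Nat.mul_le_mul_left (r + 2) (show j' + 1 ≤ j from hj)
    rw [mul_add, mul_one] at this
    exact t.e_comm _ _ (by omega)

include hA in
lemma par_ne_zero (s : Bool) : par A s ≠ 0 := by cases s <;> simp [par, hA]

include hδ in
lemma eq_par (s : Bool) : δ = -par A s ^ 2 - (par A s)⁻¹ ^ 2 := by
  cases s
  · simp only [par, hδ, inv_inv, Bool.false_eq_true, if_false]; ring
  · simp [par, hδ]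

include hA hδ hκ in
/-- Hooks can be moved along the strands of a parallel. -/
lemma slides_cabS (g : Slice) : Slides (t.hook r κ) g (t.cabS A (r + 2) g) where
  left d j hj := by
    have h1 := hκ d
    have := Nat.mul_le_mul_left (r + 2) (show j + 1 ≤ g.pos from hj)
    rw [mul_add, mul_one] at this
    exact (loc_cabP A (r + 2) g.piece _ _ _ (rp_e ((r + 2) * j + κ d) _ (by omega))).symm
  right d j := by
    have := rp_cabP (t := t) A (r + 2) g.piece _ _ (le_refl ((r + 2) * g.pos))
    have := loc_e _ _ _ (this.mono ((r + 2) * (g.pos + g.piece.dom + j) + κ d)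
      ((r + 2) * (g.pos + g.piece.cod + j) + κ d) ((r + 2) * j + κ d) (by ring) (by ring))
    exact this
  -- Around an extremum both the direction of the strand and the order of its copies are reversed: a
  -- hook at `κ b` on one leg reappears at `r - κ b = κ (!b)` on the other.
  cup b hb := by
    obtain ⟨g, i⟩ := g
    obtain rfl : g = .cup b := hb
    have h1 := hκ b
    have := t.U_mul_e r ((r + 2) * i) (κ b) (by omega)
    change t.U _ _ * t.e _ = t.U _ _ * t.e ((r + 2) * (i + 1) + κ (!b))
    rw [this, mul_add]
    congr 2; omega
  cap hb d := by
    obtain ⟨g, i⟩ := g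
    obtain rfl : g = .cap := hb
    have h1 := hκ d
    have := t.e_mul_C r ((r + 2) * i) (κ d) (by omega)
    change t.e _ * t.C _ _ = t.e ((r + 2) * (i + 1) + κ (!d)) * t.C _ _
    rw [this, mul_add]
    congr 2; omega
  cross s hb d := by
    obtain ⟨g, i⟩ := g
    obtain rfl : g = .cross s := hb
    have h1 := hκ d
    constructor
    · have := t.e_B_left (par_ne_zero hA s) (eq_par hδ s) (r + 2) (r + 2) ((r + 2) * i) (κ d)
        (by omega)
      change t.e _ * t.B _ _ _ _ = t.B _ _ _ _ * t.e ((r + 2) * (i + 1) + κ d)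
      rw [this, mul_add, mul_one]
    · have := t.e_B_right (par_ne_zero hA s) (eq_par hδ s) (r + 2) (r + 2) ((r + 2) * i) (κ d)
        (by omega)
      change t.e ((r + 2) * (i + 1) + κ d) * t.B _ _ _ _ = t.B _ _ _ _ * t.e _
      rw [← this, mul_add, mul_one]

/-- The slices of a word with their values in the parallel. -/
def cabList (A : k) (r : ℕ) (w : Word) : List (Slice × 𝒜) := w.map fun g => (g, t.cabS A r g)

@[simp] lemma map_fst_cabList (A : k) (r : ℕ) (w : Word) :
    (t.cabList A r w).map Prod.fst = w := by
  simp only [cabList, List.map_map]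
  exact List.map_id w

@[simp] lemma prod_cabList (A : k) (r : ℕ) (w : Word) :
    ((t.cabList A r w).map Prod.snd).prod = t.cabW A r w := by
  simp only [cabList, List.map_map]
  rfl

include hA hδ hκ in
lemma slides_cabList (w : Word) : ∀ g ∈ t.cabList A (r + 2) w, Slides (t.hook r κ) g.1 g.2 := by
  intro g hg
  obtain ⟨g, _, rfl⟩ := List.mem_map.1 hg
  exact t.slides_cabS hA hδ hκ g

lemma U_hook (hκ : ∀ d, κ d + κ (!d) = r) (b : Bool) :
    t.U (r + 2) 0 * t.hook r κ b 0 = t.U (r + 2) 0 * t.hook r κ (!b) 1 := by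
  have h1 := hκ b
  have := t.U_mul_e r 0 (κ b) (by omega)
  rw [zero_add, zero_add] at this
  rw [hook, hook, mul_zero, zero_add, this, mul_one]
  congr 2; omega

include hA hδ in
/-- Inserting elements at the first local minimum of a parallel defines a trace. -/
theorem trace_comm {b : Bool} {w : Word} (hw : run w [b, !b] = some []) {x : 𝒜}
    (hx : t.RP x (r + 2) (r + 2)) {i : ℕ} (hi : i ≤ r) :
    t.U (r + 2) 0 * (x * t.e i) * t.cabW A (r + 2) w =
      t.U (r + 2) 0 * (t.e i * x) * t.cabW A (r + 2) w := by
  -- With this choice the hook on strand `0` in direction `b` is `t.e i`.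
  set κ : Bool → ℕ := fun d => if d = b then i else r - i with hκ'
  have hκ : ∀ d, κ d + κ (!d) = r := fun d => by cases d <;> cases b <;> simp [hκ'] <;> omega
  have h1 := slide_ends (t.cabList A (r + 2) w) b (t.slides_cabList hA hδ hκ w) (by simpa using hw)
  have h2 := t.U_hook hκ b
  rw [prod_cabList] at h1
  have h3 : t.hook r κ b 0 = t.e i := by simp [hook, hκ']
  have h4 : t.hook r κ (!b) 1 * x = x * t.hook r κ (!b) 1 := by
    have := loc_e (t := t) _ _ _ (hx.mono ((r + 2) * 1 + κ (!b)) ((r + 2) * 1 + κ (!b))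
      (κ (!b)) (by ring) (by ring))
    exact this
  rw [h3] at h1 h2
  -- The hook travels through `w` from strand `0` to strand `1`, passes `x`, which lives on the
  -- first bundle, and returns over the first minimum to the other side of `x`.
  calc _ = t.U (r + 2) 0 * x * (t.e i * t.cabW A (r + 2) w) := by simp only [mul_assoc]
    _ = t.U (r + 2) 0 * (t.hook r κ (!b) 1 * x) * t.cabW A (r + 2) w := by
      rw [h1, h4]; simp only [mul_assoc]
    _ = _ := by rw [← mul_assoc, ← h2]; simp only [mul_assoc]

/-- The element `x` commutes with everything outside the block of `r` strands from `p` on. -/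
def Within (p r : ℕ) (x : 𝒜) : Prop := ∀ m, m + 2 ≤ p ∨ p + r ≤ m → t.e m * x = x * t.e m

variable {t} in
lemma Within.mul {p r : ℕ} {x y : 𝒜} (hx : t.Within p r x) (hy : t.Within p r y) :
    t.Within p r (x * y) := fun m hm => by
  rw [← mul_assoc, hx m hm, mul_assoc, hy m hm, mul_assoc]

lemma within_one (p r : ℕ) : t.Within p r 1 := fun m _ => by simp

lemma within_e (p r i : ℕ) (h1 : p ≤ i) (h2 : i + 2 ≤ p + r) : t.Within p r (t.e i) :=
  fun m hm => by
    rcases hm with hm | hm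
    · exact (t.e_comm _ _ (by omega)).symm
    · exact t.e_comm _ _ (by omega)

include hA hδ in
/-- A hook anywhere in the parallel of a knot diagram is annihilated by an element at the first
local minimum which annihilates all hooks there. -/
theorem annihilates {b : Bool} {v w : Word} (hc : components (⟨.cup b, 0⟩ :: (v ++ w)) = 1)
    {P Q : List Bool} {d : Bool} (hv : run v [b, !b] = some (P ++ d :: Q))
    (hw : run w (P ++ d :: Q) = some []) {f : 𝒜} (hf : t.RP f (r + 2) (r + 2))
    (h0 : ∀ i ≤ r, f * t.e i = 0) (h0' : ∀ i ≤ r, t.e i * f = 0) {i : ℕ} (hi : i ≤ r)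
    {x : 𝒜} (hx : t.Within ((r + 2) * P.length) (r + 2) x) :
    t.U (r + 2) 0 * f * t.cabW A (r + 2) v * x * t.e ((r + 2) * P.length + i) *
      t.cabW A (r + 2) w = 0 := by
  set κ : Bool → ℕ := fun d' => if d' = d then i else r - i with hκ'
  have hκ : ∀ d, κ d + κ (!d) = r := fun d' => by cases d' <;> cases d <;> simp [hκ'] <;> omega
  have h2 := t.U_hook hκ b
  have h4 : t.hook r κ (!b) 1 * f = f * t.hook r κ (!b) 1 := by
    have := loc_e (t := t) _ _ _ (hf.mono ((r + 2) * 1 + κ (!b)) ((r + 2) * 1 + κ (!b))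
      (κ (!b)) (by ring) (by ring))
    exact this
  have h5 : f * t.hook r κ b 0 = 0 := by
    have := hκ b
    rw [hook, mul_zero, zero_add]; exact h0 _ (by omega)
  have hL : ∀ g ∈ t.cabList A (r + 2) v ++ t.cabList A (r + 2) w,
      Slides (t.hook r κ) g.1 g.2 := fun g hg => by
    rcases List.mem_append.1 hg with hg | hg
    · exact t.slides_cabList hA hδ hκ v g hg
    · exact t.slides_cabList hA hδ hκ w g hg
  -- On the second leg the hook is carried over the minimum and meets `f` from below, which is where
  -- `h0'` is needed.
  have h6 : t.U (r + 2) 0 * f * t.hook r κ (!b) 1 = 0 := by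
    rw [mul_assoc, ← h4, ← mul_assoc, ← h2, mul_assoc]
    have := hκ b
    rw [hook, mul_zero, zero_add, h0' _ (by omega), mul_zero]
  -- With `f` included in the prefix, the colours of both legs at the start are zero, so they agree
  -- as required, and the hook brought to the start vanishes.
  have h8 := slide_to_start (t.U (r + 2) 0 * f) x _ _ b d P Q hL
    (by rw [h6, mul_assoc, h5, mul_zero])
    (by simpa using hv) (by simpa using hw) (by simpa [components, shadow_cons, Slice.flat] using hc)
    (fun d' j hj => hx _ (by
      have := hκ d'
      rcases Nat.lt_or_gt_of_ne hj with hj | hj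
      · have := Nat.mul_le_mul_left (r + 2) (show j + 1 ≤ P.length from hj)
        rw [mul_add, mul_one] at this
        left; omega
      · have := Nat.mul_le_mul_left (r + 2) (show P.length + 1 ≤ j from hj)
        rw [mul_add, mul_one] at this
        right; omega))
  rw [prod_cabList, prod_cabList, mul_assoc (t.U _ _) f (t.hook r κ b 0), h5, mul_zero,
    zero_mul] at h8
  rw [← h8, hook]
  simp [hκ']

/-- The product of cups which insert two neighbouring copies of every strand, chosen by `κ`. -/
def insertion (r : ℕ) (κ : Bool → ℕ) : ℕ → List Bool → 𝒜
  | _, [] => 1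
  | j, d :: O => t.u ((r + 2) * j + κ d) * insertion r κ (j + 1) O

lemma insertion_append (P Q : List Bool) : ∀ j, t.insertion r κ j (P ++ Q) =
    t.insertion r κ j P * t.insertion r κ (j + P.length) Q := by
  induction P with
  | nil => intro j; simp [insertion]
  | cons d P ih =>
    intro j
    simp only [List.cons_append, insertion, ih, List.length_cons, mul_assoc]
    rw [add_assoc, add_comm 1]

lemma insertion_comm (m n : ℕ) {x : 𝒜} (Q : List Bool) : ∀ i,
    t.RP x ((r + 2) * (i + m)) ((r + 2) * (i + n)) →
    t.insertion r κ (i + m) Q * x = x * t.insertion r κ (i + n) Q := by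
  induction Q with
  | nil => intro i _; simp [insertion]
  | cons d Q ih =>
    intro i hx
    simp only [insertion]
    have h2 := ih (i + 1) (hx.mono _ _ (r + 2) (by ring) (by ring))
    rw [add_right_comm i 1, add_right_comm i 1] at h2
    rw [mul_assoc, h2, ← mul_assoc, (hx (κ d)).1, mul_assoc]

include hκ in
lemma rp_insertion (P : List Bool) : ∀ j, t.RP (t.insertion r κ j P)
    ((r + 2) * j + r * P.length) ((r + 2) * (j + P.length)) := by
  induction P with
  | nil => intro j; exact RP.one _
  | cons d P ih =>
    intro j
    have h1 := hκ d
    have := rp_u (t := t) ((r + 2) * j + κ d) ((r + 2) * j + r) (by omega)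
    exact (this.mono _ _ (r * P.length) (by rw [List.length_cons]; ring) rfl).mul
      ((ih (j + 1)).mono _ _ 0 (by ring) (by rw [List.length_cons]; ring))

/-- The value of a slice in the parallel, with an additional hook at every local minimum. -/
def hookedS (A : k) (r : ℕ) (κ : Bool → ℕ) (g : Slice) : 𝒜 :=
  t.cabS A (r + 2) g * match g.piece with
    | .cup b => t.hook r κ b g.pos
    | _ => 1

-- The inserted pairs of copies retract. At a minimum the hook cuts the new pair of arcs, which
-- leaves one insertion on each leg; at a crossing the insertions are pulled through; at a maximum
-- two insertions meet and close up to a circle, hence the factor `δ`.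
include hA hδ hκ in
lemma insertion_mul_hookedS {g : Slice} {O O' : List Bool} (h : Step g O O') :
    t.insertion r κ 0 O * t.hookedS A r κ g =
      (if g.piece = .cap then δ else 1) • (t.cabS A r g * t.insertion r κ 0 O') := by
  have hR : ∀ Q : List Bool, t.insertion r κ (g.pos + g.piece.dom) Q * t.cabS A (r + 2) g =
      t.cabS A (r + 2) g * t.insertion r κ (g.pos + g.piece.cod) Q := fun Q =>
    t.insertion_comm _ _ Q _ ((rp_cabP A (r + 2) g.piece _ _ le_rfl).mono _ _ 0
      (by ring) (by ring))
  have hL : ∀ P : List Bool, P.length = g.pos →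
      t.insertion r κ 0 P * t.cabP A r g.piece ((r + 2) * g.pos) =
      t.cabS A r g * t.insertion r κ 0 P := fun P hP =>
    (loc_cabP A r g.piece _ _ _ ((t.rp_insertion hκ P 0).mono _ _ 0 (by simp [hP])
      (by simp [hP]))).symm
  cases h with
  | cup b P Q =>
    have e1 := hL P rfl
    have e2 := hR Q
    have h1 := hκ b
    simp only [Piece.dom, Piece.cod, add_zero] at e1 e2
    have e3 : t.insertion r κ (P.length + 2) Q * t.hook r κ b P.length =
        t.hook r κ b P.length * t.insertion r κ (P.length + 2) Q :=
      t.insertion_comm 2 2 Q _ (rp_e _ _ (by rw [mul_add]; omega))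
    have e4 : t.cabS A (r + 2) ⟨.cup b, P.length⟩ * t.hook r κ b P.length =
        t.cabP A r (.cup b) ((r + 2) * P.length) * (t.u ((r + 2) * P.length + κ b) *
          t.u ((r + 2) * (P.length + 1) + κ (!b))) := by
      change t.U _ _ * t.e _ = t.U _ _ * _
      rw [e, ← mul_assoc, t.U_mul_c_left r ((r + 2) * P.length) (κ b) (by omega), mul_assoc,
        t.uu ((r + 2) * P.length + κ b) ((r + 2) * P.length + 2 * r - κ b) (by omega)]
      congr 3; rw [mul_add]; omega
    rw [insertion_append, insertion_append, zero_add, hookedS, if_neg (by simp), one_smul]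
    simp only [insertion]
    calc _ = t.insertion r κ 0 P * (t.insertion r κ P.length Q *
          t.cabS A (r + 2) ⟨.cup b, P.length⟩) * t.hook r κ b P.length := by
          simp only [mul_assoc]
      _ = t.insertion r κ 0 P * (t.cabS A (r + 2) ⟨.cup b, P.length⟩ * t.hook r κ b P.length) *
          t.insertion r κ (P.length + 2) Q := by
          rw [e2, mul_assoc, mul_assoc, e3]; simp only [mul_assoc]
      _ = _ := by rw [e4, ← mul_assoc, e1]; simp only [mul_assoc]
  | cap b P Q =>
    have e1 := hL P rfl
    have e2 := hR Q
    have h1 := hκ b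
    simp only [Piece.dom, Piece.cod, add_zero] at e1 e2
    have e4 : t.u ((r + 2) * P.length + κ b) * (t.u ((r + 2) * (P.length + 1) + κ (!b)) *
        t.cabS A (r + 2) ⟨.cap, P.length⟩) = δ • t.cabP A r .cap ((r + 2) * P.length) := by
      change t.u _ * (t.u _ * t.C _ _) = δ • t.C _ _
      have := t.u_mul_C_right r ((r + 2) * P.length) (κ b) (by omega)
      rw [show (r + 2) * (P.length + 1) + κ (!b) = (r + 2) * P.length + 2 * r + 2 - κ b by
        rw [mul_add]; omega, this, ← mul_assoc, t.loop, Algebra.smul_def]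
    rw [insertion_append, insertion_append, zero_add, hookedS, if_pos rfl, mul_one]
    simp only [insertion]
    calc _ = t.insertion r κ 0 P * (t.u ((r + 2) * P.length + κ b) *
          (t.u ((r + 2) * (P.length + 1) + κ (!b)) *
          (t.insertion r κ (P.length + 2) Q * t.cabS A (r + 2) ⟨.cap, P.length⟩))) := by
          simp only [mul_assoc]
      _ = t.insertion r κ 0 P * (t.u ((r + 2) * P.length + κ b) *
          (t.u ((r + 2) * (P.length + 1) + κ (!b)) * t.cabS A (r + 2) ⟨.cap, P.length⟩)) *
          t.insertion r κ P.length Q := by rw [e2]; simp only [mul_assoc]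
      _ = _ := by rw [e4, mul_smul_comm, e1, smul_mul_assoc, mul_assoc]
  | cross s x y P Q =>
    have e1 := hL P rfl
    have e2 := hR Q
    have h1 := hκ x
    have h2 := hκ y
    simp only [Piece.dom, Piece.cod] at e1 e2
    have e4 : t.u ((r + 2) * P.length + κ x) * (t.u ((r + 2) * (P.length + 1) + κ y) *
        t.cabS A (r + 2) ⟨.cross s, P.length⟩) =
        t.cabP A r (.cross s) ((r + 2) * P.length) * (t.u ((r + 2) * P.length + κ y) *
        t.u ((r + 2) * (P.length + 1) + κ x)) := by
      change t.u _ * (t.u _ * t.B _ _ _ _) = t.B _ _ _ _ * _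
      have e5 := t.u_B_right (par_ne_zero hA s) (eq_par hδ s) (r + 2) r ((r + 2) * P.length) (κ y)
        (by omega)
      have e6 := t.u_B_left (par_ne_zero hA s) (eq_par hδ s) r r ((r + 2) * P.length) (κ x)
        (by omega)
      rw [mul_add, mul_one, e5, ← mul_assoc, e6, mul_assoc,
        t.uu ((r + 2) * P.length + κ y) ((r + 2) * P.length + r + κ x) (by omega)]
      congr 3; omega
    rw [insertion_append, insertion_append, zero_add, hookedS, if_neg (by simp), one_smul, mul_one]
    simp only [insertion]
    calc _ = t.insertion r κ 0 P * (t.u ((r + 2) * P.length + κ x) *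
          (t.u ((r + 2) * (P.length + 1) + κ y) *
          (t.insertion r κ (P.length + 2) Q * t.cabS A (r + 2) ⟨.cross s, P.length⟩))) := by
          simp only [mul_assoc]
      _ = t.insertion r κ 0 P * (t.u ((r + 2) * P.length + κ x) *
          (t.u ((r + 2) * (P.length + 1) + κ y) * t.cabS A (r + 2) ⟨.cross s, P.length⟩)) *
          t.insertion r κ (P.length + 2) Q := by rw [e2]; simp only [mul_assoc]
      _ = _ := by rw [e4, ← mul_assoc, e1]; simp only [mul_assoc]

/-- The slices of a word with their values in the parallel with additional hooks. -/
def hookedList (A : k) (r : ℕ) (κ : Bool → ℕ) (w : Word) : List (Slice × 𝒜) :=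
  w.map fun g => (g, t.hookedS A r κ g)

@[simp] lemma map_fst_hookedList (w : Word) : (t.hookedList A r κ w).map Prod.fst = w := by
  simp only [hookedList, List.map_map]
  exact List.map_id w

lemma map_snd_hookedList (w : Word) :
    (t.hookedList A r κ w).map Prod.snd = w.map (t.hookedS A r κ) := by
  simp only [hookedList, List.map_map]
  rfl

include hA hδ hκ in
lemma slides_hookedList (w : Word) :
    ∀ g ∈ t.hookedList A r κ w, Slides (t.hook r κ) g.1 g.2 := by
  intro g hg
  obtain ⟨g, _, rfl⟩ := List.mem_map.1 hg
  have h1 := t.slides_cabS hA hδ hκ g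
  rw [hookedS]
  split
  · rename_i b hb
    exact h1.mul_of_cup hb fun d j h => t.hook_comm hκ _ _ _ _ h
  · rwa [mul_one]

include hA hδ hκ in
lemma insertion_mul_hooked (w : Word) : ∀ {O O' : List Bool}, run w O = some O' →
    t.insertion r κ 0 O * (w.map (t.hookedS A r κ)).prod =
      δ ^ w.countP (fun g => g.piece = .cap) • (t.cabW A r w * t.insertion r κ 0 O') := by
  induction w with
  | nil =>
    intro O O' h
    simp only [run, Option.some.injEq] at h
    subst h
    simp
  | cons g w ih =>
    intro O O' h
    obtain ⟨M, h1, h2⟩ := run_cons_eq_some.1 h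
    rw [List.map_cons, List.prod_cons, ← mul_assoc, t.insertion_mul_hookedS hA hδ hκ h1,
      smul_mul_assoc, mul_assoc, ih h2, mul_smul_comm, smul_smul, cabW_cons, mul_assoc,
      List.countP_cons]
    congr 1
    by_cases hg : g.piece = .cap <;> simp [hg, pow_succ, mul_comm]

-- The hooks are carried to the first minimum one by one, along the only component, and each is
-- absorbed there by `f` at the cost of `δ`. The prefix `v` contains the slices whose hooks have
-- already been removed.
include hA hδ hκ in
lemma cabW_mul_hooked (v w : Word) {b : Bool} (hc : components (⟨.cup b, 0⟩ :: (v ++ w)) = 1)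
    (h : run (v ++ w) [b, !b] = some []) {f : 𝒜} (h0 : f * t.hook r κ b 0 = δ • f)
    (h1 : f * t.hook r κ b 0 = f * t.hook r κ (!b) 1) :
    f * t.cabW A (r + 2) v * (w.map (t.hookedS A r κ)).prod =
      δ ^ w.countP (fun g => g.piece.dom = 0) • (f * t.cabW A (r + 2) (v ++ w)) := by
  induction w generalizing v with
  | nil => simp
  | cons g w ih =>
    have h2 := ih (v ++ [g]) (by simpa using hc) (by simpa using h)
    rw [cabW_append, cabW_cons, cabW_nil, mul_one] at h2
    obtain ⟨M, hv, hw⟩ := run_append_eq_some.1 h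
    obtain ⟨M', hs, hw⟩ := run_cons_eq_some.1 hw
    rw [List.map_cons, List.prod_cons, List.countP_cons]
    rw [List.append_assoc] at h2
    cases hs with
    | cup d P Q =>
      have h3 := slide_to_start f 1 (t.cabList A (r + 2) (v ++ [⟨.cup d, P.length⟩]))
        (t.hookedList A r κ w) b d P ((!d) :: Q) (fun g hg => by
          rcases List.mem_append.1 hg with hg | hg
          · exact t.slides_cabList hA hδ hκ _ g hg
          · exact t.slides_hookedList hA hδ hκ w g hg) h1
        (by rw [map_fst_cabList]
            exact run_append_eq_some.2 ⟨_, hv, run_cons_eq_some.2 ⟨_, .cup _ _ _, rfl⟩⟩)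
        (by simpa using hw)
        (by simpa [components, shadow_cons, Slice.flat] using hc) (fun d j _ => by simp)
      rw [mul_one, mul_one, prod_cabList, map_snd_hookedList, h0, cabW_append, cabW_cons, cabW_nil, mul_one] at h3
      simp only [List.cons_append, List.nil_append] at h2
      rw [if_pos (by simp [Piece.dom]), pow_succ', mul_smul, ← h2]
      simp only [hookedS]
      simp only [mul_assoc, smul_mul_assoc] at h3 ⊢
      exact h3
    | cap d P Q => simpa [hookedS, Piece.dom, mul_assoc] using h2
    | cross s x y P Q => simpa [hookedS, Piece.dom, mul_assoc] using h2

/-- Each minimum adds two strands and each maximum removes two. -/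
lemma countP_cap (w : Word) : ∀ {O O' : List Bool}, run w O = some O' →
    O'.length + 2 * w.countP (fun g => g.piece = .cap) =
      O.length + 2 * w.countP (fun g => g.piece.dom = 0) := by
  induction w with
  | nil =>
    intro O O' h
    simp only [run, Option.some.injEq] at h
    subst h; simp
  | cons g w ih =>
    intro O O' h
    obtain ⟨M, h1, h2⟩ := run_cons_eq_some.1 h
    have := ih h2
    rw [List.countP_cons, List.countP_cons]
    cases h1 <;> simp [Piece.dom] at this ⊢ <;> omega

include hA hδ in
/-- The partial trace in the parallel of a knot diagram. -/
theorem partial_trace (h0 : δ ≠ 0) {b : Bool} {w : Word}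
    (hc : components (⟨.cup b, 0⟩ :: w) = 1) (hw : run w [b, !b] = some []) {y : 𝒜}
    (hy : t.RP y r r) {i : ℕ} (hi : i ≤ r) :
    t.U (r + 2) 0 * (t.c i * y * t.u i) * t.cabW A (r + 2) w =
      δ • (t.U r 0 * y * t.cabW A r w) := by
  set κ : Bool → ℕ := fun d => if d = b then i else r - i with hκ'
  have hκ : ∀ d, κ d + κ (!d) = r := fun d => by cases d <;> cases b <;> simp [hκ'] <;> omega
  have hb : κ b = i := by simp [hκ']
  have hb' : κ (!b) = r - i := by simp [hκ']
  have e1 := t.insertion_mul_hooked hA hδ hκ w hw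
  -- The insertion on the two legs of the first minimum is written in both orders of its cups, so
  -- that a hook on either leg meets its own cup and yields `δ`.
  have e0 : t.insertion r κ 0 [b, !b] = t.u i * t.u (2 * r + 2 - i) := by
    simp only [insertion, mul_one, hb, hb', mul_zero, zero_add]
    congr 2; omega
  have e0' : t.insertion r κ 0 [b, !b] = t.u (2 * r - i) * t.u i := by
    rw [e0, t.uu i (2 * r - i) (by omega)]; congr 2; omega
  have e2 := t.cabW_mul_hooked hA hδ hκ [] w (by simpa using hc) hw (f := t.insertion r κ 0 [b, !b])
    (by
      rw [e0', hook, mul_zero, zero_add, hb, mul_assoc, t.u_mul_e, Algebra.left_comm,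
        Algebra.smul_def])
    (by
      rw [hook, hook, mul_zero, zero_add, hb, hb', e0', mul_assoc, t.u_mul_e,
        ← e0', e0, mul_assoc, show (r + 2) * 1 + (r - i) = 2 * r + 2 - i by omega, t.u_mul_e,
        Algebra.left_comm, Algebra.left_comm, ← e0, e0'])
  rw [cabW_nil, mul_one, List.nil_append] at e2
  have e3 := countP_cap w hw
  simp only [List.length_nil, List.length_cons, zero_add] at e3
  -- The word `w` leads from two strands to none, so it has one more maximum than minima. After
  -- cancelling the common power of `δ`, a single factor remains.
  have e4 : t.insertion r κ 0 [b, !b] * t.cabW A (r + 2) w = δ • t.cabW A r w := by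
    rw [e1, show w.countP (fun g => decide (g.piece = .cap)) =
      w.countP (fun g => decide (g.piece.dom = 0)) + 1 by omega, pow_succ, mul_smul] at e2
    rw [show t.insertion r κ 0 [] = 1 from rfl, mul_one] at e2
    exact (smul_right_injective 𝒜 (pow_ne_zero _ h0) e2).symm
  have e5 : t.u (2 * r - i) * y = y * t.u (2 * r - i) := by
    have := (hy (r - i)).1
    rwa [show r + (r - i) = 2 * r - i by omega] at this
  calc _ = t.U (r + 2) 0 * t.c (0 + i) * y * t.u i * t.cabW A (r + 2) w := by
        rw [zero_add]; simp only [mul_assoc]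
    _ = t.U r 0 * (t.u (2 * r - i) * y) * t.u i * t.cabW A (r + 2) w := by
        rw [t.U_mul_c_left r 0 i hi, zero_add]; simp only [mul_assoc]
    _ = t.U r 0 * y * (t.insertion r κ 0 [b, !b] * t.cabW A (r + 2) w) := by
        rw [e5, e0']; simp only [mul_assoc]
    _ = _ := by rw [e4, mul_smul_comm]

end Coupons
end TL
namespace TL

section JonesWenzl
variable {k 𝒜 : Type*} [Field k] [Ring 𝒜] [Algebra k 𝒜] {δ : k} (t : TL k 𝒜 δ)

/-! ### Jones–Wenzl elements -/

/-- Chebyshev polynomials at `δ`. -/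
def cheb {k : Type*} [CommRing k] (δ : k) : ℕ → k
  | 0 => 1
  | 1 => δ
  | c + 2 => δ * cheb δ (c + 1) - cheb δ c

/-- The Jones–Wenzl element on `c` strands from position `p` on. -/
def jw (p : ℕ) : ℕ → 𝒜
  | 0 => 1
  | 1 => 1
  | c + 2 => jw p (c + 1) - (cheb δ c / cheb δ (c + 1)) • (jw p (c + 1) * t.e (p + c) * jw p (c + 1))

lemma jw_succ_succ (p c : ℕ) : t.jw p (c + 2) = t.jw p (c + 1) -
    (cheb δ c / cheb δ (c + 1)) • (t.jw p (c + 1) * t.e (p + c) * t.jw p (c + 1)) := by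
  rw [jw]

variable {t} in
lemma RP.sub {x y : 𝒜} {p q : ℕ} (hx : t.RP x p q) (hy : t.RP y p q) : t.RP (x - y) p q :=
  fun j => by simp only [mul_sub, sub_mul, (hx j).1, (hx j).2, (hy j).1, (hy j).2, and_self]

lemma rp_jw (p c : ℕ) : t.RP (t.jw p c) (p + c) (p + c) := by
  induction c using Nat.twoStepInduction with
  | zero => exact RP.one _
  | one => exact RP.one _
  | more c _ ih =>
    rw [jw_succ_succ]
    have h1 := ih.mono (p + (c + 2)) (p + (c + 2)) 1 (by ring) (by ring)
    have h2 := rp_e (t := t) (p + c) (p + (c + 2)) (by omega)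
    exact h1.sub (((h1.mul h2).mul h1).smul _)

/-- Apart from the identity, every term of a Jones–Wenzl element contains a hook, which `z` kills by
the recursion. -/
lemma mul_jw_of (p c : ℕ) (z : 𝒜) (h : ∀ j, j + 2 ≤ c → z * t.e (p + j) = 0) :
    z * t.jw p c = z := by
  induction c using Nat.twoStepInduction with
  | zero => exact mul_one z
  | one => exact mul_one z
  | more c _ ih =>
    have h1 := ih fun j hj => h j (by omega)
    rw [jw_succ_succ, mul_sub, mul_smul_comm, ← mul_assoc, ← mul_assoc, h1, h c (by omega),
      zero_mul, smul_zero, sub_zero]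

lemma jw_mul_of (p c : ℕ) (z : 𝒜) (h : ∀ j, j + 2 ≤ c → t.e (p + j) * z = 0) :
    t.jw p c * z = z := by
  induction c using Nat.twoStepInduction with
  | zero => exact one_mul z
  | one => exact one_mul z
  | more c _ ih =>
    have h1 := ih fun j hj => h j (by omega)
    rw [jw_succ_succ, sub_mul, smul_mul_assoc, mul_assoc, h1, mul_assoc, h c (by omega),
      mul_zero, smul_zero, sub_zero]

/-- Jones–Wenzl elements are polynomials in hooks, so they slide wherever these hooks slide. -/
lemma jw_intertwine (p q c : ℕ) (x : 𝒜)
    (h : ∀ j, j + 2 ≤ c → t.e (p + j) * x = x * t.e (q + j)) : t.jw p c * x = x * t.jw q c := by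
  induction c using Nat.twoStepInduction with
  | zero => simp [jw]
  | one => simp [jw]
  | more c _ ih =>
    have h1 := ih fun j hj => h j (by omega)
    rw [jw_succ_succ, jw_succ_succ, sub_mul, mul_sub, smul_mul_assoc, mul_smul_comm, h1,
      mul_assoc, h1, mul_assoc (t.jw p _), ← mul_assoc (t.e _), h c (by omega), mul_assoc,
      ← mul_assoc, h1]
    simp only [mul_assoc]

variable (hc : ∀ c, cheb δ c ≠ 0)
include hc

/-- The three statements need a joint induction: the coefficient in the recursion is inverse to the
scalar in the third statement, which makes the next element annihilate the new hook. The third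
statement continues because `δ - cheb δ c / cheb δ (c + 1)` is the next quotient of Chebyshev
values. -/
lemma jw_aux (p c : ℕ) : (∀ j, j + 2 ≤ c + 1 → t.jw p (c + 1) * t.e (p + j) = 0) ∧
    (∀ j, j + 2 ≤ c + 1 → t.e (p + j) * t.jw p (c + 1) = 0) ∧
    t.e (p + c) * t.jw p (c + 1) * t.e (p + c) =
      (cheb δ (c + 1) / cheb δ c) • (t.jw p c * t.e (p + c)) := by
  induction c with
  | zero =>
    refine ⟨fun j h => by omega, fun j h => by omega, ?_⟩
    simp [jw, cheb, e_mul_e, Algebra.smul_def]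
  | succ c ih =>
    obtain ⟨h1, h2, h3⟩ := ih
    set f := t.jw p (c + 1)
    have hf : f * f = f := t.mul_jw_of p (c + 1) f h1
    have hf' : f * t.jw p c = f := t.mul_jw_of p c f fun j hj => h1 j (by omega)
    have hf2 : t.jw p c * f = f := t.jw_mul_of p c f fun j hj => h2 j (by omega)
    have hcomm : t.e (p + (c + 1)) * f = f * t.e (p + (c + 1)) := by
      have := loc_e (t := t) _ _ _ (t.rp_jw p (c + 1)); exact this
    have hce : t.jw p c * t.e (p + c) = t.e (p + c) * t.jw p c := by
      have := loc_e (t := t) _ _ _ (t.rp_jw p c); exact this.symm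
    have hμ : (cheb δ c / cheb δ (c + 1)) * (cheb δ (c + 1) / cheb δ c) = 1 := by
      have := hc c; have := hc (c + 1); field_simp
    refine ⟨fun j hj => ?_, fun j hj => ?_, ?_⟩
    · rw [jw_succ_succ, sub_mul, smul_mul_assoc]
      rcases Nat.lt_or_ge j c with h | h
      · rw [mul_assoc _ f, h1 j (by omega), mul_zero, smul_zero, sub_zero]
      · obtain rfl : j = c := by omega
        rw [mul_assoc f, mul_assoc f, h3, mul_smul_comm, smul_smul, hμ, one_smul, ← mul_assoc,
          hf', sub_self]
    · rw [jw_succ_succ, mul_sub, mul_smul_comm]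
      rcases Nat.lt_or_ge j c with h | h
      · rw [← mul_assoc, ← mul_assoc, h2 j (by omega), zero_mul, zero_mul, smul_zero, sub_zero]
      · obtain rfl : j = c := by omega
        rw [← mul_assoc, ← mul_assoc, h3, smul_mul_assoc, smul_smul, hμ, one_smul, hce, mul_assoc,
          hf2, sub_self]
    · rw [jw_succ_succ, mul_sub, sub_mul, mul_smul_comm, smul_mul_assoc]
      change t.e (p + (c + 1)) * f * t.e (p + (c + 1)) - (cheb δ c / cheb δ (c + 1)) •
        (t.e (p + (c + 1)) * (f * t.e (p + c) * f) * t.e (p + (c + 1))) = _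
      have e1 : t.e (p + (c + 1)) * f * t.e (p + (c + 1)) = δ • (f * t.e (p + (c + 1))) := by
        rw [hcomm, mul_assoc, t.e_mul_e, Algebra.left_comm, Algebra.smul_def]
      have e2 : t.e (p + (c + 1)) * (f * t.e (p + c) * f) * t.e (p + (c + 1)) =
          f * t.e (p + (c + 1)) := by
        calc _ = (t.e (p + (c + 1)) * f) * t.e (p + c) * (f * t.e (p + (c + 1))) := by
              simp only [mul_assoc]
          _ = (f * t.e (p + (c + 1))) * t.e (p + c) * (t.e (p + (c + 1)) * f) := by rw [hcomm]
          _ = f * (t.e (p + c + 1) * t.e (p + c) * t.e (p + c + 1)) * f := by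
              simp only [mul_assoc, add_assoc]
          _ = f * (f * t.e (p + (c + 1))) := by
              rw [t.e_succ_e_e_succ, mul_assoc, ← hcomm]; rfl
          _ = _ := by rw [← mul_assoc, hf]
      rw [e1, e2, ← sub_smul]
      congr 1
      have := hc (c + 1)
      rw [cheb]
      field_simp

lemma jw_mul_e (p c j : ℕ) (h : j + 2 ≤ c) : t.jw p c * t.e (p + j) = 0 := by
  obtain ⟨c, rfl⟩ : ∃ c', c = c' + 1 := ⟨c - 1, by omega⟩
  exact (t.jw_aux hc p c).1 j h

lemma e_mul_jw (p c j : ℕ) (h : j + 2 ≤ c) : t.e (p + j) * t.jw p c = 0 := by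
  obtain ⟨c, rfl⟩ : ∃ c', c = c' + 1 := ⟨c - 1, by omega⟩
  exact (t.jw_aux hc p c).2.1 j h

lemma jw_mul_jw (p c : ℕ) : t.jw p c * t.jw p c = t.jw p c :=
  t.mul_jw_of p c _ fun j hj => t.jw_mul_e hc p c j hj

-- An element that kills hooks sees only the term `a • 1` of a crossing.
omit hc in
lemma mul_cr_of (a : k) (z : 𝒜) (L : List ℕ) (h : ∀ l ∈ L, z * t.e l = 0) :
    z * (L.map (t.cr a)).prod = a ^ L.length • z := by
  induction L with
  | nil => simp
  | cons l L ih =>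
    have : z * t.cr a l = a • z := by simp [cr, mul_add, h l (by simp)]
    rw [List.map_cons, List.prod_cons, ← mul_assoc, this, smul_mul_assoc,
      ih fun l hl => h l (by simp [hl]), smul_smul, List.length_cons, pow_succ']

/-- A Jones–Wenzl element can be moved around a local minimum. -/
lemma U_jw (r p : ℕ) : t.U r p * t.jw p r = t.U r p * t.jw (p + r) r := by
  rcases Nat.lt_or_ge r 2 with hr | hr
  · interval_cases r <;> simp [jw]
  obtain ⟨r, rfl⟩ : ∃ r', r = r' + 2 := ⟨r - 2, by omega⟩
  have h1 : ∀ j, j ≤ r → t.U (r + 2) p * t.e (p + j) =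
      t.U (r + 2) p * t.e (p + (r + 2) + (r - j)) := fun j hj => by
    rw [t.U_mul_e r p j hj]; congr 2; omega
  have hcm : ∀ j, t.e (p + (r + 2) + j) * t.jw p (r + 2) = t.jw p (r + 2) * t.e (p + (r + 2) + j) :=
    fun j => loc_e.shift j _ _ _ (t.rp_jw p (r + 2))
  have hcm' : ∀ j, j ≤ r → t.jw (p + (r + 2)) (r + 2) * t.e (p + j) =
      t.e (p + j) * t.jw (p + (r + 2)) (r + 2) := fun j hj =>
    t.jw_intertwine _ _ _ _ fun l _ => t.e_comm _ _ (by omega)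
  -- Hooks on the right legs slide to the left legs, so the element on the left legs kills them too
  -- and absorbs a second element on the right; `h3` is symmetric. Both sides equal the value with
  -- an element on each side.
  have h2 : t.U (r + 2) p * t.jw p (r + 2) * t.jw (p + (r + 2)) (r + 2) =
      t.U (r + 2) p * t.jw p (r + 2) := t.mul_jw_of _ _ _ fun j hj => by
    rw [mul_assoc, ← hcm, ← mul_assoc]
    have := h1 (r - j) (by omega)
    rw [show r - (r - j) = j by omega] at this
    rw [← this, mul_assoc, t.e_mul_jw hc _ _ _ (by omega), mul_zero]
  have h3 : t.U (r + 2) p * t.jw (p + (r + 2)) (r + 2) * t.jw p (r + 2) =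
      t.U (r + 2) p * t.jw (p + (r + 2)) (r + 2) := t.mul_jw_of _ _ _ fun j hj => by
    rw [mul_assoc, hcm' j (by omega), ← mul_assoc, h1 j (by omega), mul_assoc,
      t.e_mul_jw hc _ _ _ (by omega), mul_zero]
  have h4 : t.jw p (r + 2) * t.jw (p + (r + 2)) (r + 2) =
      t.jw (p + (r + 2)) (r + 2) * t.jw p (r + 2) :=
    t.jw_intertwine _ _ _ _ fun l hl => (hcm' l (by omega)).symm
  rw [← h2, mul_assoc, h4, ← mul_assoc, h3]

/-! ### Full twists -/

omit hc
variable {a : k} (ha : a ≠ 0) (hδ : δ = -a ^ 2 - a⁻¹ ^ 2)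

/-- A full twist of the first `r` strands. -/
def twist (a : k) (r : ℕ) : 𝒜 := t.row a 0 (r - 1) ^ r

lemma rp_twist (r : ℕ) : t.RP (t.twist a r) r r := by
  have h : t.RP (t.row a 0 (r - 1)) r r := by
    rcases r with _ | r
    · exact RP.one _
    · exact rp_row a r 0 (r + 1) (by omega)
  have : ∀ n : ℕ, t.RP (t.row a 0 (r - 1) ^ n) r r := fun n => by
    induction n with
    | zero => rw [pow_zero]; exact RP.one _
    | succ n ih => rw [pow_succ]; exact ih.mul h
  exact this r

-- A full twist on `r` strands has `r * (r - 1)` crossings, each of which becomes `a`.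
include hc in
lemma jw_mul_twist (r : ℕ) : t.jw 0 r * t.twist a r = a ^ (r * (r - 1)) • t.jw 0 r := by
  have h : t.jw 0 r * t.row a 0 (r - 1) = a ^ (r - 1) • t.jw 0 r := by
    have := t.mul_cr_of a (t.jw 0 r) ((List.range (r - 1)).map (0 + ·)) fun l hl => by
      simp only [List.mem_map, List.mem_range] at hl
      obtain ⟨l, hl, rfl⟩ := hl
      exact t.jw_mul_e hc 0 r l (by omega)
    rw [List.map_map, List.length_map, List.length_range] at this
    rw [row_eq_prod]; exact this
  rw [twist]
  suffices H : ∀ n : ℕ, t.jw 0 r * t.row a 0 (r - 1) ^ n = a ^ (n * (r - 1)) • t.jw 0 r from H r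
  intro n
  induction n with
  | zero => simp
  | succ n ih =>
    rw [pow_succ, ← mul_assoc, ih, smul_mul_assoc, h, smul_smul, ← pow_add]; congr 2; ring

include ha hδ

lemma u_row_row (n : ℕ) : ∀ p, t.u p * (t.row a (p + 1) n * t.row a p n) = t.u (p + n) := by
  induction n with
  | zero => intro p; simp [row]
  | succ n ih =>
    intro p
    have h := loc_row (t := t) a n _ _ _ (rp_cr (t := t) a p (p + 2) le_rfl)
    dsimp only at h
    calc _ = t.u p * (t.cr a (p + 1) * (t.row a (p + 2) n * t.cr a p) * t.row a (p + 1) n) := by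
          rw [row, row]; simp only [mul_assoc]
      _ = t.u p * (t.cr a (p + 1) * t.cr a p) * (t.row a (p + 1 + 1) n * t.row a (p + 1) n) := by
          rw [h]; simp only [mul_assoc]
      _ = _ := by rw [t.u_mul_cr_cr ha hδ, ih]; congr 1; ring

lemma row_row_c (n : ℕ) : ∀ p, t.row a (p + 1) n * t.row a p n * t.c (p + n) = t.c p := by
  induction n with
  | zero => intro p; simp [row]
  | succ n ih =>
    intro p
    have h := loc_row (t := t) a n _ _ _ (rp_cr (t := t) a p (p + 2) le_rfl)
    dsimp only at h
    calc _ = t.cr a (p + 1) * (t.row a (p + 2) n * t.cr a p) * t.row a (p + 1) n *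
          t.c (p + (n + 1)) := by rw [row, row]; simp only [mul_assoc]
      _ = t.cr a (p + 1) * t.cr a p * (t.row a (p + 1 + 1) n * t.row a (p + 1) n *
          t.c (p + 1 + n)) := by
          rw [h, show p + (n + 1) = p + 1 + n by ring]; simp only [mul_assoc]
      _ = _ := by rw [ih, mul_assoc, t.cr_cr_mul_c_succ ha hδ]

/-- The first `i` rows shift the cup to position `0`. The next two rows carry it to position `r`
with two curls, worth `(-a⁻³)²`. The last `r - i` rows bring it back to `i`, and the other strands
keep their full twist. -/
lemma u_mul_twist (r i : ℕ) (hi : i ≤ r) :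
    t.u i * t.twist a (r + 2) = (a⁻¹ ^ 6) • (t.twist a r * t.u i) := by
  have h0 : t.u 0 * t.row a 0 (r + 1) ^ 2 = (a⁻¹ ^ 6) • t.u r := by
    have := t.u_row_row ha hδ r 0
    rw [pow_two]
    nth_rewrite 2 [row_snoc]
    rw [row, ← mul_assoc, ← mul_assoc, ← mul_assoc, t.u_mul_cr ha hδ]
    simp only [zero_add, smul_mul_assoc, mul_assoc] at this ⊢
    rw [← mul_assoc (t.row a 1 r), ← mul_assoc (t.u 0), this, t.u_mul_cr ha hδ, smul_smul]
    congr 1; ring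
  have h1 : ∀ m n, m + n ≤ r → t.u (n + m) * t.row a 0 (r + 1) ^ m =
      t.row a 0 (r - 1) ^ m * t.u n := by
    intro m
    induction m with
    | zero => intro n _; simp
    | succ m ih =>
      intro n hn
      have := t.u_row ha hδ (r - 1) 0 (n + m) (by omega)
      rw [show 0 + 1 + (n + m) = n + (m + 1) by ring, show r - 1 + 2 = r + 1 by omega,
        zero_add] at this
      rw [pow_succ', ← mul_assoc, this, mul_assoc, ih n (by omega), ← mul_assoc, pow_succ']
  have h2 := h1 i 0 (by omega)
  have h3 := h1 (r - i) i (by omega)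
  rw [show i + (r - i) = r by omega] at h3
  rw [zero_add] at h2
  rw [twist, twist, show r + 2 - 1 = r + 1 by omega]
  have e1 : t.row a 0 (r + 1) ^ (r + 2) = t.row a 0 (r + 1) ^ i *
      (t.row a 0 (r + 1) ^ 2 * t.row a 0 (r + 1) ^ (r - i)) := by
    rw [← pow_add, ← pow_add]; congr 1; omega
  have e2 : t.row a 0 (r - 1) ^ r = t.row a 0 (r - 1) ^ i * t.row a 0 (r - 1) ^ (r - i) := by
    rw [← pow_add]; congr 1; omega
  rw [e1, e2, ← mul_assoc, h2, mul_assoc, ← mul_assoc (t.u 0), h0, smul_mul_assoc, mul_smul_comm,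
    h3, mul_assoc]

lemma twist_mul_c (r i : ℕ) (hi : i ≤ r) :
    t.twist a (r + 2) * t.c i = (a⁻¹ ^ 6) • (t.c i * t.twist a r) := by
  have h0 : t.row a 0 (r + 1) ^ 2 * t.c r = (a⁻¹ ^ 6) • t.c 0 := by
    have := t.row_row_c ha hδ r 0
    rw [pow_two]
    nth_rewrite 2 [row_snoc]
    rw [row, zero_add, zero_add, mul_assoc, mul_assoc, mul_assoc, t.cr_mul_c ha hδ]
    simp only [zero_add, mul_smul_comm] at this ⊢
    rw [← mul_assoc (t.row a 1 r), this, t.cr_mul_c ha hδ, smul_smul]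
    congr 1; ring
  have h1 : ∀ m n, m + n ≤ r → t.row a 0 (r + 1) ^ m * t.c n =
      t.c (n + m) * t.row a 0 (r - 1) ^ m := by
    intro m
    induction m with
    | zero => intro n _; simp
    | succ m ih =>
      intro n hn
      have := t.c_row ha hδ (r - 1) 0 (n + m) (by omega)
      rw [show 0 + 1 + (n + m) = n + (m + 1) by ring, show r - 1 + 2 = r + 1 by omega,
        zero_add] at this
      rw [pow_succ', mul_assoc, ih n (by omega), ← mul_assoc, ← this, mul_assoc, pow_succ']
  have h2 := h1 i 0 (by omega)
  have h3 := h1 (r - i) i (by omega)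
  rw [show i + (r - i) = r by omega] at h3
  rw [zero_add] at h2
  rw [twist, twist, show r + 2 - 1 = r + 1 by omega]
  have e1 : t.row a 0 (r + 1) ^ (r + 2) = t.row a 0 (r + 1) ^ i *
      (t.row a 0 (r + 1) ^ 2 * t.row a 0 (r + 1) ^ (r - i)) := by
    rw [← pow_add, ← pow_add]; congr 1; omega
  have e2 : t.row a 0 (r - 1) ^ r = t.row a 0 (r - 1) ^ i * t.row a 0 (r - 1) ^ (r - i) := by
    rw [← pow_add]; congr 1; omega
  rw [e1, e2, mul_assoc, mul_assoc, h3, ← mul_assoc _ (t.c r), h0, smul_mul_assoc, mul_smul_comm,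
    ← mul_assoc, h2, mul_assoc]

lemma twist_comm (r i : ℕ) (hi : i ≤ r) :
    t.e i * t.twist a (r + 2) = t.twist a (r + 2) * t.e i := by
  rw [e, mul_assoc, t.u_mul_twist ha hδ r i hi, ← mul_assoc, t.twist_mul_c ha hδ r i hi,
    mul_smul_comm, smul_mul_assoc, mul_assoc]

end JonesWenzl
end TL

/-! ### Combinatorics of the expansion. -/

/-- The coefficients of the expansion of twisted strands by Jones–Wenzl elements. -/
def twistCoeff : ℕ → ℕ → ℕ → ℕ
  | 0, _, 0 => 1
  | 0, _, _ + 1 => 0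
  | k + 1, 0, d => twistCoeff k 1 d
  | k + 1, c + 1, 0 => twistCoeff k (c + 2) 0
  | k + 1, c + 1, d + 1 => twistCoeff k (c + 2) (d + 1) + twistCoeff k c d

lemma twistCoeff_zero (k : ℕ) : ∀ c, twistCoeff k c 0 = 1 := by
  induction k with
  | zero => intro c; rfl
  | succ k ih => intro c; rcases c with _ | c <;> simp [twistCoeff, ih]

lemma twistCoeff_eq_zero (k : ℕ) : ∀ c d, c + k < 2 * d → twistCoeff k c d = 0 := by
  induction k with
  | zero => intro c d h; rcases d with _ | d; · omega
            rfl
  | succ k ih =>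
    intro c d h
    rcases d with _ | d
    · omega
    rcases c with _ | c
    · exact ih _ _ (by omega)
    · simp [twistCoeff, ih (c + 2) (d + 1) (by omega), ih c d (by omega)]

/-- The recursion follows a walk on the colours with steps `±1` that is reflected at `0`; each step
down costs `η`. So `twistCoeff n c d` counts the walks of `n` steps from `c` with `d` steps down. In
the application `H n c` is the value with a Jones–Wenzl element on `c` of `c + n` strands. -/
lemma eq_sum_twistCoeff {k V : Type*} [Field k] [AddCommGroup V] [Module k V] (H : ℕ → ℕ → V)
    (S : ℕ → V) (η : k) (ω : ℕ → k) (h0 : ∀ c, H 0 c = ω c • S c) (h1 : ∀ n, H (n + 1) 0 = H n 1)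
    (h2 : ∀ n c, H (n + 1) (c + 1) = H n (c + 2) + η • H n c) (n : ℕ) : ∀ c N, c + n < 2 * N →
    H n c = ∑ d ∈ Finset.range N,
      ((twistCoeff n c d : k) * (η ^ d * ω (c + n - 2 * d))) • S (c + n - 2 * d) := by
  induction n with
  | zero =>
    intro c N hN
    obtain ⟨N, rfl⟩ : ∃ N', N = N' + 1 := ⟨N - 1, by omega⟩
    rw [Finset.sum_range_succ', Finset.sum_eq_zero]
    · simp [twistCoeff, h0]
    · intro d _; simp [twistCoeff]
  | succ n ih =>
    intro c N hN
    rcases c with _ | c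
    · rw [h1, ih 1 N (by omega)]
      refine Finset.sum_congr rfl fun d _ => ?_
      rw [twistCoeff, show 0 + (n + 1) = 1 + n by ring]
    · obtain ⟨N, rfl⟩ : ∃ N', N = N' + 1 := ⟨N - 1, by omega⟩
      rw [h2, ih (c + 2) (N + 1) (by omega), ih c N (by omega), Finset.sum_range_succ',
        Finset.sum_range_succ', Finset.smul_sum, add_right_comm, ← Finset.sum_add_distrib]
      congr 1
      · refine Finset.sum_congr rfl fun d _ => ?_
        rw [show c + 2 + n - 2 * (d + 1) = c + n - 2 * d by omega,
          show c + 1 + (n + 1) - 2 * (d + 1) = c + n - 2 * d by omega, smul_smul, ← add_smul,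
          twistCoeff]
        congr 1; push_cast; ring
      · rw [twistCoeff, show c + 2 + n = c + 1 + (n + 1) by ring, twistCoeff_zero]

namespace TL

/-! ### Twisted parallels in terms of Jones–Wenzl elements. -/

section Expansion
variable {k 𝒜 : Type*} [Field k] [Ring 𝒜] [Algebra k 𝒜] {δ : k} (t : TL k 𝒜 δ)
  {A : k} (hA : A ≠ 0) (hδ : δ = -A ^ 2 - A⁻¹ ^ 2) (hc : ∀ c, cheb δ c ≠ 0)

/-- The `r`-parallel of a diagram, with an element `x` inserted after the first local minimum. -/
def decor (A : k) (w : Word) (r : ℕ) (x : 𝒜) : 𝒜 := t.U r 0 * x * t.cabW A r w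

lemma decor_sub (w : Word) (r : ℕ) (x y : 𝒜) :
    t.decor A w r (x - y) = t.decor A w r x - t.decor A w r y := by
  simp [decor, mul_sub, sub_mul]

lemma decor_smul (w : Word) (r : ℕ) (z : k) (x : 𝒜) :
    t.decor A w r (z • x) = z • t.decor A w r x := by
  simp [decor]

include hA hδ

/-- The trace property passes from hooks to Jones–Wenzl elements by their recursion: the factors of
its second term are carried around one after another. -/
lemma decor_jw_comm {b : Bool} {w : Word} (hw : run w [b, !b] = some []) (r c : ℕ) (h : c ≤ r + 2)
    {x : 𝒜} (hx : t.RP x (r + 2) (r + 2)) :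
    t.decor A w (r + 2) (x * t.jw 0 c) = t.decor A w (r + 2) (t.jw 0 c * x) := by
  induction c using Nat.twoStepInduction generalizing x with
  | zero => simp [jw]
  | one => simp [jw]
  | more c _ ih =>
    have hf : t.RP (t.jw 0 (c + 1)) (r + 2) (r + 2) :=
      (t.rp_jw 0 (c + 1)).mono _ _ (r + 2 - (c + 1)) (by omega) (by omega)
    have he : t.RP (t.e c) (r + 2) (r + 2) := rp_e _ _ (by omega)
    rw [jw_succ_succ, mul_sub, sub_mul, decor_sub, decor_sub, ih (by omega) hx, mul_smul_comm,
      smul_mul_assoc, decor_smul, decor_smul, zero_add]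
    congr 2
    calc _ = t.decor A w (r + 2) ((x * (t.jw 0 (c + 1) * t.e c)) * t.jw 0 (c + 1)) := by
          simp only [mul_assoc]
      _ = t.decor A w (r + 2) ((t.jw 0 (c + 1) * x * t.jw 0 (c + 1)) * t.e c) := by
          rw [ih (by omega) (hx.mul (hf.mul he))]; simp only [mul_assoc]
      _ = t.decor A w (r + 2) ((t.e c * t.jw 0 (c + 1) * x) * t.jw 0 (c + 1)) := by
          have := t.trace_comm hA hδ hw ((hf.mul hx).mul hf) (i := c) (by omega)
          rw [decor, this, decor]; simp only [mul_assoc]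
      _ = _ := by rw [ih (by omega) ((he.mul hf).mul hx)]; simp only [mul_assoc]

-- The recursion for `t.jw 0 (c + 2)` is read backwards. Under the trace its second term reduces to
-- a hook, which splits off two strands; its coefficient cancels against the scalar from `jw_aux`.
-- The full twists contribute `a⁻⁶` each when the cap of the hook passes them.
include hc in
lemma decor_step {b : Bool} {w : Word} (hcomp : components (⟨.cup b, 0⟩ :: w) = 1)
    (hw : run w [b, !b] = some []) {a : k} (ha : a ≠ 0) (hδ' : δ = -a ^ 2 - a⁻¹ ^ 2)
    (M n c : ℕ) :
    t.decor A w (c + n + 2) (t.jw 0 (c + 1) * t.twist a (c + n + 2) ^ M) =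
      t.decor A w (c + n + 2) (t.jw 0 (c + 2) * t.twist a (c + n + 2) ^ M) +
      (a⁻¹ ^ 6) ^ M • t.decor A w (c + n) (t.jw 0 c * t.twist a (c + n) ^ M) := by
  set r := c + n
  set τ := t.twist a (r + 2) ^ M
  set τ' := t.twist a r ^ M
  set f := t.jw 0 (c + 1)
  set f' := t.jw 0 c
  have hpow : ∀ (s m : ℕ), t.RP (t.twist a s ^ m) s s := fun s m => by
    induction m with
    | zero => rw [pow_zero]; exact RP.one _
    | succ m ih => rw [pow_succ]; exact ih.mul (t.rp_twist s)
  have hτ : t.RP τ (r + 2) (r + 2) := hpow _ _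
  have hf : t.RP f (r + 2) (r + 2) :=
    (t.rp_jw 0 (c + 1)).mono _ _ (r + 2 - (c + 1)) (by omega) (by omega)
  have hf' : t.RP f' r r := (t.rp_jw 0 c).mono _ _ (r - c) (by omega) (by omega)
  have he : t.RP (t.e c) (r + 2) (r + 2) := rp_e _ _ (by omega)
  have hcτ : ∀ i ≤ r, t.e i * τ = τ * t.e i := fun i hi =>
    (Commute.pow_right (t.twist_comm ha hδ' r i hi) M)
  have hfτ : f * τ = τ * f := t.jw_intertwine _ _ _ _ fun j hj => by
    rw [zero_add]; exact hcτ j (by omega)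
  have hf'τ : f' * τ = τ * f' := t.jw_intertwine _ _ _ _ fun j hj => by
    rw [zero_add]; exact hcτ j (by omega)
  have hτc : τ * t.c c = (a⁻¹ ^ 6) ^ M • (t.c c * τ') := by
    suffices H : ∀ m : ℕ, t.twist a (r + 2) ^ m * t.c c =
        (a⁻¹ ^ 6) ^ m • (t.c c * t.twist a r ^ m) from H M
    intro m
    induction m with
    | zero => simp
    | succ m ih =>
      rw [pow_succ, mul_assoc, t.twist_mul_c ha hδ' r c (by omega), mul_smul_comm, ← mul_assoc, ih,
        smul_mul_assoc, smul_smul, mul_assoc, ← pow_succ, ← pow_succ']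
  have hδ0 : δ ≠ 0 := hc 1
  have hμ := hc c; have hμ' := hc (c + 1)
  obtain ⟨-, -, h3⟩ := t.jw_aux hc 0 c
  rw [zero_add] at h3
  have hff : f * f = f := t.jw_mul_jw hc 0 (c + 1)
  have hf'c : f' * t.c c = t.c c * f' := by
    have := (t.rp_jw 0 c 0).2
    rw [zero_add, add_zero] at this
    exact this.symm
  have hτe : t.e c * τ = τ * t.e c := hcτ c (by omega)
  have e1 : t.decor A w (r + 2) (f * t.e c * f * τ) = t.decor A w (r + 2) (t.e c * τ * f) := by
    calc _ = t.decor A w (r + 2) (f * (t.e c * τ * f)) := by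
          rw [mul_assoc, hfτ]; simp only [mul_assoc]
      _ = t.decor A w (r + 2) (t.e c * τ * f * f) :=
          (t.decor_jw_comm hA hδ hw r (c + 1) (by omega) ((he.mul hτ).mul hf)).symm
      _ = _ := by rw [mul_assoc _ f, hff]
  -- At the cost of `δ` the hook is doubled. One copy is carried around the knot, so that the
  -- Jones–Wenzl element is enclosed between two hooks.
  have e2 : δ • t.decor A w (r + 2) (t.e c * τ * f) =
      (cheb δ (c + 1) / cheb δ c) • t.decor A w (r + 2) (f' * τ * t.e c) := by
    calc _ = t.decor A w (r + 2) (t.e c * (t.e c * τ * f)) := by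
          rw [← decor_smul, Algebra.smul_def, ← mul_assoc, ← mul_assoc, ← t.e_mul_e]
          simp only [mul_assoc]
      _ = t.decor A w (r + 2) (t.e c * τ * f * t.e c) := by
          have := t.trace_comm hA hδ hw ((he.mul hτ).mul hf) (i := c) (by omega)
          exact this.symm
      _ = t.decor A w (r + 2) (τ * (t.e c * f * t.e c)) := by rw [hτe]; simp only [mul_assoc]
      _ = _ := by rw [h3, mul_smul_comm, decor_smul, ← mul_assoc, hf'τ]
  have e3 : t.decor A w (r + 2) (f' * τ * t.e c) =
      ((a⁻¹ ^ 6) ^ M * δ) • t.decor A w r (f' * τ') := by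
    have := t.partial_trace hA hδ hδ0 hcomp hw (hf'.mul (hpow r M)) (i := c) (by omega)
    rw [e, ← mul_assoc, mul_assoc f', hτc, mul_smul_comm, smul_mul_assoc, decor_smul, ← mul_assoc,
      hf'c, mul_assoc (t.c c), mul_smul, decor, this, decor, ← mul_assoc]
  have e4 : t.decor A w (r + 2) (t.e c * τ * f) =
      (cheb δ (c + 1) / cheb δ c * (a⁻¹ ^ 6) ^ M) • t.decor A w r (f' * τ') := by
    rw [e3, smul_smul] at e2
    refine smul_right_injective 𝒜 hδ0 ?_
    simp only
    rw [e2, smul_smul]; congr 1; ring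
  rw [jw_succ_succ, sub_mul, smul_mul_assoc, decor_sub, decor_smul, zero_add, e1, e4, smul_smul]
  rw [show cheb δ c / cheb δ (c + 1) * (cheb δ (c + 1) / cheb δ c * (a⁻¹ ^ 6) ^ M) =
    (a⁻¹ ^ 6) ^ M by field_simp, sub_add_cancel]

include hc in
/-- The twisted parallel in terms of Jones–Wenzl elements. -/
theorem decor_twist {b : Bool} {w : Word} (hcomp : components (⟨.cup b, 0⟩ :: w) = 1)
    (hw : run w [b, !b] = some []) {a : k} (ha : a ≠ 0) (hδ' : δ = -a ^ 2 - a⁻¹ ^ 2)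
    (M r : ℕ) :
    t.decor A w r (t.twist a r ^ M) = ∑ d ∈ Finset.range (r + 1),
      ((twistCoeff r 0 d : k) * (((a⁻¹ ^ 6) ^ M) ^ d *
        (a ^ ((r - 2 * d) * (r - 2 * d - 1))) ^ M)) •
        t.decor A w (r - 2 * d) (t.jw 0 (r - 2 * d)) := by
  -- The walk starts at the colour `0`, where the Jones–Wenzl element is `1`, with `r` free strands.
  -- The factor `η` stems from `u_mul_twist` and its mirror image, `ω` from `jw_mul_twist`.
  have := eq_sum_twistCoeff (fun n c => t.decor A w (c + n) (t.jw 0 c * t.twist a (c + n) ^ M))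
    (fun c => t.decor A w c (t.jw 0 c)) ((a⁻¹ ^ 6) ^ M) (fun c => (a ^ (c * (c - 1))) ^ M)
    (fun c => by
      rw [← decor_smul]
      congr 1
      induction M with
      | zero => simp
      | succ m ih =>
        rw [pow_succ, ← mul_assoc, ih, smul_mul_assoc, add_zero, t.jw_mul_twist hc, smul_smul,
          ← pow_succ])
    (fun n => by rw [show 0 + (n + 1) = 1 + n by ring]; rfl)
    (fun n c => by
      have := t.decor_step hA hδ hc hcomp hw ha hδ' M n c
      rw [show c + 1 + (n + 1) = c + n + 2 by ring, show c + 2 + n = c + n + 2 by ring]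
      exact this) r 0 (r + 1) (by omega)
  simp only [zero_add] at this
  rw [← this, jw, one_mul]

end Expansion
end TL

/-! ### The writhe under local moves -/

/-- The directions below and above a piece. -/
inductive PStep : Piece → List Bool → List Bool → Prop
  | cup (b : Bool) : PStep (.cup b) [] [b, !b]
  | cap (x : Bool) : PStep .cap [x, !x] []
  | cross (s x y : Bool) : PStep (.cross s) [x, y] [y, x]

lemma PStep.length_left {g : Piece} {X Y : List Bool} (h : PStep g X Y) : X.length = g.dom := by
  cases h <;> rfl

lemma PStep.length_right {g : Piece} {X Y : List Bool} (h : PStep g X Y) : Y.length = g.cod := by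
  cases h <;> rfl

lemma Step.exists_pStep {g : Slice} {O O' : List Bool} (h : Step g O O') :
    ∃ P X Y Q, P.length = g.pos ∧ PStep g.piece X Y ∧ O = P ++ X ++ Q ∧ O' = P ++ Y ++ Q := by
  cases h with
  | cup b P Q => exact ⟨P, _, _, Q, rfl, .cup b, by simp, by simp⟩
  | cap b P Q => exact ⟨P, _, _, Q, rfl, .cap b, by simp, by simp⟩
  | cross s x y P Q => exact ⟨P, _, _, Q, rfl, .cross s x y, by simp, by simp⟩

lemma PStep.step {g : Piece} {X Y : List Bool} (h : PStep g X Y) (P Q : List Bool) :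
    step ⟨g, P.length⟩ (P ++ X ++ Q) = some (P ++ Y ++ Q) := by
  rw [step_iff]
  cases h with
  | cup b => simpa using Step.cup b P Q
  | cap b => simpa using Step.cap b P Q
  | cross s x y => simpa using Step.cross s x y P Q

/-- The sign of a piece. -/
def pieceSign : Piece → List Bool → ℤ
  | .cross s, [x, y] => crossSign s x y
  | _, _ => 0

lemma PStep.writheFrom {g : Piece} {X Y : List Bool} (h : PStep g X Y) (P Q : List Bool)
    (w : Word) : writheFrom (⟨g, P.length⟩ :: w) (P ++ X ++ Q) =
      pieceSign g X + writheFrom w (P ++ Y ++ Q) := by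
  rw [SlicedLink.writheFrom, h.step P Q, Option.getD_some]
  congr 1
  cases h <;> simp [pieceSign]

lemma writheFrom_append (v w : Word) : ∀ {O M : List Bool}, run v O = some M →
    writheFrom (v ++ w) O = writheFrom v O + writheFrom w M := by
  induction v with
  | nil =>
    intro O M h
    simp only [run, Option.some.injEq] at h
    subst h; simp [writheFrom]
  | cons g v ih =>
    intro O M h
    simp only [run, Option.bind_eq_some_iff] at h
    obtain ⟨N, h1, h2⟩ := h
    rw [List.cons_append, writheFrom, writheFrom, h1, Option.getD_some, ih h2, add_assoc]

lemma exchange_run {g h : Piece} {i d : ℕ} {O M : List Bool}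
    (hr : run [⟨h, i + g.dom + d⟩, ⟨g, i⟩] O = some M) :
    run [⟨g, i⟩, ⟨h, i + g.cod + d⟩] O = some M ∧
      writheFrom [⟨h, i + g.dom + d⟩, ⟨g, i⟩] O = writheFrom [⟨g, i⟩, ⟨h, i + g.cod + d⟩] O := by
  obtain ⟨N, h1, h2⟩ := run_cons_eq_some.1 hr
  obtain ⟨N', h3, h4⟩ := run_cons_eq_some.1 h2
  simp only [run, Option.some.injEq] at h4
  subst h4
  obtain ⟨P', X', Y', Q', e1, s1, rfl, rfl⟩ := h1.exists_pStep
  obtain ⟨P, X, Y, Q, e2, s2, e3, rfl⟩ := h3.exists_pStep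
  dsimp only at e1 s1 e2 s2
  have l1 := s2.length_left
  have l2 := s2.length_right
  rw [List.append_assoc] at e3
  -- `D` consists of the strands between the two pieces.
  obtain ⟨D, rfl, rfl⟩ : ∃ D, P' = P ++ X ++ D ∧ Q = D ++ (Y' ++ Q') := by
    rcases List.append_eq_append_iff.1 e3 with ⟨D, h5, h6⟩ | ⟨D, h5, h6⟩
    · have : D = [] := by
        have := congrArg List.length h5
        simp only [List.length_append] at this
        exact List.length_eq_zero_iff.1 (by omega)
      subst this
      exact ⟨[], by simpa using h5.symm, by simpa using h6.symm⟩
    · exact ⟨D, h5, h6⟩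
  have hd : i + g.dom + d = (P ++ X ++ D).length := e1.symm
  have hd' : i + g.cod + d = (P ++ Y ++ D).length := by
    simp only [List.length_append] at e1 ⊢; omega
  rw [hd, hd', ← e2]
  have t1 := s2.step P (D ++ X' ++ Q')
  have t2 := s1.step (P ++ Y ++ D) Q'
  have w1 := s1.writheFrom (P ++ X ++ D) Q' [⟨g, P.length⟩]
  have w2 := s2.writheFrom P (D ++ Y' ++ Q') []
  have w3 := s2.writheFrom P (D ++ X' ++ Q') [⟨h, (P ++ Y ++ D).length⟩]
  have w4 := s1.writheFrom (P ++ Y ++ D) Q' []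
  constructor
  · simp only [run]
    rw [show P ++ X ++ D ++ X' ++ Q' = P ++ X ++ (D ++ X' ++ Q') by simp, t1]
    simp only [Option.bind_some]
    rw [show P ++ Y ++ (D ++ X' ++ Q') = P ++ Y ++ D ++ X' ++ Q' by simp, t2]
    simp
  · simp only [List.append_assoc] at w1 w2 w3 w4 ⊢
    rw [w1, w2, w3, w4]
    simp only [SlicedLink.writheFrom]
    ring

section Lists
variable (P Q : List Bool)

lemma run_cup (b : Bool) (w : Word) :
    run (⟨.cup b, P.length⟩ :: w) (P ++ Q) = run w (P ++ b :: (!b) :: Q) := by simp [run, step]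

lemma run_cap (x y : Bool) (w : Word) : run (⟨.cap, P.length⟩ :: w) (P ++ x :: y :: Q) =
    if x ≠ y then run w (P ++ Q) else none := by
  simp only [run, step, List.drop_left', List.take_left']; split_ifs <;> rfl

lemma run_cross (s x y : Bool) (w : Word) : run (⟨.cross s, P.length⟩ :: w) (P ++ x :: y :: Q) =
    run w (P ++ y :: x :: Q) := by simp [run, step]

lemma writheFrom_cup (b : Bool) (w : Word) : writheFrom (⟨.cup b, P.length⟩ :: w) (P ++ Q) =
    writheFrom w (P ++ b :: (!b) :: Q) := by simp [writheFrom, step]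

lemma writheFrom_cap (x y : Bool) (w : Word) (h : x ≠ y) :
    writheFrom (⟨.cap, P.length⟩ :: w) (P ++ x :: y :: Q) = writheFrom w (P ++ Q) := by
  simp [writheFrom, step, h]

lemma writheFrom_cross (s x y : Bool) (w : Word) :
    writheFrom (⟨.cross s, P.length⟩ :: w) (P ++ x :: y :: Q) =
      crossSign s x y + writheFrom w (P ++ y :: x :: Q) := by simp [writheFrom, step]

lemma run_cup' (a b : Bool) (w : Word) : run (⟨.cup b, P.length + 1⟩ :: w) (P ++ a :: Q) =
    run w (P ++ a :: b :: (!b) :: Q) := by simpa using run_cup (P ++ [a]) Q b w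

lemma run_cap' (a x y : Bool) (w : Word) :
    run (⟨.cap, P.length + 1⟩ :: w) (P ++ a :: x :: y :: Q) =
    if x ≠ y then run w (P ++ a :: Q) else none := by simpa using run_cap (P ++ [a]) Q x y w

lemma run_cross' (a s x y : Bool) (w : Word) :
    run (⟨.cross s, P.length + 1⟩ :: w) (P ++ a :: x :: y :: Q) =
    run w (P ++ a :: y :: x :: Q) := by simpa using run_cross (P ++ [a]) Q s x y w

lemma writheFrom_cup' (a b : Bool) (w : Word) :
    writheFrom (⟨.cup b, P.length + 1⟩ :: w) (P ++ a :: Q) =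
    writheFrom w (P ++ a :: b :: (!b) :: Q) := by simpa using writheFrom_cup (P ++ [a]) Q b w

lemma writheFrom_cap' (a x y : Bool) (w : Word) (h : x ≠ y) :
    writheFrom (⟨.cap, P.length + 1⟩ :: w) (P ++ a :: x :: y :: Q) =
    writheFrom w (P ++ a :: Q) := by simpa using writheFrom_cap (P ++ [a]) Q x y w h

lemma writheFrom_cross' (a s x y : Bool) (w : Word) :
    writheFrom (⟨.cross s, P.length + 1⟩ :: w) (P ++ a :: x :: y :: Q) =
      crossSign s x y + writheFrom w (P ++ a :: y :: x :: Q) := by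
  simpa using writheFrom_cross (P ++ [a]) Q s x y w

end Lists

/-- The words of a first Reidemeister move. -/
def IsCurl (s : Bool) (x y : Word) : Prop :=
  (∃ b i, x = [⟨.cup b, i⟩, ⟨.cross s, i⟩] ∧ y = [⟨.cup !b, i⟩]) ∨
    ∃ i, x = [⟨.cross s, i⟩, ⟨.cap, i⟩] ∧ y = [⟨.cap, i⟩]

/-- Only the first Reidemeister move changes the writhe. The strands entering its crossing have
opposite directions, so the sign of the crossing depends on `s` alone. -/
lemma localMove_run {x y : Word} (h : LocalMove x y) {O M : List Bool} (hr : run x O = some M) :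
    run y O = some M ∧ ((writheFrom x O = writheFrom y O ∧ ¬ ∃ s, IsCurl s x y) ∨
      ∃ s, IsCurl s x y ∧ writheFrom x O = writheFrom y O + if s then -1 else 1) := by
  have hf := fits_of_run hr
  cases h with
  | exchange g h i d =>
    have := exchange_run hr
    refine ⟨this.1, .inl ⟨this.2, ?_⟩⟩
    rintro ⟨s, ⟨b, i, h1, h2⟩ | ⟨i, h1, h2⟩⟩ <;> simp at h2
  | zigzagLeft b i =>
    simp only [Fits] at hf
    obtain ⟨P, z, Q, rfl, rfl⟩ := exists_append_cons_of_lt (i := i) (L := O) (by omega)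
    rw [run_cup, run_cap'] at hr
    split_ifs at hr with hz
    obtain rfl : z = b := by cases z <;> cases b <;> simp at hz ⊢
    refine ⟨hr, .inl ⟨?_, ?_⟩⟩
    · rw [writheFrom_cup, writheFrom_cap' _ _ _ _ _ _ hz]
    · rintro ⟨s, ⟨b, i, h1, h2⟩ | ⟨i, h1, h2⟩⟩ <;> simp at h2
  | zigzagRight b i =>
    simp only [Fits] at hf
    obtain ⟨P, z, Q, rfl, rfl⟩ := exists_append_cons_of_lt (i := i) (L := O) (by omega)
    rw [run_cup', run_cap] at hr
    split_ifs at hr with hz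
    obtain rfl : z = !b := by cases z <;> cases b <;> simp at hz ⊢
    refine ⟨hr, .inl ⟨?_, ?_⟩⟩
    · rw [writheFrom_cup', writheFrom_cap _ _ _ _ _ hz]
    · rintro ⟨s, ⟨b, i, h1, h2⟩ | ⟨i, h1, h2⟩⟩ <;> simp at h2
  | swingCup b s i =>
    simp only [Fits] at hf
    obtain ⟨P, z, Q, rfl, rfl⟩ := exists_append_cons_of_lt (i := i) (L := O) (by omega)
    rw [run_cup, run_cross'] at hr
    refine ⟨by rw [run_cup', run_cross]; exact hr, .inl ⟨?_, ?_⟩⟩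
    · rw [writheFrom_cup, writheFrom_cross', writheFrom_cup', writheFrom_cross]
      simp only [writheFrom, crossSign]
      cases b <;> cases s <;> cases z <;> rfl
    · rintro ⟨s, ⟨b, i, h1, h2⟩ | ⟨i, h1, h2⟩⟩ <;> simp at h2
  | swingCap s i =>
    simp only [Fits] at hf
    obtain ⟨P, x, y, Q, rfl, rfl⟩ := exists_append_cons_cons_of_lt (i := i) (L := O) (by omega)
    rcases Q with _ | ⟨z, Q⟩
    · simp at hf
    rw [run_cross', run_cap] at hr
    split_ifs at hr with hz
    refine ⟨by rw [run_cross, run_cap', if_pos hz]; exact hr, .inl ⟨?_, ?_⟩⟩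
    · rw [writheFrom_cross', writheFrom_cap _ _ _ _ _ hz, writheFrom_cross,
        writheFrom_cap' _ _ _ _ _ _ hz]
      simp only [writheFrom, crossSign]
      revert hz
      cases x <;> cases y <;> cases z <;> cases s <;> simp
    · rintro ⟨s, ⟨b, i, h1, h2⟩ | ⟨i, h1, h2⟩⟩ <;> simp at h2
  | reidemeisterOneCup b s i =>
    simp only [Fits] at hf
    obtain ⟨P, Q, rfl, rfl⟩ := exists_append_of_le (i := i) (L := O) (by omega)
    rw [run_cup, run_cross] at hr
    refine ⟨by rw [run_cup, Bool.not_not]; exact hr, .inr ⟨s, .inl ⟨b, P.length, rfl, rfl⟩, ?_⟩⟩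
    rw [writheFrom_cup, writheFrom_cross, writheFrom_cup]
    simp only [writheFrom, crossSign]
    cases b <;> cases s <;> simp
  | reidemeisterOneCap s i =>
    simp only [Fits] at hf
    obtain ⟨P, x, y, Q, rfl, rfl⟩ := exists_append_cons_cons_of_lt (i := i) (L := O) (by omega)
    rw [run_cross, run_cap] at hr
    split_ifs at hr with hz
    refine ⟨by rw [run_cap, if_pos (Ne.symm hz)]; exact hr, .inr ⟨s, .inr ⟨P.length, rfl, rfl⟩, ?_⟩⟩
    rw [writheFrom_cross, writheFrom_cap _ _ _ _ _ hz, writheFrom_cap _ _ _ _ _ (Ne.symm hz)]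
    simp only [writheFrom, crossSign]
    revert hz
    cases x <;> cases y <;> cases s <;> simp
  | reidemeisterTwo s i =>
    simp only [Fits] at hf
    obtain ⟨P, x, y, Q, rfl, rfl⟩ := exists_append_cons_cons_of_lt (i := i) (L := O) (by omega)
    rw [run_cross, run_cross] at hr
    refine ⟨hr, .inl ⟨?_, ?_⟩⟩
    · rw [writheFrom_cross, writheFrom_cross]
      simp only [writheFrom, crossSign]
      cases x <;> cases y <;> cases s <;> rfl
    · rintro ⟨s, ⟨b, i, h1, h2⟩ | ⟨i, h1, h2⟩⟩ <;> simp at h2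
  | reidemeisterThree a b c i h =>
    simp only [Fits] at hf
    obtain ⟨P, x, y, Q, rfl, rfl⟩ := exists_append_cons_cons_of_lt (i := i) (L := O) (by omega)
    rcases Q with _ | ⟨z, Q⟩
    · simp at hf
    rw [run_cross, run_cross', run_cross] at hr
    refine ⟨by rw [run_cross', run_cross, run_cross']; exact hr, .inl ⟨?_, ?_⟩⟩
    · rw [writheFrom_cross, writheFrom_cross', writheFrom_cross, writheFrom_cross',
        writheFrom_cross, writheFrom_cross']
      simp only [writheFrom]
      ring
    · rintro ⟨s, ⟨b, i, h1, h2⟩ | ⟨i, h1, h2⟩⟩ <;> simp at h2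

namespace TL

section Invariance
variable {k 𝒜 : Type*} [Field k] [Ring 𝒜] [Algebra k 𝒜] {δ : k} (t : TL k 𝒜 δ)

/-! ### Curls of parallels with Jones–Wenzl elements -/

/-- Crossings of the two blocks commute. So a crossing of the right block can be brought next to
`z`, where it is exchanged for one of the left block. -/
lemma exists_block_left (a : k) (r p : ℕ) (z : 𝒜)
    (hz : ∀ l, l + 2 ≤ r → z * t.e (p + r + l) = z * t.e (p + (r - 2 - l))) (L : List ℕ)
    (hL : ∀ l ∈ L, (p ≤ l ∧ l + 2 ≤ p + r) ∨ (p + r ≤ l ∧ l + 2 ≤ p + 2 * r)) :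
    ∃ L' : List ℕ, L'.length = L.length ∧ (∀ l ∈ L', p ≤ l ∧ l + 2 ≤ p + r) ∧
      z * (L.map (t.cr a)).prod = z * (L'.map (t.cr a)).prod := by
  induction L using List.reverseRecOn with
  | nil => exact ⟨[], rfl, by simp, rfl⟩
  | append_singleton L l ih =>
    obtain ⟨L', h1, h2, h3⟩ := ih fun l hl => hL l (by simp [hl])
    rcases hL l (by simp) with h | h
    · refine ⟨L' ++ [l], by simp [h1], ?_, ?_⟩
      · intro m hm
        rcases List.mem_append.1 hm with hm | hm
        · exact h2 m hm
        · rw [List.mem_singleton.1 hm]; exact h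
      · simp only [List.map_append, List.prod_append, ← mul_assoc, h3]
    · obtain ⟨m, rfl⟩ := Nat.exists_eq_add_of_le h.1
      have h4 : z * t.cr a (p + r + m) = z * t.cr a (p + (r - 2 - m)) := by
        simp only [cr, mul_add, mul_smul_comm, hz m (by omega)]
      refine ⟨(p + (r - 2 - m)) :: L', by simp [h1], ?_, ?_⟩
      · intro l hl
        rcases List.mem_cons.1 hl with rfl | hl
        · omega
        · exact h2 l hl
      · have h5 := t.prod_cr_intertwine a (t.cr a (p + r + m)) L' fun l hl => by
          have := h2 l hl
          exact (t.cr_intertwine a (t.e l) _ _ (t.e_comm _ _ (by omega))).symm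
        simp only [List.map_append, List.prod_append, ← mul_assoc, h3, List.map_cons,
          List.prod_cons, List.map_nil, List.prod_nil, mul_one]
        rw [mul_assoc, h5, ← mul_assoc, h4]

lemma exists_block_right (a : k) (r p : ℕ) (z : 𝒜)
    (hz : ∀ l, l + 2 ≤ r → t.e (p + r + l) * z = t.e (p + (r - 2 - l)) * z) (L : List ℕ)
    (hL : ∀ l ∈ L, (p ≤ l ∧ l + 2 ≤ p + r) ∨ (p + r ≤ l ∧ l + 2 ≤ p + 2 * r)) :
    ∃ L' : List ℕ, L'.length = L.length ∧ (∀ l ∈ L', p ≤ l ∧ l + 2 ≤ p + r) ∧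
      (L.map (t.cr a)).prod * z = (L'.map (t.cr a)).prod * z := by
  induction L with
  | nil => exact ⟨[], rfl, by simp, rfl⟩
  | cons l L ih =>
    obtain ⟨L', h1, h2, h3⟩ := ih fun l hl => hL l (by simp [hl])
    rcases hL l (by simp) with h | h
    · refine ⟨l :: L', by simp [h1], ?_, ?_⟩
      · intro m hm
        rcases List.mem_cons.1 hm with rfl | hm
        · exact h
        · exact h2 m hm
      · simp only [List.map_cons, List.prod_cons, mul_assoc, h3]
    · obtain ⟨m, rfl⟩ := Nat.exists_eq_add_of_le h.1
      have h4 : t.cr a (p + r + m) * z = t.cr a (p + (r - 2 - m)) * z := by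
        simp only [cr, add_mul, smul_mul_assoc, hz m (by omega)]
      refine ⟨L' ++ [p + (r - 2 - m)], by simp [h1], ?_, ?_⟩
      · intro l hl
        rcases List.mem_append.1 hl with hl | hl
        · exact h2 l hl
        · rw [List.mem_singleton.1 hl]; omega
      · have h5 := t.prod_cr_intertwine a (t.cr a (p + r + m)) L' fun l hl => by
          have := h2 l hl
          exact (t.cr_intertwine a (t.e l) _ _ (t.e_comm _ _ (by omega))).symm
        simp only [List.map_append, List.prod_append, h3, List.map_cons, mul_assoc,
          List.prod_cons, List.map_nil, List.prod_nil, one_mul]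
        rw [← h4, ← mul_assoc, ← h5, mul_assoc]

section
variable {a : k} (ha : a ≠ 0) (hδ : δ = -a ^ 2 - a⁻¹ ^ 2)
include ha hδ

/-- The crossings that untwist the parallel of a curl are gathered on one leg, that is, on the
copies of a single strand, as the absorption lemmas require. -/
lemma exists_U_curl (r p : ℕ) : ∃ L : List ℕ, L.length = r * (r - 1) ∧
    (∀ l ∈ L, p ≤ l ∧ l + 2 ≤ p + r) ∧
    t.U r p * t.B a p r r * (L.map (t.cr a)).prod = (-a⁻¹ ^ 3) ^ r • t.U r p := by
  obtain ⟨L, h1, h2, h3⟩ := t.exists_block_left a r p (t.U r p * t.B a p r r) (fun l hl => by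
    obtain ⟨r, rfl⟩ : ∃ r', r = r' + 2 := ⟨r - 2, by omega⟩
    have h4 := t.U_mul_e r p l (by omega)
    have h5 := t.e_B_right ha hδ (r + 2) (r + 2) p (r + 2 - 2 - l) (by omega)
    rw [mul_assoc, ← t.e_B_left ha hδ (r + 2) (r + 2) p l (by omega), ← mul_assoc, h4, mul_assoc,
      mul_assoc, ← h5]
    congr 3; omega) (curlIdx r p) (mem_curlIdx r p)
  exact ⟨L, by rw [h1, length_curlIdx], h2, by rw [← h3, t.U_curl ha hδ]⟩

lemma exists_C_curl (r p : ℕ) : ∃ L : List ℕ, L.length = r * (r - 1) ∧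
    (∀ l ∈ L, p ≤ l ∧ l + 2 ≤ p + r) ∧
    (L.map (t.cr a)).prod * (t.B a p r r * t.C r p) = (-a⁻¹ ^ 3) ^ r • t.C r p := by
  obtain ⟨L, h1, h2, h3⟩ := t.exists_block_right a r p (t.B a p r r * t.C r p) (fun l hl => by
    obtain ⟨r, rfl⟩ : ∃ r', r = r' + 2 := ⟨r - 2, by omega⟩
    have h4 := t.e_mul_C r p l (by omega)
    have h5 := t.e_B_left ha hδ (r + 2) (r + 2) p (r + 2 - 2 - l) (by omega)
    rw [← mul_assoc, t.e_B_right ha hδ (r + 2) (r + 2) p l (by omega), mul_assoc, h4, ← mul_assoc,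
      ← mul_assoc, h5]
    congr 3; omega) (curlIdx' r p) (mem_curlIdx' r p)
  exact ⟨L, by rw [h1, length_curlIdx'], h2, by rw [← h3, ← mul_assoc, t.C_curl ha hδ]⟩

end

/-! ### Absorption -/

/-- If every hook between `z` and `y` inside the block gives zero, then each crossing placed there
acts as the scalar `a`. The elements `x` keep track of the crossings already inserted. -/
lemma absorb_cr (a : k) {p r : ℕ} {z y : 𝒜} (h : ∀ x, t.Within p r x → ∀ l, p ≤ l → l + 2 ≤ p + r →
    z * x * t.e l * y = 0) (L : List ℕ) (hL : ∀ l ∈ L, p ≤ l ∧ l + 2 ≤ p + r) :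
    z * (L.map (t.cr a)).prod * y = a ^ L.length • (z * y) := by
  suffices H : ∀ x, t.Within p r x →
      z * x * (L.map (t.cr a)).prod * y = a ^ L.length • (z * x * y) by
    simpa using H 1 (t.within_one p r)
  induction L with
  | nil => intro x _; simp
  | cons l L ih =>
    intro x hx
    have hl := hL l (by simp)
    have hw : t.Within p r (t.cr a l) := fun m hm =>
      (t.cr_intertwine a (t.e m) l l (t.within_e p r l hl.1 hl.2 m hm).symm).symm
    have h1 : z * x * t.cr a l * y = a • (z * x * y) := by
      simp only [cr, mul_add, add_mul, mul_smul_comm, smul_mul_assoc, mul_one,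
        h x hx l hl.1 hl.2, smul_zero, add_zero]
    rw [List.map_cons, List.prod_cons, ← mul_assoc, mul_assoc z x,
      ih (fun l hl => hL l (by simp [hl])) _ (hx.mul hw), ← mul_assoc, h1, smul_smul,
      List.length_cons, pow_succ]

lemma within_jw (p c r : ℕ) (h : c ≤ r) : t.Within p r (t.jw p c) := fun m hm =>
  (t.jw_intertwine p p c _ fun j hj => (t.within_e p r (p + j) (by omega) (by omega) m hm).symm).symm

/-- For the same reason a further Jones–Wenzl element may be placed on any strand of a coloured
parallel without changing the value. -/
lemma absorb_jw {p r : ℕ} {z y : 𝒜} (h : ∀ x, t.Within p r x → ∀ l, p ≤ l → l + 2 ≤ p + r →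
    z * x * t.e l * y = 0) : z * t.jw p r * y = z * y := by
  suffices H : ∀ c ≤ r, ∀ x, t.Within p r x → z * x * t.jw p c * y = z * x * y by
    simpa using H r le_rfl 1 (t.within_one p r)
  intro c
  induction c using Nat.twoStepInduction with
  | zero => intro _ x _; simp [jw]
  | one => intro _ x _; simp [jw]
  | more c _ ih =>
    intro hc x hx
    have hf := t.within_jw p (c + 1) r (by omega)
    have he := t.within_e p r (p + c) (by omega) (by omega)
    have h1 := ih (by omega) (x * (t.jw p (c + 1) * t.e (p + c))) (hx.mul (hf.mul he))
    have h2 := h (x * t.jw p (c + 1)) (hx.mul hf) (p + c) (by omega) (by omega)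
    rw [jw_succ_succ, mul_sub, sub_mul, ih (by omega) x hx, mul_smul_comm, smul_mul_assoc]
    have h3 : z * x * (t.jw p (c + 1) * t.e (p + c) * t.jw p (c + 1)) * y = 0 := by
      have e1 : z * (x * (t.jw p (c + 1) * t.e (p + c))) * t.jw p (c + 1) * y =
        z * x * (t.jw p (c + 1) * t.e (p + c) * t.jw p (c + 1)) * y := by simp only [mul_assoc]
      rw [← e1, h1, ← h2]; simp only [mul_assoc]
    rw [h3, smul_zero, sub_zero]

/-! ### Invariance of the coloured value. -/

variable {A : k} (hA : A ≠ 0) (hδ : δ = -A ^ 2 - A⁻¹ ^ 2) (hc : ∀ c, cheb δ c ≠ 0)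
include hA hδ hc

lemma jw_annihilates {b : Bool} {v w : Word} (hcomp : components (⟨.cup b, 0⟩ :: (v ++ w)) = 1)
    {P Q : List Bool} {d : Bool} (hv : run v [b, !b] = some (P ++ d :: Q))
    (hw : run w (P ++ d :: Q) = some []) (r : ℕ) (x : 𝒜) (hx : t.Within (r * P.length) r x) (l : ℕ)
    (h1 : r * P.length ≤ l) (h2 : l + 2 ≤ r * P.length + r) :
    t.U r 0 * t.jw 0 r * t.cabW A r v * x * t.e l * t.cabW A r w = 0 := by
  obtain ⟨r, rfl⟩ : ∃ r', r = r' + 2 := ⟨r - 2, by omega⟩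
  obtain ⟨m, rfl⟩ := Nat.exists_eq_add_of_le h1
  refine t.annihilates hA hδ hcomp hv hw ?_ ?_ ?_ (by omega) hx
  · simpa using t.rp_jw 0 (r + 2)
  · intro i hi; have := t.jw_mul_e hc 0 (r + 2) i (by omega); rwa [zero_add] at this
  · intro i hi; have := t.e_mul_jw hc 0 (r + 2) i (by omega); rwa [zero_add] at this

omit hc hA hδ in
/-- The value of a parallel with a Jones–Wenzl element inserted after the first slice. -/
def colored (A : k) (r : ℕ) (w : Word) : 𝒜 := t.decor A w.tail r (t.jw 0 r)

omit hc hA hδ in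
/-- The effect of a curl on the coloured value. -/
def curlFactor (A : k) (r : ℕ) : k := (-1) ^ r * A ^ (r ^ 2 + 2 * r)

/-- The same `r * (r - 1)` crossings inserted at the curl are evaluated twice: as scalars, by
absorption, and as the crossings that untwist the parallel and leave the factor of `r` single curls.
-/
lemma colored_curl {D E : KnotDiagram} {p x y q : Word} {s : Bool} (h : IsCurl s x y)
    (hD : D.1 = p ++ x ++ q) (hE : E.1 = p ++ y ++ q) (r : ℕ) :
    par A s ^ (r * (r - 1)) • t.colored A r D.1 =
      (-(par A s)⁻¹ ^ 3) ^ r • t.colored A r E.1 := by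
  obtain ⟨b, v, h1, h2⟩ := D.exists_cons
  have hcomp := D.2.2
  have ha := par_ne_zero hA s
  have hδ' := eq_par hδ s
  rcases p with _ | ⟨g, p⟩
  · obtain ⟨c, i, rfl, rfl⟩ | ⟨i, rfl, rfl⟩ := h
    · rw [h1] at hD
      simp only [List.nil_append, List.cons_append, List.cons.injEq, Slice.mk.injEq,
        Piece.cup.injEq] at hD
      obtain ⟨⟨rfl, rfl⟩, rfl⟩ := hD
      obtain ⟨L, l1, l2, l3⟩ := t.exists_U_curl ha hδ' r 0
      have hrun : run [⟨.cross s, 0⟩] [b, !b] = some ([] ++ (!b) :: [b]) := rfl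
      obtain ⟨M, e1, e2⟩ := run_append_eq_some.1
        (show run ([⟨.cross s, 0⟩] ++ q) [b, !b] = some [] from h2)
      rw [hrun, Option.some.injEq] at e1
      subst e1
      have hk := t.jw_annihilates hA hδ hc (v := [⟨.cross s, 0⟩]) (w := q) (by rw [← hcomp, h1]; rfl)
        hrun e2 r
      rw [List.length_nil, mul_zero] at hk
      have h3 := t.absorb_cr (par A s) hk L l2
      -- At the first minimum the Jones–Wenzl element separates the cups from the crossings. It is
      -- moved through the grid to the other block, past the inserted crossings, and finally back
      -- around the minimum.
      have h4 : t.jw 0 r * t.B (par A s) 0 r r = t.B (par A s) 0 r r * t.jw r r :=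
        t.jw_intertwine _ _ _ _ fun j hj => by
          have := t.e_B_left ha hδ' r r 0 j (by omega)
          rwa [zero_add r] at this
      have h5 : (L.map (t.cr (par A s))).prod * t.jw r r = t.jw r r * (L.map (t.cr (par A s))).prod :=
        t.prod_cr_intertwine _ _ _ fun l hl => (t.jw_intertwine _ _ _ _ fun j hj => by
          have := l2 l hl
          exact t.e_comm _ _ (by omega)).symm
      have h6 := t.U_jw hc r 0
      rw [zero_add] at h6
      rw [l1, ] at h3
      rw [h1, hE]
      have h7 : t.cabW A r [⟨.cross s, 0⟩] = t.B (par A s) 0 r r := by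
        simp [cabW, cabS, cabP]
      rw [h7] at h3
      simp only [colored, decor, List.tail_cons, List.nil_append, List.cons_append]
      have h8 : t.cabW A r (⟨.cross s, 0⟩ :: q) = t.B (par A s) 0 r r * t.cabW A r q := by
        rw [cabW_cons]; simp [cabS, cabP]
      rw [h8, ← mul_assoc _ _ (t.cabW A r q), ← h3, ← smul_mul_assoc]
      congr 1
      rw [mul_assoc (t.U r 0), h4, mul_assoc, mul_assoc, ← h5, ← mul_assoc (t.B _ _ _ _),
        ← mul_assoc, ← mul_assoc (t.U r 0), l3, smul_mul_assoc, h6]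
    · rw [h1] at hD; simp at hD
  · have hg : g = ⟨.cup b, 0⟩ := by
      rw [h1] at hD; simp only [List.cons_append, List.cons.injEq] at hD; exact hD.1.symm
    subst hg
    have hv : v = p ++ x ++ q := by
      rw [h1] at hD; simpa only [List.cons_append, List.cons.injEq, true_and] using hD
    subst hv
    rw [h1] at hcomp
    rw [h1, hE]
    simp only [colored, decor, List.tail_cons, List.cons_append, cabW_append]
    obtain ⟨M, e1, e2⟩ := run_append_eq_some.1 h2
    obtain ⟨O, e3, e4⟩ := run_append_eq_some.1 e1
    have hf := fits_of_run e4
    obtain ⟨c, i, rfl, rfl⟩ | ⟨i, rfl, rfl⟩ := h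
    · simp only [Fits] at hf
      obtain ⟨P, Q, rfl, rfl⟩ := exists_append_of_le (i := i) (L := O) (by omega)
      rw [run_cup, run_cross, run, Option.some.injEq] at e4
      subst e4
      obtain ⟨L, l1, l2, l3⟩ := t.exists_U_curl ha hδ' r (r * P.length)
      have hk := t.jw_annihilates hA hδ hc hcomp e1 e2 r
      have h3 := t.absorb_cr (par A s) hk L l2
      have h7 : t.cabW A r [⟨.cup c, P.length⟩, ⟨.cross s, P.length⟩] =
          t.U r (r * P.length) * t.B (par A s) (r * P.length) r r := by
        simp [cabW, cabS, cabP]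
      have h8 : t.cabW A r [⟨.cup !c, P.length⟩] = t.U r (r * P.length) := by
        simp [cabW, cabS, cabP]
      rw [cabW_append, h7, l1] at h3
      rw [h7, h8, ← mul_assoc _ _ (t.cabW A r q), ← h3]
      rw [← mul_assoc (t.U r 0 * t.jw 0 r), mul_assoc (_ * t.cabW A r p), l3, mul_smul_comm,
        smul_mul_assoc]
      simp only [mul_assoc]
    · simp only [Fits] at hf
      obtain ⟨P, x, y, Q, rfl, rfl⟩ := exists_append_cons_cons_of_lt (i := i) (L := O) (by omega)
      obtain ⟨L, l1, l2, l3⟩ := t.exists_C_curl ha hδ' r (r * P.length)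
      have hk := t.jw_annihilates hA hδ hc (v := p) (w := [⟨.cross s, P.length⟩, ⟨.cap, P.length⟩] ++ q)
        (by rw [← List.append_assoc]; exact hcomp) e3
        (run_append_eq_some.2 ⟨_, e4, e2⟩) r
      have h3 := t.absorb_cr (par A s) hk L l2
      have h7 : t.cabW A r [⟨.cross s, P.length⟩, ⟨.cap, P.length⟩] =
          t.B (par A s) (r * P.length) r r * t.C r (r * P.length) := by
        simp [cabW, cabS, cabP]
      have h8 : t.cabW A r [⟨.cap, P.length⟩] = t.C r (r * P.length) := by
        simp [cabW, cabS, cabP]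
      rw [cabW_append, h7, l1] at h3
      rw [h7, h8, ← mul_assoc (t.U r 0 * t.jw 0 r), ← mul_assoc (t.U r 0 * t.jw 0 r)]
      simp only [mul_assoc] at h3 l3 ⊢
      rw [← h3]
      have l4 := congrArg (· * t.cabW A r q) l3
      simp only [mul_assoc, smul_mul_assoc] at l4
      rw [l4]
      simp only [mul_smul_comm]

/-- The exchange changes which minimum carries the Jones–Wenzl element. Both values equal the one
with an element at each of the two minima. -/
lemma colored_exchange {b c : Bool} {q : Word} (hcomp : components (⟨.cup b, 0⟩ :: ⟨.cup c, 0⟩ :: q) = 1)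
    (hcomp' : components (⟨.cup c, 0⟩ :: ⟨.cup b, 2⟩ :: q) = 1)
    (h : run (⟨.cup c, 0⟩ :: q) [b, !b] = some [])
    (r : ℕ) :
    t.colored A r (⟨.cup b, 0⟩ :: ⟨.cup c, 0⟩ :: q) =
      t.colored A r (⟨.cup c, 0⟩ :: ⟨.cup b, 2⟩ :: q) := by
  have hq : run q [c, !c, b, !b] = some [] := h
  have k1 := t.absorb_jw (t.jw_annihilates hA hδ hc (v := [⟨.cup c, 0⟩]) (w := q) hcomp
    (P := []) (d := c) (Q := [!c, b, !b]) rfl hq r)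
  have k2 := t.absorb_jw (t.jw_annihilates hA hδ hc (v := [⟨.cup b, 2⟩]) (w := q) hcomp'
    (P := [c, !c]) (d := b) (Q := [!b]) rfl hq r)
  have e1 : t.cabW A r [⟨.cup c, 0⟩] = t.U r 0 := by simp [cabW, cabS, cabP]
  have e2 : t.cabW A r [⟨.cup b, 2⟩] = t.U r (r * 2) := by simp [cabW, cabS, cabP]
  have e3 : t.jw 0 r * t.U r 0 = t.U r 0 * t.jw (r * 2) r :=
    t.jw_intertwine _ _ _ _ fun j _ => by
      have := loc_e.shift (t := t) j _ _ _ (rp_U (t := t) r 0 0 le_rfl)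
      dsimp only at this
      rwa [zero_add (2 * r), mul_comm 2 r] at this
  have e4 : t.U r 0 * t.U r 0 = t.U r 0 * t.U r (r * 2) := by
    have := loc_U (t := t) r _ _ _ (rp_U (t := t) r 0 0 le_rfl)
    rwa [zero_add, mul_comm 2 r] at this
  have e5 : t.jw 0 r * t.U r (r * 2) = t.U r (r * 2) * t.jw 0 r :=
    (loc_U (t := t) r _ _ _ ((t.rp_jw 0 r).mono (r * 2) (r * 2) r (by ring) (by ring))).symm
  have e6 : t.jw (r * 2) r * t.jw 0 r = t.jw 0 r * t.jw (r * 2) r :=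
    (t.within_jw 0 r r le_rfl |> fun hw => t.jw_intertwine _ _ _ _ fun j _ => hw _ (by omega))
  simp only [colored, decor, List.tail_cons]
  rw [t.cabW_cons A r ⟨.cup c, 0⟩, t.cabW_cons A r ⟨.cup b, 2⟩]
  change _ * (t.U r (r * 0) * _) = _ * (t.U r (r * 2) * _)
  rw [e1] at k1
  rw [e2] at k2
  rw [mul_zero, ← mul_assoc, ← mul_assoc, ← k1, ← k2, List.length_nil, mul_zero]
  simp only [List.length_cons, List.length_nil, zero_add, Nat.reduceAdd]
  congr 1
  rw [mul_assoc (t.U r 0), e3, mul_assoc, mul_assoc, e6, ← mul_assoc (t.U r 0),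
    e4, mul_assoc (t.U r 0) _ (t.U r (r * 2)), e5]
  simp only [mul_assoc]

/-- Above the first slice the parallel itself is unchanged. A move other than a curl that involves
the first slice starts from no strands, which leaves only the exchange of two minima. -/
lemma colored_move_of_not_isCurl {D E : KnotDiagram} {p x y q : Word} (h : LocalMove x y)
    (hn : ¬ ∃ s, IsCurl s x y) (hD : D.1 = p ++ x ++ q) (hE : E.1 = p ++ y ++ q) (r : ℕ) :
    t.colored A r D.1 = t.colored A r E.1 := by
  rcases p with _ | ⟨g, p⟩
  · obtain ⟨M, e1, -⟩ := run_append_eq_some.1 (show run (x ++ q) [] = some [] from hD ▸ D.2.1)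
    have hf := fits_of_run e1
    have hD' := D.2
    have hE' := E.2
    cases h with
    | exchange g h i d =>
      obtain ⟨b, v, h1, h2⟩ := D.exists_cons
      rw [h1] at hD
      simp only [List.nil_append, List.cons_append, List.cons.injEq, Slice.mk.injEq] at hD
      obtain ⟨⟨rfl, hi⟩, rfl⟩ := hD
      obtain rfl : i = 0 := by omega
      obtain rfl : d = 0 := by omega
      rcases g with c | _ | s
      · rw [hE] at hE' ⊢
        rw [h1] at hD' ⊢
        simp only [List.nil_append, List.cons_append, Piece.cod, Nat.add_zero, zero_add] at hE' ⊢
        refine t.colored_exchange hA hδ hc hD'.2 hE'.2 h2 r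
      · simp [Piece.dom] at hi
      · simp [Piece.dom] at hi
    | zigzagLeft b i => simp [Fits] at hf
    | zigzagRight b i => simp [Fits] at hf
    | swingCup b s i => simp [Fits] at hf
    | swingCap s i => simp [Fits] at hf
    | reidemeisterOneCup b s i => exact (hn ⟨s, .inl ⟨b, i, rfl, rfl⟩⟩).elim
    | reidemeisterOneCap s i => exact (hn ⟨s, .inr ⟨i, rfl, rfl⟩⟩).elim
    | reidemeisterTwo s i => simp [Fits] at hf
    | reidemeisterThree a b c i h => simp [Fits] at hf
  · rcases t.cabW_localMove hA hδ r h with hxy | ⟨b, s, i, h1, h2⟩ | ⟨s, i, h1, h2⟩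
    · rw [hD, hE]
      simp only [colored, decor, List.cons_append, List.tail_cons, cabW_append, hxy]
    · exact (hn ⟨s, .inl ⟨b, i, h1, h2⟩⟩).elim
    · exact (hn ⟨s, .inr ⟨i, h1, h2⟩⟩).elim

/-- The coloured value with the appropriate correction by the writhe is a knot invariant. -/
theorem colored_invariant {K : Knot} {D E : KnotDiagram} (hD : IsDiagramOf D K)
    (hE : IsDiagramOf E K) (r : ℕ) :
    (curlFactor A r) ^ (-writhe D.1) • t.colored A r D.1 =
      (curlFactor A r) ^ (-writhe E.1) • t.colored A r E.1 := by
  have hθ : curlFactor A r ≠ 0 := mul_ne_zero (pow_ne_zero _ (by simp)) (pow_ne_zero _ hA)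
  suffices H : ∀ D E : KnotDiagram, Move D.1 E.1 →
      (curlFactor A r) ^ (-writhe D.1) • t.colored A r D.1 =
      (curlFactor A r) ^ (-writhe E.1) • t.colored A r E.1 by
    -- Descending to the quotient takes care of chains of moves in both directions.
    have h1 := congrArg (Quot.lift (fun D : KnotDiagram =>
      (curlFactor A r) ^ (-writhe D.1) • t.colored A r D.1) H) (hD.trans hE.symm)
    exact h1
  rintro D E ⟨p, q, x, y, h, h1, h2⟩
  obtain ⟨M, e1, e2⟩ := run_append_eq_some.1 (show run (p ++ x ++ q) [] = some [] from h1 ▸ D.2.1)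
  obtain ⟨O, e3, e4⟩ := run_append_eq_some.1 e1
  obtain ⟨e5, e6⟩ := localMove_run h e4
  have w1 : writhe D.1 = writheFrom p [] + writheFrom x O + writheFrom q M := by
    rw [writhe, h1, writheFrom_append _ _ e1, writheFrom_append _ _ e3]
  have w2 : writhe E.1 = writheFrom p [] + writheFrom y O + writheFrom q M := by
    rw [writhe, h2, writheFrom_append _ _ (run_append_eq_some.2 ⟨O, e3, e5⟩),
      writheFrom_append _ _ e3]
  rcases e6 with ⟨e6, hn⟩ | ⟨s, hs, e6⟩
  · rw [t.colored_move_of_not_isCurl hA hδ hc h hn h1 h2, w1, w2, e6]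
  · have hc := t.colored_curl hA hδ hc hs h1 h2 r
    have ha := par_ne_zero hA s
    have hw : writhe D.1 = writhe E.1 + if s then -1 else 1 := by rw [w1, w2, e6]; ring
    have e7 : t.colored A r D.1 =
        (((par A s) ^ (r * (r - 1)))⁻¹ * (-(par A s)⁻¹ ^ 3) ^ r) • t.colored A r E.1 := by
      rw [mul_smul, ← hc, smul_smul, inv_mul_cancel₀ (pow_ne_zero _ ha), one_smul]
    have e8 : ((par A s) ^ (r * (r - 1)))⁻¹ * (-(par A s)⁻¹ ^ 3) ^ r =
        (curlFactor A r) ^ (if s then -1 else 1 : ℤ) := by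
      -- The exponent `r (r - 1)` comes from the correcting crossings and `3 r` from the `r` single
      -- curls.
      have hr : r ^ 2 + 2 * r = r * (r - 1) + 3 * r := by
        rcases r with _ | r
        · rfl
        · simp only [Nat.add_sub_cancel]; ring
      have e9 : ((par A s) ^ (r * (r - 1)))⁻¹ * (-(par A s)⁻¹ ^ 3) ^ r =
          (-1) ^ r * ((par A s) ^ (r ^ 2 + 2 * r))⁻¹ := by
        rw [neg_pow, hr, pow_add, mul_inv, inv_pow, inv_pow, ← pow_mul]; ring
      rw [e9]
      cases s
      · simp [par, curlFactor]
      · have h1 : ((-1 : k) ^ r)⁻¹ = (-1) ^ r := by rw [← inv_pow, inv_neg, inv_one]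
        simp [par, curlFactor, mul_comm, h1]
    rw [e7, e8, smul_smul, ← zpow_add₀ hθ, hw]
    congr 2; ring

end Invariance
end TL

/-! ### Brackets of parallels and cables -/

lemma fits_map_cup (b : Bool) (r p : ℕ) : ∀ n, p ≤ n →
    Fits ((List.range r).map fun a => (⟨.cup b, p + a⟩ : Slice)) n (n + 2 * r) := by
  induction r with
  | zero => intro n _; simp [Fits]
  | succ r ih =>
    intro n h
    rw [List.range_succ, List.map_append, fits_append]
    exact ⟨_, ih n h, by simp only [List.map_cons, List.map_nil, Fits]; omega⟩

lemma fits_map_cap (r p : ℕ) : ∀ n, p + 2 * r ≤ n →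
    Fits ((List.range r).reverse.map fun a => (⟨.cap, p + a⟩ : Slice)) n (n - 2 * r) := by
  induction r with
  | zero => intro n _; simp [Fits]
  | succ r ih =>
    intro n h
    rw [List.range_succ, List.reverse_append, List.map_append, fits_append]
    refine ⟨n - 2, by simp only [List.reverse_cons, List.reverse_nil, List.nil_append,
      List.map_cons, List.map_nil, Fits]; exact ⟨by omega, trivial⟩, ?_⟩
    have := ih (n - 2) (by omega)
    rwa [show n - 2 - 2 * r = n - 2 * (r + 1) by omega] at this

lemma fits_of_isCross (w : Word) (n : ℕ)
    (h : ∀ g ∈ w, g.piece.isCross = true ∧ g.pos + 2 ≤ n) : Fits w n n := by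
  induction w with
  | nil => rfl
  | cons g w ih =>
    have h1 := h g (by simp)
    have h2 := ih fun g hg => h g (by simp [hg])
    rcases g with ⟨_ | _ | s, i⟩
    · simp [Piece.isCross] at h1
    · simp [Piece.isCross] at h1
    · exact ⟨h1.2, h2⟩

lemma fits_parallel (r : ℕ) (w : Word) : ∀ n m, Fits w n m → Fits (parallel r w) (r * n) (r * m) := by
  induction w with
  | nil => rintro n _ rfl; exact rfl
  | cons g w ih =>
    intro n m h
    change Fits (parallelSlice r g ++ parallel r w) _ _
    rw [fits_append]
    rcases g with ⟨b | _ | s, i⟩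
    · refine ⟨r * (n + 2), ?_, ih _ _ h.2⟩
      have := fits_map_cup b r (r * i) (r * n) (Nat.mul_le_mul_left r h.1)
      rwa [show r * n + 2 * r = r * (n + 2) by ring] at this
    · obtain ⟨n, rfl⟩ : ∃ n', n = n' + 2 := ⟨n - 2, by have := h.1; omega⟩
      refine ⟨r * n, ?_, ih _ _ h.2⟩
      have h1 := Nat.mul_le_mul_left r h.1
      have := fits_map_cap r (r * i) (r * (n + 2)) (by rw [mul_add] at h1; omega)
      rwa [show r * (n + 2) - 2 * r = r * n by rw [mul_add]; omega] at this
    · refine ⟨r * n, ?_, ih _ _ h.2⟩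
      refine fits_of_isCross _ _ fun g hg => ?_
      simp only [parallelSlice, List.mem_flatMap, List.mem_map, List.mem_reverse,
        List.mem_range] at hg
      obtain ⟨a, ha, c, hc, rfl⟩ := hg
      have h1 := Nat.mul_le_mul_left r h.1
      rw [mul_add] at h1
      exact ⟨rfl, by dsimp only; omega⟩

lemma fits_cable (r : ℕ) {b : Bool} {w : Word} (m : ℤ) (hw : run w [b, !b] = some []) :
    Fits (parallel r [⟨.cup b, 0⟩] ++ fullTwists r m ++ parallel r w) 0 0 := by
  rw [fits_append]
  refine ⟨r * 2, (fits_append _ _ _ _).2 ⟨r * 2, ?_, ?_⟩, ?_⟩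
  · simpa using fits_parallel r [⟨.cup b, 0⟩] 0 2 (by simp [Fits])
  · refine fits_of_isCross _ _ fun g hg => ?_
    simp only [fullTwists, List.mem_flatten, List.mem_replicate] at hg
    obtain ⟨l, ⟨-, rfl⟩, hg⟩ := hg
    simp only [List.mem_map, List.mem_range] at hg
    obtain ⟨a, ha, rfl⟩ := hg
    exact ⟨rfl, by dsimp only; omega⟩
  · simpa using fits_parallel r w 2 0 (fits_of_run hw)

namespace TL
section
variable {k 𝒜 : Type*} [Field k] [Ring 𝒜] [Algebra k 𝒜] {δ : k} (t : TL k 𝒜 δ)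

lemma ev_fullTwists (A : k) (r : ℕ) (m : ℤ) : t.ev A (fullTwists r m) =
    t.twist (par A (decide (0 < m))) r ^ m.natAbs := by
  have h : t.ev A ((List.range (r - 1)).map fun a => (⟨.cross (decide (0 < m)), a⟩ : Slice)) =
      t.row (par A (decide (0 < m))) 0 (r - 1) := by
    rw [row_eq_prod, ev, List.map_map]
    simp only [zero_add]
    rfl
  rw [fullTwists, twist, ← pow_mul, mul_comm r]
  induction m.natAbs * r with
  | zero => simp
  | succ n ih => rw [List.replicate_succ, List.flatten_cons, ev_append, h, ih, pow_succ']

lemma par_pow_natAbs {A : k} (m : ℤ) : par A (decide (0 < m)) ^ m.natAbs = A ^ m := by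
  rcases lt_trichotomy m 0 with h | rfl | h
  · rw [par, if_neg (by simpa using h.le), inv_pow, ← zpow_natCast, ← zpow_neg]
    congr 1; omega
  · simp
  · rw [par, if_pos (by simpa using h), ← zpow_natCast]
    congr 1; omega

lemma map_cheb {R S : Type*} [CommRing R] [CommRing S] (f : R →+* S) (x : R) (c : ℕ) :
    f (cheb x c) = cheb (f x) c := by
  induction c using Nat.twoStepInduction with
  | zero => simp [cheb]
  | one => simp [cheb]
  | more c h1 h2 => simp [cheb, h1, h2]

lemma cheb_neg_two (c : ℕ) : cheb (-2 : ℤ) c = (-1) ^ c * (c + 1) := by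
  induction c using Nat.twoStepInduction with
  | zero => simp [cheb]
  | one => simp [cheb]
  | more c h1 h2 => rw [cheb, h1, h2]; push_cast; ring

end
end TL

/-! ### The field of rational functions and coloured brackets as Laurent polynomials. -/

section Ground
open LaurentPolynomial

/-- The field of rational functions in `A`. -/
abbrev RatA := FractionRing (LaurentPolynomial ℤ)

/-- The inclusion of the Laurent polynomials. -/
noncomputable def toRat : LaurentPolynomial ℤ →+* RatA := algebraMap _ _

lemma toRat_injective : Function.Injective toRat := IsFractionRing.injective _ _

/-- The variable as a rational function. -/
noncomputable def varA : RatA := toRat (T 1)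

lemma varA_ne_zero : varA ≠ 0 := fun h => by
  have := toRat_injective (h.trans (map_zero toRat).symm)
  exact (isUnit_T (R := ℤ) 1).ne_zero this

lemma toRat_T (n : ℤ) : toRat (T n) = varA ^ n := by
  have h : ∀ m : ℕ, toRat (T (m : ℤ)) = varA ^ m := fun m => by
    rw [varA, ← map_pow, T_pow, mul_one]
  rcases n with m | m
  · simpa using h m
  · rw [Int.negSucc_eq]
    refine (eq_inv_of_mul_eq_one_left ?_).trans (zpow_neg _ _).symm
    rw [show ((m : ℤ) + 1) = ((m + 1 : ℕ) : ℤ) by push_cast; rfl, zpow_natCast, ← h, ← map_mul,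
      ← T_add, neg_add_cancel, T_zero, map_one]

lemma toRat_loopValue : toRat loopValue = -varA ^ 2 - varA⁻¹ ^ 2 := by
  rw [loopValue, map_sub, map_neg, toRat_T, toRat_T]
  have : (varA : RatA) ^ (-2 : ℤ) = varA⁻¹ ^ 2 := by rw [zpow_neg, inv_pow]; rfl
  rw [this]
  have : (varA : RatA) ^ (2 : ℤ) = varA ^ 2 := rfl
  rw [this]; ring

/-- At `A = 1` the loop value is `-2`, where the Chebyshev value is `(-1)^c (c + 1)`. -/
lemma cheb_ne_zero (c : ℕ) : TL.cheb (-varA ^ 2 - varA⁻¹ ^ 2 : RatA) c ≠ 0 := by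
  rw [← toRat_loopValue, ← TL.map_cheb]
  intro h
  have h1 := toRat_injective (h.trans (map_zero toRat).symm)
  have h2 := congrArg (LaurentPolynomial.eval₂ (RingHom.id ℤ) 1) h1
  rw [TL.map_cheb, map_zero] at h2
  have h3 : LaurentPolynomial.eval₂ (RingHom.id ℤ) 1 loopValue = -2 := by
    rw [loopValue, map_sub, map_neg, eval₂_T, eval₂_T]; simp
  rw [h3, TL.cheb_neg_two] at h2
  rcases mul_eq_zero.1 h2 with h4 | h4
  · exact pow_ne_zero c (by norm_num) h4
  · omega

/-- The Temperley–Lieb system over the rational functions. -/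
noncomputable abbrev modelA := TL.model varA varA_ne_zero

/-- The scalars in the model. -/
noncomputable def scal : LaurentPolynomial ℤ →+* Module.End RatA ((ℕ → Bool) → RatA) :=
  (algebraMap RatA _).comp toRat

lemma scal_injective : Function.Injective scal :=
  (FaithfulSMul.algebraMap_injective RatA _).comp toRat_injective

lemma toRat_smul_scal (p q : LaurentPolynomial ℤ) : toRat p • scal q = scal (p * q) := by
  rw [map_mul, Algebra.smul_def]; rfl

lemma modelA_ev (w : Word) (hw : Fits w 0 0) : modelA.ev varA w = scal (fullBracket w) :=
  TL.ev_eq_fullBracket varA varA_ne_zero modelA toRat toRat_T w hw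

/-- The bracket of the parallel coloured by a Jones–Wenzl element. -/
noncomputable def coloredBracket (w : Word) (r : ℕ) : LaurentPolynomial ℤ :=
  fullBracket (parallel r w) -
    ∑ d : Fin r, (twistCoeff r 0 (d + 1) : LaurentPolynomial ℤ) * coloredBracket w (r - 2 * (d + 1))
termination_by r
decreasing_by have := d.2; omega

/-- The coloured brackets are defined by solving this triangular system with unit diagonal. Hence
they are Laurent polynomials, although Jones–Wenzl elements have denominators. -/
lemma fullBracket_parallel (w : Word) (r : ℕ) : fullBracket (parallel r w) =
    ∑ d ∈ Finset.range (r + 1),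
      (twistCoeff r 0 d : LaurentPolynomial ℤ) * coloredBracket w (r - 2 * d) := by
  rw [Finset.sum_range_succ', twistCoeff_zero, Nat.cast_one, one_mul, mul_zero, Nat.sub_zero,
    coloredBracket, Finset.sum_range fun d => (twistCoeff r 0 (d + 1) : LaurentPolynomial ℤ) *
      coloredBracket w (r - 2 * (d + 1))]
  ring

variable (D : KnotDiagram)

/-- `m` is left free: `m = 0` gives the parallel, and minus the writhe gives the cable. The sign of
`m` sits in the parameter of the twisting crossings, so the powers combine to one with exponent
linear in `m`. -/
lemma fullBracket_cable_aux (m : ℤ) (r : ℕ) {b : Bool} {w : Word} (h1 : D.1 = ⟨.cup b, 0⟩ :: w)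
    (h2 : run w [b, !b] = some []) :
    scal (fullBracket (parallel r [⟨.cup b, 0⟩] ++ fullTwists r m ++ parallel r w)) =
    ∑ d ∈ Finset.range (r + 1), toRat ((twistCoeff r 0 d : LaurentPolynomial ℤ) *
      T (m * (((r - 2 * d : ℕ) : ℤ) * ((r - 2 * d : ℕ) - 1) - 6 * d))) •
        modelA.colored varA (r - 2 * d) D.1 := by
  have hcomp : components (⟨.cup b, 0⟩ :: w) = 1 := h1 ▸ D.2.2
  have h3 := modelA.decor_twist varA_ne_zero rfl cheb_ne_zero hcomp h2
    (TL.par_ne_zero varA_ne_zero (decide (0 < m))) (TL.eq_par rfl (decide (0 < m))) m.natAbs r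
  rw [← modelA_ev _ (fits_cable r m h2), TL.ev_append, TL.ev_append, TL.ev_fullTwists,
    TL.ev_parallel, TL.ev_parallel]
  have h4 : modelA.cabW varA r [⟨.cup b, 0⟩] = modelA.U r 0 := by simp [TL.cabW, TL.cabS, TL.cabP]
  rw [h4]
  refine h3.trans (Finset.sum_congr rfl fun d hd => ?_)
  rw [TL.colored, h1, List.tail_cons]
  congr 1
  rw [map_mul, map_natCast, toRat_T]
  congr 1
  have h5 := TL.par_pow_natAbs (A := varA) m
  have h6 : ((r - 2 * d : ℕ) : ℤ) * ((r - 2 * d : ℕ) - 1) =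
      (((r - 2 * d) * (r - 2 * d - 1) : ℕ) : ℤ) := by
    rcases r - 2 * d with _ | j
    · rfl
    · push_cast; simp
  rw [inv_pow, inv_pow, inv_pow, ← pow_mul, ← pow_mul, ← pow_mul, h6]
  rw [show 6 * (m.natAbs * d) = m.natAbs * (6 * d) by ring,
    show (r - 2 * d) * (r - 2 * d - 1) * m.natAbs = m.natAbs * ((r - 2 * d) * (r - 2 * d - 1)) by
      ring, pow_mul _ m.natAbs, pow_mul _ m.natAbs ((r - 2 * d) * (r - 2 * d - 1)), h5, ← zpow_natCast, ← zpow_natCast, ← zpow_mul,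
    ← zpow_mul, ← zpow_neg, ← zpow_add₀ varA_ne_zero]
  congr 1
  push_cast
  ring

/-- For `m = 0` the coloured values satisfy the same triangular system as the coloured brackets. -/
lemma colored_eq_scal (r : ℕ) :
    modelA.colored varA r D.1 = scal (coloredBracket D.1 r) := by
  induction r using Nat.strong_induction_on with
  | _ r ih =>
  obtain ⟨b, w, h1, h2⟩ := D.exists_cons
  have h3 := fullBracket_cable_aux D 0 r h1 h2
  have h4 : fullTwists r 0 = [] := by simp [fullTwists]
  have h5 : parallel r [⟨.cup b, 0⟩] ++ fullTwists r 0 ++ parallel r w = parallel r D.1 := by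
    rw [h4, h1]; simp [parallel]
  rw [h5, fullBracket_parallel, map_sum, Finset.sum_range_succ', Finset.sum_range_succ',
    Finset.sum_congr rfl fun d hd => ?_] at h3
  · have h6 := add_left_cancel h3
    simpa [twistCoeff_zero] using h6.symm
  · rw [zero_mul, T_zero, mul_one]
    rw [Finset.mem_range] at hd
    rw [ih _ (by omega), toRat_smul_scal]

/-- The bracket of the cable in terms of coloured brackets. -/
theorem fullBracket_cable (r : ℕ) : fullBracket (cable r D.1) =
    ∑ d ∈ Finset.range (r + 1), (twistCoeff r 0 d : LaurentPolynomial ℤ) *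
      T (-writhe D.1 * (((r - 2 * d : ℕ) : ℤ) * ((r - 2 * d : ℕ) - 1) - 6 * d)) *
        coloredBracket D.1 (r - 2 * d) := by
  obtain ⟨b, w, h1, h2⟩ := D.exists_cons
  have h3 := fullBracket_cable_aux D (-writhe D.1) r h1 h2
  have h5 : cable r D.1 = parallel r [⟨.cup b, 0⟩] ++ fullTwists r (-writhe D.1) ++ parallel r w := by
    rw [cable]; congr 2 <;> rw [h1] <;> rfl
  rw [← h5] at h3
  apply scal_injective
  rw [h3, map_sum]
  refine Finset.sum_congr rfl fun d _ => ?_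
  rw [colored_eq_scal, toRat_smul_scal]

/-- The behaviour of coloured brackets under changes of the diagram. -/
theorem coloredBracket_invariant {K : Knot} {D E : KnotDiagram} (hD : IsDiagramOf D K)
    (hE : IsDiagramOf E K) (r : ℕ) :
    coloredBracket E.1 r = (((r : ℤ) * (writhe E.1 - writhe D.1)).negOnePow : ℤ) •
      (T ((r ^ 2 + 2 * r) * (writhe E.1 - writhe D.1)) * coloredBracket D.1 r) := by
  have hθ : TL.curlFactor varA r ≠ 0 :=
    mul_ne_zero (pow_ne_zero _ (by simp)) (pow_ne_zero _ varA_ne_zero)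
  have h := modelA.colored_invariant varA_ne_zero rfl cheb_ne_zero hD hE r
  have h1 : modelA.colored varA r E.1 =
      (TL.curlFactor varA r) ^ (writhe E.1 - writhe D.1) • modelA.colored varA r D.1 := by
    rw [sub_eq_add_neg (writhe E.1), zpow_add₀ hθ, mul_smul, h, smul_smul, ← zpow_add₀ hθ, add_neg_cancel,
      zpow_zero, one_smul]
  rw [colored_eq_scal, colored_eq_scal] at h1
  have h2 : (TL.curlFactor varA r) ^ (writhe E.1 - writhe D.1) =
      toRat (((((r : ℤ) * (writhe E.1 - writhe D.1)).negOnePow : ℤ) : LaurentPolynomial ℤ) *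
        T ((r ^ 2 + 2 * r) * (writhe E.1 - writhe D.1))) := by
    rw [map_mul, toRat_T, TL.curlFactor, mul_zpow, ← zpow_natCast, ← zpow_natCast, ← zpow_mul,
      ← zpow_mul, map_intCast]
    push_cast
    congr 1
    rcases Int.even_or_odd (r * (writhe E.1 - writhe D.1)) with h3 | h3
    · rw [h3.neg_one_zpow, Int.negOnePow_even _ h3]; simp
    · rw [h3.neg_one_zpow, Int.negOnePow_odd _ h3]; simp
  rw [h2, toRat_smul_scal] at h1
  rw [scal_injective h1, mul_assoc, zsmul_eq_mul]

end Ground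

/-! ### Counting colourings -/

namespace TL

/-- The cup of the system that counts colourings with two colours. -/
def bitCup (i : ℕ) : Module.End ℚ ((ℕ → Bool) → ℚ) where
  toFun ξ s := ξ (ins i false false s) + ξ (ins i true true s)
  map_add' ξ η := by funext s; simp; ring
  map_smul' r ξ := by funext s; simp; ring

/-- The cap of the system that counts colourings with two colours. -/
def bitCap (i : ℕ) : Module.End ℚ ((ℕ → Bool) → ℚ) where
  toFun ξ s := if s (i + 1) = s i then ξ (del i s) else 0
  map_add' ξ η := by funext s; simp only [Pi.add_apply]; split_ifs <;> ring
  map_smul' r ξ := by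
    funext s; simp only [Pi.smul_apply, smul_eq_mul, RingHom.id_apply]; split_ifs <;> ring

lemma bitCup_apply (i : ℕ) (ξ : (ℕ → Bool) → ℚ) (s : ℕ → Bool) :
    bitCup i ξ s = ξ (ins i false false s) + ξ (ins i true true s) := rfl

lemma bitCap_apply (i : ℕ) (ξ : (ℕ → Bool) → ℚ) (s : ℕ → Bool) :
    bitCap i ξ s = if s (i + 1) = s i then ξ (del i s) else 0 := rfl

/-- The system that counts colourings with two colours. -/
def bits : TL ℚ (Module.End ℚ ((ℕ → Bool) → ℚ)) 2 where
  u := bitCup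
  c := bitCap
  loop i := by
    ext ξ s
    rw [Module.algebraMap_end_apply]
    simp [bitCup_apply, bitCap_apply, ins_apply_left, ins_apply_right, del_ins]
    ring
  zigL i := by
    ext ξ s
    have h := ins_apply_add_two i i le_rfl
    simp only [Module.End.mul_apply, bitCup_apply, bitCap_apply, ins_apply_right, h,
      Module.End.one_apply, show i + 1 + 1 = i + 2 from rfl]
    cases hs : s i
    · simp [del_succ_ins i false false s hs]
    · simp [del_succ_ins i true true s hs]
  zigR i := by
    ext ξ s
    simp only [Module.End.mul_apply, bitCup_apply, bitCap_apply, ins_apply_left,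
      ins_apply_lt (i + 1) i (Nat.lt_succ_self i), Module.End.one_apply]
    cases hs : s i
    · simp [del_ins_succ i false false s hs]
    · simp [del_ins_succ i true true s hs]
  uu i j h := by
    ext ξ s
    simp only [Module.End.mul_apply, bitCup_apply, ins_ins i j h]
    ring
  cu i j h := by
    ext ξ s
    simp only [Module.End.mul_apply, bitCup_apply, bitCap_apply, del_ins_of_le i j h,
      ins_apply_add_two i j h, show j + 2 + 1 = (j + 1) + 2 by ring,
      ins_apply_add_two i (j + 1) (by omega)]
    split_ifs <;> ring
  uc i j h := by
    ext ξ s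
    simp only [Module.End.mul_apply, bitCup_apply, bitCap_apply, del_ins_of_le' i j h,
      ins_apply_lt (j + 2) i (by omega), ins_apply_lt (j + 2) (i + 1) (by omega)]
    split_ifs <;> ring
  cc i j h := by
    ext ξ s
    simp only [Module.End.mul_apply, bitCap_apply, del_del i j h,
      del_apply_le i j h, del_apply_le i (j + 1) (by omega),
      del_apply_lt (j + 2) i (by omega), del_apply_lt (j + 2) (i + 1) (by omega),
      show j + 1 + 2 = j + 2 + 1 by ring]
    split_ifs <;> ring

/-- The colours of finitely many strands, as a sequence. -/
def pad (M : List Bool) : ℕ → Bool := fun j => M.getD j false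

lemma pad_append_cons_cons (P Q : List Bool) (x y : Bool) :
    pad (P ++ x :: y :: Q) = ins P.length x y (pad (P ++ Q)) := by
  funext m
  simp only [pad, ins, List.getD_eq_getElem?_getD, List.getElem?_append, List.getElem?_cons]
  grind

/-- Change of the colours. -/
def recolor (κ : ℕ → Bool) : Module.End ℚ ((ℕ → Bool) → ℚ) where
  toFun ξ s := ξ fun j => xor (s j) (κ j)
  map_add' _ _ := rfl
  map_smul' _ _ := rfl

lemma recolor_apply (κ : ℕ → Bool) (ξ : (ℕ → Bool) → ℚ) (s : ℕ → Bool) :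
    recolor κ ξ s = ξ fun j => xor (s j) (κ j) := rfl

lemma ins_xor (i : ℕ) (a b x y : Bool) (s κ : ℕ → Bool) :
    (fun j => xor (ins i a b s j) (ins i x y κ j)) =
      ins i (xor a x) (xor b y) fun j => xor (s j) (κ j) := by
  funext m; simp only [ins]; grind

lemma del_xor_ins (i : ℕ) (x y : Bool) (s κ : ℕ → Bool) :
    del i (fun j => xor (s j) (ins i x y κ j)) = fun j => xor (del i s j) (κ j) := by
  funext m; simp only [ins, del]; grind

lemma bitCup_mul_recolor (i : ℕ) (x : Bool) (κ : ℕ → Bool) :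
    bitCup i * recolor (ins i x x κ) = recolor κ * bitCup i := by
  ext ξ s
  simp only [Module.End.mul_apply, bitCup_apply, recolor_apply, ins_xor]
  cases x <;> simp [add_comm]

lemma recolor_mul_bitCap (i : ℕ) (x : Bool) (κ : ℕ → Bool) :
    recolor (ins i x x κ) * bitCap i = bitCap i * recolor κ := by
  ext ξ s
  simp only [Module.End.mul_apply, bitCap_apply, recolor_apply, del_xor_ins, ins_apply_left,
    ins_apply_right, Bool.xor_left_inj]

/-- Adding a fixed colouring modulo two permutes the colourings with two colours, so it commutes
with their count. -/
lemma evF_mul_recolor {w : List Flat} {M M' : List Bool} (h : ColRun w M M') (hw : ∃ n m, Planar w n m) :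
    bits.evF w * recolor (pad M') = recolor (pad M) * bits.evF w := by
  induction h with
  | nil => simp
  | cup x P Q M w _ ih =>
    obtain ⟨n, m, hw⟩ := hw
    rw [evF_cons, mul_assoc, ih ⟨_, _, hw.2⟩, pad_append_cons_cons, ← mul_assoc]
    change bitCup _ * _ * _ = _
    rw [bitCup_mul_recolor, mul_assoc]; rfl
  | cap x P Q M w _ ih =>
    obtain ⟨n, m, hw⟩ := hw
    rw [evF_cons, mul_assoc, ih ⟨_, _, hw.2⟩, pad_append_cons_cons, ← mul_assoc, ← mul_assoc]
    change bitCap _ * _ * _ = _ * bitCap _ * _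
    rw [recolor_mul_bitCap]
  | swap => obtain ⟨n, m, hw⟩ := hw; exact hw.elim

/-- The values of `bits` are sums over colourings, so a nonzero value exhibits one. -/
lemma exists_colRun_of_ne_zero (w : List Flat) : ∀ (M : List Bool) (m : ℕ), Planar w M.length m →
    ∀ ξ, bits.evF w ξ (pad M) ≠ 0 → ∃ M', M'.length = m ∧ ColRun w M M' ∧ ξ (pad M') ≠ 0 := by
  induction w with
  | nil => intro M m h ξ hξ; exact ⟨M, h, .nil M, hξ⟩
  | cons g w ih =>
    intro M m h ξ hξ
    rw [evF_cons, Module.End.mul_apply] at hξ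
    rcases g with i | i | i
    · obtain ⟨P, Q, rfl, rfl⟩ := exists_append_of_le h.1
      change bitCup _ _ _ ≠ 0 at hξ
      rw [bitCup_apply, ← pad_append_cons_cons, ← pad_append_cons_cons] at hξ
      have key : ∀ x, bits.evF w ξ (pad (P ++ x :: x :: Q)) ≠ 0 →
          ∃ M', M'.length = m ∧ ColRun (.cup P.length :: w) (P ++ Q) M' ∧ ξ (pad M') ≠ 0 := by
        intro x hx
        obtain ⟨M', h1, h2, h3⟩ := ih _ m (by
          have := h.2
          simp only [List.length_append, List.length_cons] at this ⊢
          exact this) ξ hx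
        exact ⟨M', h1, .cup x P Q _ _ h2, h3⟩
      by_cases h0 : bits.evF w ξ (pad (P ++ false :: false :: Q)) = 0
      · rw [h0, zero_add] at hξ; exact key _ hξ
      · exact key _ h0
    · obtain ⟨P, x, y, Q, rfl, rfl⟩ := exists_append_cons_cons_of_lt h.1
      change bitCap _ _ _ ≠ 0 at hξ
      rw [bitCap_apply, pad_append_cons_cons, ins_apply_left, ins_apply_right, del_ins] at hξ
      split_ifs at hξ with hxy
      · subst hxy
        obtain ⟨M', h1, h2, h3⟩ := ih (P ++ Q) m (by
          have := h.2
          simp only [List.length_append, List.length_cons] at this ⊢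
          exact this) ξ hξ
        exact ⟨M', h1, .cap _ P Q _ _ h2, h3⟩
      · exact (hξ rfl).elim
    · exact h.elim

/-- The colours of the strands `i` and `i + 1` are equal. -/
def diag (i : ℕ) : Module.End ℚ ((ℕ → Bool) → ℚ) where
  toFun ξ s := if s (i + 1) = s i then ξ s else 0
  map_add' ξ η := by funext s; simp only [Pi.add_apply]; split_ifs <;> ring
  map_smul' r ξ := by
    funext s; simp only [Pi.smul_apply, smul_eq_mul, RingHom.id_apply]; split_ifs <;> ring

lemma diag_apply (i : ℕ) (ξ : (ℕ → Bool) → ℚ) (s : ℕ → Bool) :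
    diag i ξ s = if s (i + 1) = s i then ξ s else 0 := rfl

lemma ins_del (i : ℕ) (s : ℕ → Bool) : ins i (s i) (s (i + 1)) (del i s) = s := by
  funext m; simp only [ins, del]; grind

/-- Adding a pattern whose two bits differ exchanges equal and different colours of the two strands.
-/
lemma one_sub_diag_mul_recolor (i : ℕ) (x y : Bool) (hxy : x ≠ y) (κ : ℕ → Bool) :
    (1 - diag i) * recolor (ins i x y κ) = recolor (ins i x y κ) * diag i := by
  ext ξ s
  simp only [Module.End.mul_apply, LinearMap.sub_apply, Module.End.one_apply, Pi.sub_apply,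
    diag_apply, recolor_apply, ins_apply_left, ins_apply_right]
  revert hxy
  cases x <;> cases y <;> cases s i <;> cases s (i + 1) <;> simp

/-- A hook admits all colours of its two arcs; subtracting `diag` keeps those for which the arcs
differ. Adding different bits to the two arcs exchanges this case with the case of equal colours. -/
lemma e_sub_diag_mul_recolor (i : ℕ) (x y : Bool) (hxy : x ≠ y) (κ : ℕ → Bool) :
    (bits.e i - diag i) * recolor (ins i y y κ) = recolor (ins i x x κ) * diag i := by
  ext ξ s
  change (bitCap i * bitCup i - diag i : Module.End ℚ _) _ _ = _
  simp only [Module.End.mul_apply, LinearMap.sub_apply, Pi.sub_apply, bitCap_apply, bitCup_apply,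
    diag_apply, recolor_apply, ins_apply_left, ins_apply_right]
  obtain rfl : x = !y := by revert hxy; cases x <;> cases y <;> simp
  by_cases hs : s (i + 1) = s i
  · obtain ⟨s', b, rfl⟩ : ∃ s' b, s = ins i b b s' := by
      refine ⟨del i s, s i, ?_⟩
      conv_lhs => rw [← ins_del i s, hs]
    simp only [ins_apply_left, ins_apply_right, del_ins, if_true, ins_xor]
    cases y <;> cases b <;> simp
  · simp [hs]

end TL

/-- There is a colouring of `v` and `w` for which the strands `i` and `i + 1` differ. -/
def SepVert (v w : List Flat) (i : ℕ) : Prop :=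
  ∃ (P : List Bool) (x y : Bool) (Q : List Bool), P.length = i ∧ x ≠ y ∧
    ColRun v [] (P ++ x :: y :: Q) ∧ ColRun w (P ++ x :: y :: Q) []

/-- There is a colouring of `v`, a hook and `w` for which the two arcs of the hook differ. -/
def SepHook (v w : List Flat) (i : ℕ) : Prop :=
  ∃ (P : List Bool) (x y : Bool) (Q : List Bool), P.length = i ∧ x ≠ y ∧
    ColRun v [] (P ++ x :: x :: Q) ∧ ColRun w (P ++ y :: y :: Q) []

namespace TL

/-- The number of colourings with a condition in the middle. -/
def count (v w : List Flat) (X : Module.End ℚ ((ℕ → Bool) → ℚ)) : ℚ :=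
  (bits.evF v * X * bits.evF w) 1 (pad [])

lemma count_add (v w : List Flat) (X Y : Module.End ℚ ((ℕ → Bool) → ℚ)) :
    count v w (X + Y) = count v w X + count v w Y := by
  simp only [count, mul_add, add_mul, LinearMap.add_apply, Pi.add_apply]

variable {v w : List Flat} {m i : ℕ}

lemma count_eq_of_recolor (hv : Planar v 0 m) (hw : Planar w m 0) {M M' : List Bool}
    (h : ColRun v [] M) (h' : ColRun w M' []) {X Y : Module.End ℚ ((ℕ → Bool) → ℚ)}
    (hXY : X * recolor (pad M') = recolor (pad M) * Y) : count v w X = count v w Y := by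
  have e0 : recolor (pad []) = 1 := by ext ξ s; simp [recolor_apply, pad]
  have e1 := evF_mul_recolor h ⟨_, _, hv⟩
  have e2 := evF_mul_recolor h' ⟨_, _, hw⟩
  rw [e0, one_mul] at e1
  rw [e0, mul_one] at e2
  rw [count, e2, ← mul_assoc, mul_assoc _ X, hXY, ← mul_assoc, e1, count]

lemma exists_of_count_ne_zero (hv : Planar v 0 m) {X : Module.End ℚ ((ℕ → Bool) → ℚ)}
    (h : count v w X ≠ 0) :
    ∃ M : List Bool, M.length = m ∧ ColRun v [] M ∧ X (bits.evF w 1) (pad M) ≠ 0 :=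
  exists_colRun_of_ne_zero v [] m hv _ h

/-- If some colouring separates the two strands, adding it pairs the separating colourings with the
others, so they are exactly half of all. -/
lemma count_one_sub_diag (hv : Planar v 0 m) (hw : Planar w m 0) (hi : i + 2 ≤ m) :
    (SepVert v w i → count v w (1 - diag i) = count v w (diag i)) ∧
    (¬ SepVert v w i → count v w (1 - diag i) = 0) := by
  constructor
  · rintro ⟨P, x, y, Q, rfl, hxy, h1, h2⟩
    refine count_eq_of_recolor hv hw h1 h2 ?_
    rw [pad_append_cons_cons]
    exact one_sub_diag_mul_recolor _ _ _ hxy _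
  · intro h
    by_contra hne
    obtain ⟨M, hM, h1, h2⟩ := exists_of_count_ne_zero hv hne
    obtain ⟨P, x, y, Q, rfl, rfl⟩ := exists_append_cons_cons_of_lt (L := M) (i := i) (by omega)
    rw [LinearMap.sub_apply, Pi.sub_apply, Module.End.one_apply, diag_apply] at h2
    have hp := pad_append_cons_cons P Q x y
    split_ifs at h2 with hxy
    · simp at h2
    · rw [hp, ins_apply_left, ins_apply_right] at hxy
      rw [sub_zero] at h2
      obtain ⟨M', h3, h4, -⟩ := exists_colRun_of_ne_zero w _ 0 (hM.symm ▸ hw) _ h2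
      rw [List.length_eq_zero_iff] at h3
      subst h3
      exact h ⟨P, x, y, Q, rfl, Ne.symm hxy, h1, h4⟩

lemma count_e_sub_diag (hv : Planar v 0 m) (hw : Planar w m 0) (hi : i + 2 ≤ m) :
    (SepHook v w i → count v w (bits.e i - diag i) = count v w (diag i)) ∧
    (¬ SepHook v w i → count v w (bits.e i - diag i) = 0) := by
  constructor
  · rintro ⟨P, x, y, Q, rfl, hxy, h1, h2⟩
    refine count_eq_of_recolor hv hw h1 h2 ?_
    rw [pad_append_cons_cons, pad_append_cons_cons]
    exact e_sub_diag_mul_recolor _ _ _ hxy _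
  · intro h
    by_contra hne
    obtain ⟨M, hM, h1, h2⟩ := exists_of_count_ne_zero hv hne
    obtain ⟨P, x, y, Q, rfl, rfl⟩ := exists_append_cons_cons_of_lt (L := M) (i := i) (by omega)
    have hp := pad_append_cons_cons P Q x y
    change (bitCap _ * bitCup _ - diag _ : Module.End ℚ _) _ _ ≠ 0 at h2
    rw [LinearMap.sub_apply, Pi.sub_apply, Module.End.mul_apply, bitCap_apply, diag_apply, hp,
      ins_apply_left, ins_apply_right, del_ins, bitCup_apply] at h2
    split_ifs at h2 with hxy
    · subst hxy
      have h3 : bits.evF w 1 (ins P.length (!y) (!y) (pad (P ++ Q))) ≠ 0 := by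
        intro h3
        cases y
        · simp only [Bool.not_false] at h3; simp [h3] at h2
        · simp only [Bool.not_true] at h3; simp [h3] at h2
      rw [← pad_append_cons_cons] at h3
      obtain ⟨M', h4, h5, -⟩ := exists_colRun_of_ne_zero w _ 0 (by
        simp only [List.length_append, List.length_cons] at hM ⊢
        rw [hM]; exact hw) _ h3
      rw [List.length_eq_zero_iff] at h4
      subst h4
      exact h ⟨P, y, !y, Q, rfl, by simp, h1, h5⟩
    · simp at h2

lemma planar_hook (hv : Planar v 0 m) (hw : Planar w m 0) (hi : i + 2 ≤ m) :
    Planar (v ++ [.cap i, .cup i] ++ w) 0 0 := by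
  rw [planar_append]
  refine ⟨m, (planar_append _ _ _ _).2 ⟨m, hv, hi, ?_, ?_⟩, hw⟩
  · omega
  · change m - 2 + 2 = m; omega

end TL

open TL in
/-- A planar word, and the word with a hook inserted: exactly one of the two has a separating
colouring, and it has one circuit more than the other. -/
theorem circuits_hook {v w : List Flat} {m i : ℕ} (hv : Planar v 0 m) (hw : Planar w m 0)
    (hi : i + 2 ≤ m) :
    (circuits (v ++ w) = circuits (v ++ [.cap i, .cup i] ++ w) + 1 ∧
      SepVert v w i ∧ ¬ SepHook v w i) ∨
    (circuits (v ++ [.cap i, .cup i] ++ w) = circuits (v ++ w) + 1 ∧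
      SepHook v w i ∧ ¬ SepVert v w i) := by
  have p0 : Planar (v ++ w) 0 0 := (planar_append _ _ _ _).2 ⟨m, hv, hw⟩
  have p1 := planar_hook hv hw hi
  -- In the system `sign` a hook is worth `-1`, so inserting it changes the parity of the number of
  -- circuits.
  have hpar : ((-1 : ℤ)) ^ circuits (v ++ [.cap i, .cup i] ++ w) = -(-1) ^ circuits (v ++ w) := by
    have e0 := (sign.evF_eq_pow _ p0).1
    have e1 := (sign.evF_eq_pow _ p1).1
    have he : sign.evF [.cap i, .cup i] = -1 := by
      change ((-1 : ℤ) ^ (i + 1)) * ((-1) ^ i * 1) = -1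
      rw [mul_one, ← pow_add]; exact Odd.neg_one_pow ⟨i, by ring⟩
    rw [evF_append] at e0
    rw [evF_append, evF_append, he, mul_neg_one, neg_mul, e0] at e1
    simpa using e1.symm
  have c0 : count v w (diag i) + count v w (1 - diag i) = 2 ^ circuits (v ++ w) := by
    rw [← count_add, add_sub_cancel, count, mul_one, ← evF_append, (bits.evF_eq_pow _ p0).1,
      Module.algebraMap_end_apply]
    simp
  have c1 : count v w (diag i) + count v w (bits.e i - diag i) =
      2 ^ circuits (v ++ [.cap i, .cup i] ++ w) := by
    have h := (bits.evF_eq_pow _ p1).1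
    rw [evF_append, evF_append, Module.algebraMap_end_eq_smul_id] at h
    have he : bits.evF [.cap i, .cup i] = bits.e i := by simp [evF, flat, e]
    rw [← count_add, add_sub_cancel, count, ← he, h]
    simp
  have d0 := count_one_sub_diag hv hw hi
  have d1 := count_e_sub_diag hv hw hi
  -- The colourings with equal colours at `i` and `i + 1` are the same for both words. A word has
  -- twice as many colourings if it can be separated, and no others if it cannot. By parity the two
  -- totals differ, so exactly one of the words can be separated.
  have hne : circuits (v ++ [.cap i, .cup i] ++ w) ≠ circuits (v ++ w) := fun h => by
    rw [h] at hpar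
    have : ((-1 : ℤ)) ^ circuits (v ++ w) ≠ 0 := by simp
    omega
  have inj : ∀ a b : ℕ, (2 : ℚ) ^ a = 2 ^ b → a = b := fun a b h =>
    pow_right_injective₀ (by norm_num) (by norm_num) h
  by_cases s0 : SepVert v w i <;> by_cases s1 : SepHook v w i
  · rw [d0.1 s0] at c0; rw [d1.1 s1, c0] at c1; exact (hne (inj _ _ c1.symm)).elim
  · rw [d0.1 s0] at c0; rw [d1.2 s1, add_zero] at c1
    refine .inl ⟨inj _ _ ?_, s0, s1⟩
    rw [← c0, pow_succ, ← c1]; ring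
  · rw [d0.2 s0, add_zero] at c0; rw [d1.1 s1] at c1
    refine .inr ⟨inj _ _ ?_, s1, s0⟩
    rw [← c1, pow_succ, ← c0]; ring
  · rw [d0.2 s0] at c0; rw [d1.2 s1, c0] at c1; exact (hne (inj _ _ c1.symm)).elim


/-! ### Coloured homogeneous states -/

/-- The result of splitting all crossings in the same way. -/
def smoothing (t : Bool) : Word → List Flat
  | [] => []
  | ⟨.cup _, i⟩ :: w => .cup i :: smoothing t w
  | ⟨.cap, i⟩ :: w => .cap i :: smoothing t w
  | ⟨.cross a, i⟩ :: w => (if t = a then [] else [.cap i, .cup i]) ++ smoothing t w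

lemma crossings_append (v w : Word) : crossings (v ++ w) = crossings v + crossings w := by
  simp [crossings]

lemma crossings_cons_cross (a : Bool) (i : ℕ) (w : Word) :
    crossings (⟨.cross a, i⟩ :: w) = crossings w + 1 := by
  simp [crossings, Piece.isCross]

lemma resolve_append (v w : Word) (l' : List Bool) : ∀ l : List Bool, l.length = crossings v →
    resolve (v ++ w) (l ++ l') = resolve v l ++ resolve w l' := by
  induction v with
  | nil => intro l hl; obtain rfl := List.length_eq_zero_iff.1 hl; rfl
  | cons g v ih =>
    intro l hl
    rcases g with ⟨_ | _ | a, i⟩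
    · simp [resolve, ih l (by simpa [crossings, Piece.isCross] using hl)]
    · simp [resolve, ih l (by simpa [crossings, Piece.isCross] using hl)]
    · rcases l with _ | ⟨b, l⟩
      · simp [crossings, Piece.isCross] at hl
      · simp [resolve, ih l (by simpa [crossings, Piece.isCross] using hl)]

lemma resolve_replicate (t : Bool) (w : Word) :
    resolve w (List.replicate (crossings w) t) = smoothing t w := by
  induction w with
  | nil => rfl
  | cons g w ih =>
    rcases g with ⟨_ | _ | a, i⟩
    · simpa [resolve, smoothing, crossings, Piece.isCross] using ih
    · simpa [resolve, smoothing, crossings, Piece.isCross] using ih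
    · rw [crossings_cons_cross, List.replicate_succ, resolve, ih, smoothing]

lemma smoothing_append (t : Bool) (v w : Word) :
    smoothing t (v ++ w) = smoothing t v ++ smoothing t w := by
  rw [← resolve_replicate, ← resolve_replicate, ← resolve_replicate, crossings_append,
    List.replicate_add, resolve_append _ _ _ _ (by simp)]

lemma planar_smoothing (t : Bool) {w : Word} {n m : ℕ} (h : Fits w n m) :
    Planar (smoothing t w) n m := by
  rw [← resolve_replicate]; exact planar_resolve w _ n m h (by simp)

/-- A coloured run of a homogeneous state, where the colours at every crossing are related by `R`. -/
inductive SRun {α : Type*} (R : α → α → Prop) (t : Bool) : Word → List α → List α → Prop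
  | nil (M : List α) : SRun R t [] M M
  | cup (b : Bool) (x : α) (P Q M : List α) (w : Word) (h : SRun R t w (P ++ x :: x :: Q) M) :
      SRun R t (⟨.cup b, P.length⟩ :: w) (P ++ Q) M
  | cap (x : α) (P Q M : List α) (w : Word) (h : SRun R t w (P ++ Q) M) :
      SRun R t (⟨.cap, P.length⟩ :: w) (P ++ x :: x :: Q) M
  | vert (x y : α) (P Q M : List α) (w : Word) (hR : R x y) (h : SRun R t w (P ++ x :: y :: Q) M) :
      SRun R t (⟨.cross t, P.length⟩ :: w) (P ++ x :: y :: Q) M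
  | hook (x y : α) (P Q M : List α) (w : Word) (hR : R x y) (h : SRun R t w (P ++ y :: y :: Q) M) :
      SRun R t (⟨.cross !t, P.length⟩ :: w) (P ++ x :: x :: Q) M

namespace SRun
variable {α : Type*} {R : α → α → Prop} {t : Bool}

lemma append {v w : Word} {M M' M'' : List α} (h : SRun R t v M M') (h' : SRun R t w M' M'') :
    SRun R t (v ++ w) M M'' := by
  induction h with
  | nil => exact h'
  | cup b x P Q M w _ ih => exact .cup b x P Q _ _ (ih h')
  | cap x P Q M w _ ih => exact .cap x P Q _ _ (ih h')
  | vert x y P Q M w hR _ ih => exact .vert x y P Q _ _ hR (ih h')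
  | hook x y P Q M w hR _ ih => exact .hook x y P Q _ _ hR (ih h')

lemma exists_of_append {v w : Word} {M M'' : List α} (h : SRun R t (v ++ w) M M'') :
    ∃ M', SRun R t v M M' ∧ SRun R t w M' M'' := by
  generalize hu : v ++ w = u at h
  induction h generalizing v with
  | nil M =>
    obtain ⟨rfl, rfl⟩ := List.append_eq_nil_iff.1 hu
    exact ⟨M, .nil M, .nil M⟩
  | cup b x P Q M w' h ih =>
    rcases v with _ | ⟨g, v⟩
    · subst hu; exact ⟨_, .nil _, .cup b x P Q M w' h⟩
    · rw [List.cons_append, List.cons.injEq] at hu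
      obtain ⟨rfl, hu⟩ := hu
      obtain ⟨M', h1, h2⟩ := ih hu
      exact ⟨M', .cup b x P Q _ _ h1, h2⟩
  | cap x P Q M w' h ih =>
    rcases v with _ | ⟨g, v⟩
    · subst hu; exact ⟨_, .nil _, .cap x P Q M w' h⟩
    · rw [List.cons_append, List.cons.injEq] at hu
      obtain ⟨rfl, hu⟩ := hu
      obtain ⟨M', h1, h2⟩ := ih hu
      exact ⟨M', .cap x P Q _ _ h1, h2⟩
  | vert x y P Q M w' hR h ih =>
    rcases v with _ | ⟨g, v⟩
    · subst hu; exact ⟨_, .nil _, .vert x y P Q M w' hR h⟩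
    · rw [List.cons_append, List.cons.injEq] at hu
      obtain ⟨rfl, hu⟩ := hu
      obtain ⟨M', h1, h2⟩ := ih hu
      exact ⟨M', .vert x y P Q _ _ hR h1, h2⟩
  | hook x y P Q M w' hR h ih =>
    rcases v with _ | ⟨g, v⟩
    · subst hu; exact ⟨_, .nil _, .hook x y P Q M w' hR h⟩
    · rw [List.cons_append, List.cons.injEq] at hu
      obtain ⟨rfl, hu⟩ := hu
      obtain ⟨M', h1, h2⟩ := ih hu
      exact ⟨M', .hook x y P Q _ _ hR h1, h2⟩

lemma mono {R' : α → α → Prop} (hR : ∀ x y, R x y → R' x y) {w : Word} {M M' : List α}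
    (h : SRun R t w M M') : SRun R' t w M M' := by
  induction h with
  | nil M => exact .nil M
  | cup b x P Q M w _ ih => exact .cup b x P Q _ _ ih
  | cap x P Q M w _ ih => exact .cap x P Q _ _ ih
  | vert x y P Q M w h _ ih => exact .vert x y P Q _ _ (hR _ _ h) ih
  | hook x y P Q M w h _ ih => exact .hook x y P Q _ _ (hR _ _ h) ih

lemma colRun {w : Word} {M M' : List α} (h : SRun R t w M M') : ColRun (smoothing t w) M M' := by
  induction h with
  | nil M => exact .nil M
  | cup b x P Q M w _ ih => exact .cup x P Q _ _ ih
  | cap x P Q M w _ ih => exact .cap x P Q _ _ ih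
  | vert x y P Q M w h _ ih => simpa [smoothing] using ih
  | hook x y P Q M w h _ ih =>
    simp only [smoothing, Bool.eq_not_self, if_false, List.cons_append, List.nil_append]
    exact .cap x P Q _ _ (.cup y P Q _ _ ih)

lemma of_colRun (w : Word) : ∀ {M M' : List α} {m : ℕ}, Fits w M.length m →
    ColRun (smoothing t w) M M' → SRun (fun _ _ => True) t w M M' := by
  induction w with
  | nil => intro M M' m _ h; cases h; exact .nil M
  | cons g w ih =>
    intro M M' m hw h
    rcases g with ⟨b | _ | a, i⟩
    · cases h with
      | cup x P Q _ _ h =>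
        refine .cup b x P Q _ _ (ih (m := m) ?_ h)
        have := hw.2
        simp only [List.length_append, List.length_cons] at this ⊢
        exact this
    · cases h with
      | cap x P Q _ _ h =>
        refine .cap x P Q _ _ (ih (m := m) ?_ h)
        have := hw.2
        simp only [List.length_append, List.length_cons] at this ⊢
        exact this
    · by_cases hta : t = a
      · subst hta
        obtain ⟨P, x, y, Q, rfl, rfl⟩ := exists_append_cons_cons_of_lt hw.1
        simp only [smoothing, if_true, List.nil_append] at h
        exact .vert x y P Q _ _ trivial (ih hw.2 h)
      · obtain rfl : a = !t := by revert hta; cases a <;> cases t <;> simp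
        simp only [smoothing, Bool.eq_not_self, if_false, List.cons_append, List.nil_append] at h
        generalize hu : Flat.cup i :: smoothing t w = u at h
        cases h with
        | cap x P Q _ _ h =>
          generalize hPQ : P ++ Q = S at h
          subst hu
          generalize hi : P.length = i at h
          cases h with
          | cup y P' Q' _ _ h =>
            obtain ⟨rfl, rfl⟩ := List.append_inj hPQ hi
            refine .hook x y P Q _ _ trivial (ih (m := m) ?_ h)
            have := hw.2
            simp only [List.length_append, List.length_cons] at this ⊢
            exact this

end SRun

lemma ColRun.map {α β : Type*} (f : α → β) {w : List Flat} {M M' : List α} (h : ColRun w M M') :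
    ColRun w (M.map f) (M'.map f) := by
  induction h with
  | nil M => exact .nil _
  | cup x P Q M w _ ih =>
    rw [List.map_append] at ih ⊢
    rw [← List.length_map (f := f)]
    exact .cup (f x) _ _ _ _ ih
  | cap x P Q M w _ ih =>
    rw [List.map_append] at ih ⊢
    rw [← List.length_map (f := f)]
    exact .cap (f x) _ _ _ _ ih
  | swap x y P Q M w _ ih =>
    rw [List.map_append] at ih ⊢
    rw [← List.length_map (f := f)]
    exact .swap (f x) (f y) _ _ _ _ ih

/-! ### Coloured runs of parallels -/

section Parallel
variable {α : Type*} {R : α → α → Prop} {t : Bool}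

lemma map_range_sub {β : Type*} (f : ℕ → β) (c : ℕ) :
    (List.range c).map (fun k => f (c - 1 - k)) = ((List.range c).map f).reverse := by
  apply List.ext_getElem <;> simp

lemma SRun.cups (b : Bool) (P : List α) (L : List α) : ∀ Q : List α,
    SRun R t ((List.range L.length).map fun a => (⟨.cup b, P.length + a⟩ : Slice)) (P ++ Q)
      (P ++ (L ++ L.reverse) ++ Q) := by
  induction L using List.reverseRecOn with
  | nil => intro Q; simpa using SRun.nil (P ++ Q)
  | append_singleton L x ih =>
    intro Q
    rw [List.length_append, List.length_singleton, List.range_succ, List.map_append]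
    refine (ih Q).append ?_
    have := SRun.cup (R := R) (t := t) b x (P ++ L) (L.reverse ++ Q) _ _ (.nil _)
    simpa using this

lemma SRun.caps (P : List α) (L : List α) : ∀ Q : List α,
    SRun R t ((List.range L.length).reverse.map fun a => (⟨.cap, P.length + a⟩ : Slice))
      (P ++ (L ++ L.reverse) ++ Q) (P ++ Q) := by
  induction L using List.reverseRecOn with
  | nil => intro Q; simpa using SRun.nil (P ++ Q)
  | append_singleton L x ih =>
    intro Q
    rw [List.length_append, List.length_singleton, List.range_succ, List.reverse_append,
      List.map_append]
    refine SRun.append ?_ (ih Q)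
    have := SRun.cap (R := R) (t := t) x (P ++ L) (L.reverse ++ Q) _ _ (.nil _)
    simpa using this

lemma SRun.verts (M : List α) (w : Word) (h : ∀ g ∈ w, g.piece = .cross t ∧ ∃ P x y Q,
    M = P ++ x :: y :: Q ∧ P.length = g.pos ∧ R x y) : SRun R t w M M := by
  induction w with
  | nil => exact .nil M
  | cons g w ih =>
    rcases g with ⟨p, i⟩
    obtain ⟨rfl, P, x, y, Q, rfl, rfl, hR⟩ := h ⟨p, i⟩ (by simp)
    exact .vert x y P Q _ _ hR (ih fun g hg => h g (by simp [hg]))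

lemma SRun.hooks (P : List α) (h : ℕ → α) (n : ℕ) : ∀ Q : List α,
    (∀ b < n, R (h b) (h (b + 1))) →
    SRun R t ((List.range n).map fun b => (⟨.cross !t, P.length + b⟩ : Slice))
      (P ++ h 0 :: (List.range n).map h ++ Q)
      (P ++ (List.range n).map (fun b => h (b + 1)) ++ h n :: Q) := by
  induction n with
  | zero => intro Q _; simpa using SRun.nil (P ++ h 0 :: Q)
  | succ n ih =>
    intro Q hR
    rw [List.range_succ, List.map_append, List.map_append, List.map_append]
    have h1 := ih (h n :: Q) fun b hb => hR b (by omega)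
    have h2 := SRun.hook (R := R) (t := t) (h n) (h (n + 1))
      (P ++ (List.range n).map (fun b => h (b + 1))) Q _ _ (hR n (by omega)) (.nil _)
    have := h1.append h2
    simpa using this

/-- A `c` by `c` grid of hooks consists of `c` nested caps below `c` nested cups. These arcs are
numbered by `g`, from the innermost cap outwards and then from the outermost cup inwards, and every
hook separates two consecutive ones. The induction runs over the rows, with `m` rows left to
process. -/
lemma SRun.hookGrid (P Q : List α) (g : ℕ → α) (c : ℕ) (hR : ∀ l, l + 1 < 2 * c → R (g l) (g (l + 1))) :
    ∀ m l, m + l = c →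
    SRun R t ((List.range m).reverse.flatMap fun a =>
        (List.range c).map fun b => (⟨.cross !t, P.length + a + b⟩ : Slice))
      (P ++ ((List.range m).map (fun j => g (c - 1 - j)) ++ (List.range c).map (fun b => g (l + b)) ++
        (List.range l).reverse.map (fun b => g (c + b))) ++ Q)
      (P ++ ((List.range c).map (fun b => g (c + b)) ++
        (List.range c).reverse.map (fun b => g (c + b))) ++ Q) := by
  intro m
  induction m with
  | zero =>
    rintro l rfl
    simpa using SRun.nil _
  | succ m ih =>
    intro l hl
    rw [List.range_succ, List.reverse_append, List.flatMap_append]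
    refine SRun.append ?_ (ih (l + 1) (by omega))
    have h1 := SRun.hooks (R := R) (t := t) (P ++ (List.range m).map (fun j => g (c - 1 - j)))
      (fun b => g (l + b)) c ((List.range l).reverse.map (fun b => g (c + b)) ++ Q)
      fun b hb => by rw [← add_assoc]; exact hR _ (by omega)
    have e1 : c - 1 - m = l := by omega
    have e2 : ∀ b, l + 1 + b = l + (b + 1) := fun b => by omega
    simp only [List.length_append, List.length_map, List.length_range] at h1
    simpa [e1, List.range_succ, e2, add_comm c l] using h1

/-- The colours of the copies of a strand. -/
def copies (c : ℕ) (o : Bool) (x : α) : List (α × ℕ) :=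
  if o then ((List.range c).map fun k => (x, k)).reverse else (List.range c).map fun k => (x, k)

lemma length_copies (c : ℕ) (o : Bool) (x : α) : (copies c o x).length = c := by
  cases o <;> simp [copies]

lemma copies_not (c : ℕ) (o : Bool) (x : α) : copies c (!o) x = (copies c o x).reverse := by
  cases o <;> simp [copies]

/-- The colours of the copies of all strands. -/
def blow (c : ℕ) : Bool → List α → List (α × ℕ)
  | _, [] => []
  | o, x :: M => copies c o x ++ blow c (!o) M

lemma length_blow (c : ℕ) (M : List α) : ∀ o, (blow c o M).length = c * M.length := by
  induction M with
  | nil => intro o; rfl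
  | cons x M ih => intro o; simp [blow, ih, length_copies]; ring

lemma blow_append (c : ℕ) (P : List α) : ∀ o, ∃ o', ∀ Q,
    blow c o (P ++ Q) = blow c o P ++ blow c o' Q := by
  induction P with
  | nil => intro o; exact ⟨o, fun Q => rfl⟩
  | cons x P ih =>
    intro o
    obtain ⟨o', h⟩ := ih (!o)
    exact ⟨o', fun Q => by simp [blow, h]⟩

/-- Cups and caps join neighbouring strands with nested copies, hence the order of the copies
alternates from strand to strand. Inserting or removing two strands keeps the order on the others.
-/
lemma blow_cons_cons (c : ℕ) (o : Bool) (x y : α) (Q : List α) :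
    blow c o (x :: y :: Q) = copies c o x ++ (copies c o y).reverse ++ blow c o Q := by
  simp [blow, copies_not]

/-- The order of the copies. -/
lemma exists_copies_eq (c : ℕ) (o : Bool) : ∃ ν : ℕ → ℕ,
    (∀ k l, k < c → l < c → k ≠ l → ν k ≠ ν l) ∧
    ∀ x : α, copies c o x = (List.range c).map fun k => (x, ν k) := by
  cases o
  · exact ⟨id, fun k l _ _ h => h, fun x => by simp [copies]⟩
  · exact ⟨fun k => c - 1 - k, fun k l _ _ _ => by dsimp only; omega, fun x => by
      simp [copies, map_range_sub fun k => (x, k)]⟩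

variable {R' : α × ℕ → α × ℕ → Prop}

/-- In either splitting of the grid, the arcs at each crossing are different copies of one arc or
the same copy of the two arcs at the original crossing. So separated colours stay separated. -/
lemma SRun.parallelSlice_cross (h1 : ∀ x k l, k ≠ l → R' (x, k) (x, l)) (c : ℕ) (o : Bool) (x y : α)
    (hR : ∀ k, R' (x, k) (y, k)) (P Q : List (α × ℕ)) (i : ℕ) (hP : P.length = c * i) :
    SRun R' t (parallelSlice c ⟨.cross t, i⟩) (P ++ (copies c o x ++ (copies c o y).reverse) ++ Q)
      (P ++ (copies c o x ++ (copies c o y).reverse) ++ Q) ∧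
    SRun R' t (parallelSlice c ⟨.cross !t, i⟩) (P ++ (copies c o x ++ (copies c o x).reverse) ++ Q)
      (P ++ (copies c o y ++ (copies c o y).reverse) ++ Q) := by
  obtain ⟨ν, hν, hc⟩ := exists_copies_eq (α := α) c o
  simp only [hc]
  constructor
  · refine SRun.verts _ _ fun g hg => ?_
    simp only [parallelSlice, List.mem_flatMap, List.mem_map, List.mem_reverse,
      List.mem_range] at hg
    obtain ⟨a, ha, b, hb, rfl⟩ := hg
    refine ⟨rfl, ?_⟩
    set M := P ++ ((List.range c).map (fun k => (x, ν k)) ++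
      ((List.range c).map (fun k => (y, ν k))).reverse) ++ Q with hM
    have hl : c * i + a + b + 2 ≤ M.length := by simp [hM, hP]; omega
    obtain ⟨P', z, z', Q', h3, h4⟩ := exists_append_cons_cons_of_lt hl
    refine ⟨P', z, z', Q', h3, h4, ?_⟩
    have g1 : M[c * i + a + b]? = some z := by rw [h3]; simp [h4]
    have g2 : M[c * i + a + b + 1]? = some z' := by rw [h3]; simp [h4]
    rw [hM, List.append_assoc, List.getElem?_append_right (by omega), hP] at g1 g2
    rw [List.getElem?_append_left (by simp; omega)] at g1 g2
    rw [← map_range_sub, List.getElem?_append] at g1 g2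
    simp only [List.length_map, List.length_range, List.getElem?_map] at g1 g2
    split_ifs at g1 g2
    · rw [List.getElem?_range (by omega)] at g1 g2
      simp only [Option.map_some, Option.some.injEq] at g1 g2
      rw [← g1, ← g2]
      exact h1 _ _ _ (hν _ _ (by omega) (by omega) (by omega))
    · rw [List.getElem?_range (by omega)] at g1 g2
      simp only [Option.map_some, Option.some.injEq] at g1 g2
      rw [← g1, ← g2, show c - 1 - (c * i + a + b + 1 - c * i - c) = c * i + a + b - c * i by omega]
      exact hR _
    · omega
    · rw [List.getElem?_range (by omega)] at g1 g2
      simp only [Option.map_some, Option.some.injEq] at g1 g2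
      rw [← g1, ← g2]
      exact h1 _ _ _ (hν _ _ (by omega) (by omega) (by omega))
  · have h3 := SRun.hookGrid (R := R') (t := t) P Q
      -- The copies of `x` form the caps and those of `y` the cups; the outermost ones, `l = c - 1`
      -- and `l = c`, both carry the index `ν 0`.
      (fun l => if l < c then (x, ν (c - 1 - l)) else (y, ν (l - c))) c (fun l hl => by
        split_ifs
        · exact h1 _ _ _ (hν _ _ (by omega) (by omega) (by omega))
        · rw [show c - 1 - l = l + 1 - c by omega]; exact hR _
        · omega
        · exact h1 _ _ _ (hν _ _ (by omega) (by omega) (by omega))) c 0 rfl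
    have e1 : (List.range c).map (fun j => if c - 1 - j < c then (x, ν (c - 1 - (c - 1 - j)))
        else (y, ν (c - 1 - j - c))) = (List.range c).map fun k => (x, ν k) := by
      refine List.map_congr_left fun k hk => ?_
      rw [List.mem_range] at hk
      rw [if_pos (by omega), show c - 1 - (c - 1 - k) = k by omega]
    have e2 : (List.range c).map (fun b => if 0 + b < c then (x, ν (c - 1 - (0 + b)))
        else (y, ν (0 + b - c))) = ((List.range c).map fun k => (x, ν k)).reverse := by
      rw [← map_range_sub]
      refine List.map_congr_left fun k hk => ?_
      rw [List.mem_range] at hk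
      rw [if_pos (by omega), zero_add]
    have e3 : ∀ L : List ℕ, L.map (fun b => if c + b < c then (x, ν (c - 1 - (c + b)))
        else (y, ν (c + b - c))) = L.map fun k => (y, ν k) := fun L => by
      refine List.map_congr_left fun k hk => ?_
      rw [if_neg (by omega), Nat.add_sub_cancel_left]
    rw [e1, e2, e3, e3, hP] at h3
    simpa [parallelSlice] using h3

lemma SRun.parallel (h1 : ∀ x k l, k ≠ l → R' (x, k) (x, l))
    (h2 : ∀ x y, R x y → ∀ k, R' (x, k) (y, k)) (c : ℕ) (o : Bool) {w : Word} {M M' : List α}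
    (h : SRun R t w M M') : SRun R' t (parallel c w) (blow c o M) (blow c o M') := by
  induction h with
  | nil M => exact .nil _
  | cup b x P Q M w _ ih =>
    obtain ⟨o', ho⟩ := blow_append c P o
    rw [ho, blow_cons_cons] at ih
    change SRun R' t (parallelSlice c _ ++ SlicedLink.parallel c w) _ _
    refine SRun.append ?_ ih
    rw [ho]
    have := SRun.cups (R := R') (t := t) b (blow c o P) (copies c o' x) (blow c o' Q)
    simpa [length_copies, length_blow, parallelSlice] using this
  | cap x P Q M w _ ih =>
    obtain ⟨o', ho⟩ := blow_append c P o
    rw [ho] at ih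
    change SRun R' t (parallelSlice c _ ++ SlicedLink.parallel c w) _ _
    refine SRun.append ?_ ih
    rw [ho, blow_cons_cons]
    have := SRun.caps (R := R') (t := t) (blow c o P) (copies c o' x) (blow c o' Q)
    simpa [length_copies, length_blow, parallelSlice] using this
  | vert x y P Q M w hR _ ih =>
    obtain ⟨o', ho⟩ := blow_append c P o
    rw [ho, blow_cons_cons, ← List.append_assoc] at ih ⊢
    exact SRun.append (SRun.parallelSlice_cross h1 c o' x y (h2 _ _ hR) _ _ _
      (length_blow c P o)).1 ih
  | hook x y P Q M w hR _ ih =>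
    obtain ⟨o', ho⟩ := blow_append c P o
    rw [ho, blow_cons_cons, ← List.append_assoc] at ih ⊢
    exact SRun.append (SRun.parallelSlice_cross h1 c o' x y (h2 _ _ hR) _ _ _
      (length_blow c P o)).2 ih

end Parallel

/-! ### Adequate diagrams -/

lemma ColRun.length_eq {α : Type*} {w : List Flat} {M M' : List α} (h : ColRun w M M') :
    ∀ {m}, Planar w M.length m → M'.length = m := by
  induction h with
  | nil M => intro m h; exact h
  | cup x P Q M w _ ih =>
    intro m h
    have := h.2
    refine ih ?_
    simp only [List.length_append, List.length_cons] at this ⊢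
    exact this
  | cap x P Q M w _ ih =>
    intro m h
    have := h.2
    refine ih ?_
    simp only [List.length_append, List.length_cons] at this ⊢
    exact this
  | swap => intro m h; exact h.elim

/-- There is a coloured run of a homogeneous state of a word that separates the arcs at a
crossing. -/
def SepAt (α : Type*) (t : Bool) (v : Word) (g : Slice) (w : Word) : Prop :=
  ∃ M M' : List α, SRun (fun _ _ => True) t v [] M ∧ SRun (· ≠ ·) t [g] M M' ∧
    SRun (fun _ _ => True) t w M' []

section
variable {α : Type*} {t : Bool} {v w : Word} {i m : ℕ}

/-- Two colours suffice: all colours other than `x` are identified. -/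
lemma SepAt.sepVert (h : SepAt α t v ⟨.cross t, i⟩ w) :
    SepVert (smoothing t v) (smoothing t w) i := by
  classical
  obtain ⟨M, M', h1, h2, h3⟩ := h
  generalize hg : (Piece.cross t) = g at h2
  cases h2 with
  | cup => cases hg
  | cap => cases hg
  | hook => simp at hg
  | vert x y P Q _ _ hR h2 =>
    cases h2
    have e1 := h1.colRun.map fun z => decide (z = x)
    have e3 := h3.colRun.map fun z => decide (z = x)
    simp only [List.map_append, List.map_cons, List.map_nil] at e1 e3
    exact ⟨_, _, _, _, by simp, by simpa using Ne.symm hR, e1, e3⟩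

lemma SepAt.sepHook (h : SepAt α t v ⟨.cross !t, i⟩ w) :
    SepHook (smoothing t v) (smoothing t w) i := by
  classical
  obtain ⟨M, M', h1, h2, h3⟩ := h
  generalize hg : (Piece.cross !t) = g at h2
  cases h2 with
  | cup => cases hg
  | cap => cases hg
  | vert => simp at hg
  | hook x y P Q _ _ hR h2 =>
    cases h2
    have e1 := h1.colRun.map fun z => decide (z = x)
    have e3 := h3.colRun.map fun z => decide (z = x)
    simp only [List.map_append, List.map_cons, List.map_nil] at e1 e3
    exact ⟨_, _, _, _, by simp, by simpa using Ne.symm hR, e1, e3⟩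

lemma SepVert.sepAt (hv : Fits v 0 m) (hw : Fits w m 0)
    (h : SepVert (smoothing t v) (smoothing t w) i) : SepAt Bool t v ⟨.cross t, i⟩ w := by
  obtain ⟨P, x, y, Q, rfl, hxy, h1, h2⟩ := h
  have hl := h1.length_eq (planar_smoothing t hv)
  exact ⟨_, _, .of_colRun v hv h1, .vert x y P Q _ _ hxy (.nil _),
    .of_colRun w (hl ▸ hw) h2⟩

lemma SepHook.sepAt (hv : Fits v 0 m) (hw : Fits w m 0)
    (h : SepHook (smoothing t v) (smoothing t w) i) : SepAt Bool t v ⟨.cross !t, i⟩ w := by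
  obtain ⟨P, x, y, Q, rfl, hxy, h1, h2⟩ := h
  have hl := h1.length_eq (planar_smoothing t hv)
  refine ⟨_, _, .of_colRun v hv h1, .hook x y P Q _ _ hxy (.nil _),
    .of_colRun w (m := 0) ?_ h2⟩
  simp only [List.length_append, List.length_cons] at hl ⊢
  exact hl ▸ hw

/-- A splitting of a crossing. -/
def splitting (b a : Bool) (i : ℕ) : List Flat := if b = a then [] else [.cap i, .cup i]

/-- In every state, changing one splitting changes the number of circuits by exactly one. -/
lemma circuits_splitting_le {v w : List Flat} (hv : Planar v 0 m) (hw : Planar w m 0)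
    (hi : i + 2 ≤ m) (a b : Bool) :
    circuits (v ++ splitting b a i ++ w) ≤ circuits (v ++ splitting (!b) a i ++ w) + 1 := by
  have := circuits_hook hv hw hi
  cases a <;> cases b <;> simp [splitting] at this ⊢ <;> omega

lemma SepAt.circuits_splitting (hv : Fits v 0 m) (hw : Fits w m 0) (hi : i + 2 ≤ m) {a : Bool}
    (h : SepAt α t v ⟨.cross a, i⟩ w) :
    circuits (smoothing t v ++ splitting (!t) a i ++ smoothing t w) + 1 =
      circuits (smoothing t v ++ splitting t a i ++ smoothing t w) := by
  have h1 := circuits_hook (planar_smoothing t hv) (planar_smoothing t hw) hi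
  by_cases hta : a = t
  · subst hta
    have h2 := h.sepVert
    simp only [splitting, Bool.not_eq_self, if_true, if_false, List.append_nil]
    rcases h1 with h1 | h1
    · exact h1.1.symm
    · exact (h1.2.2 h2).elim
  · obtain rfl : a = !t := by revert hta; cases a <;> cases t <;> simp
    have h2 := h.sepHook
    simp only [splitting, Bool.eq_not_self, if_true, if_false, List.append_nil]
    rcases h1 with h1 | h1
    · exact (h1.2.2 h2).elim
    · exact h1.1.symm

lemma sepAt_of_circuits_lt (hv : Fits v 0 m) (hw : Fits w m 0) (hi : i + 2 ≤ m) {a : Bool}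
    (h : circuits (smoothing t v ++ splitting (!t) a i ++ smoothing t w) <
      circuits (smoothing t v ++ splitting t a i ++ smoothing t w)) :
    SepAt Bool t v ⟨.cross a, i⟩ w := by
  have h1 := circuits_hook (planar_smoothing t hv) (planar_smoothing t hw) hi
  by_cases hta : a = t
  · subst hta
    simp only [splitting, Bool.not_eq_self, if_true, if_false, List.append_nil] at h
    rcases h1 with h1 | h1
    · exact h1.2.1.sepAt hv hw
    · omega
  · obtain rfl : a = !t := by revert hta; cases a <;> cases t <;> simp
    simp only [splitting, Bool.eq_not_self, if_true, if_false, List.append_nil] at h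
    rcases h1 with h1 | h1
    · omega
    · exact h1.2.1.sepAt hv hw

end

/-- At every crossing the arcs of the homogeneous state can be separated. -/
def Separated (α : Type*) (t : Bool) (W : Word) : Prop :=
  ∀ v a i w, W = v ++ ⟨.cross a, i⟩ :: w → SepAt α t v ⟨.cross a, i⟩ w

lemma smoothing_cross (t a : Bool) (v w : Word) (i : ℕ) :
    smoothing t (v ++ ⟨.cross a, i⟩ :: w) = smoothing t v ++ splitting t a i ++ smoothing t w := by
  rw [smoothing_append, List.append_assoc]; rfl

lemma resolve_cross (a b : Bool) (v w : Word) (i : ℕ) {l l' : List Bool}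
    (hl : l.length = crossings v) :
    resolve (v ++ ⟨.cross a, i⟩ :: w) (l ++ b :: l') =
      resolve v l ++ splitting b a i ++ resolve w l' := by
  rw [resolve_append _ _ _ _ hl, List.append_assoc]; rfl

lemma fits_cross {v w : Word} {a : Bool} {i : ℕ} (h : Fits (v ++ ⟨.cross a, i⟩ :: w) 0 0) :
    ∃ m, Fits v 0 m ∧ Fits w m 0 ∧ i + 2 ≤ m := by
  obtain ⟨m, h1, h2⟩ := (fits_append _ _ _ _).1 h
  exact ⟨m, h1, h2.2, h2.1⟩

lemma separated_of_circuits_lt {t : Bool} {W : Word} (hW : Fits W 0 0)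
    (h : ∀ l : List Bool, l.length = crossings W → l.count (!t) = 1 →
      circuits (resolve W l) < circuits (smoothing t W)) : Separated Bool t W := by
  rintro v a i w rfl
  obtain ⟨m, h1, h2, h3⟩ := fits_cross hW
  refine sepAt_of_circuits_lt h1 h2 h3 ?_
  have := h (List.replicate (crossings v) t ++ (!t) :: List.replicate (crossings w) t)
    (by simp [crossings_append, crossings_cons_cross]) (by simp [List.count_replicate])
  rwa [resolve_cross _ _ _ _ _ (by simp), resolve_replicate, resolve_replicate,
    smoothing_cross] at this

lemma exists_of_flatMap_eq {α β : Type*} (f : α → List β) (D : List α) : ∀ {V W : List β} {g : β},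
    D.flatMap f = V ++ g :: W → ∃ v s w V' W', D = v ++ s :: w ∧ f s = V' ++ g :: W' ∧
      V = v.flatMap f ++ V' ∧ W = W' ++ w.flatMap f := by
  induction D with
  | nil => intro V W g h; simp at h
  | cons s D ih =>
    intro V W g h
    rw [List.flatMap_cons] at h
    rcases List.append_eq_append_iff.1 h with ⟨A, h1, h2⟩ | ⟨A, h1, h2⟩
    · obtain ⟨v, s', w, V', W', rfl, h3, h4, h5⟩ := ih h2
      exact ⟨s :: v, s', w, V', W', rfl, h3, by simp [h1, h4], h5⟩
    · rcases A with _ | ⟨g', A⟩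
      · obtain ⟨v, s', w, V', W', rfl, h3, h4, h5⟩ := ih (V := []) (by simpa using h2.symm)
        exact ⟨s :: v, s', w, V', W', rfl, h3, by
          rw [List.flatMap_cons, List.append_assoc, ← h4, List.append_nil, h1, List.append_nil], h5⟩
      · rw [List.cons_append, List.cons.injEq] at h2
        obtain ⟨rfl, rfl⟩ := h2
        exact ⟨[], s, D, V, A, rfl, h1, by simp, rfl⟩

/-- A crossing of the parallel lies in the grid of a crossing of `W`. The colouring that separates
the latter, refined by the index of the copy, separates all crossings of this grid at once; no
condition is imposed elsewhere. -/
lemma Separated.parallel {α : Type*} {t : Bool} {W : Word} (h : Separated α t W) (c : ℕ) :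
    Separated (α × ℕ) t (parallel c W) := by
  intro V a i W₀ hW
  obtain ⟨v, ⟨p, j⟩, w, V', W', rfl, h1, rfl, rfl⟩ := exists_of_flatMap_eq _ W hW
  rcases p with b | _ | s
  · have : (⟨.cross a, i⟩ : Slice) ∈ parallelSlice c ⟨.cup b, j⟩ := by rw [h1]; simp
    simp [parallelSlice] at this
  · have : (⟨.cross a, i⟩ : Slice) ∈ parallelSlice c ⟨.cap, j⟩ := by rw [h1]; simp
    simp [parallelSlice] at this
  · obtain ⟨M, M', e1, e2, e3⟩ := h v s j w rfl
    have f1 := SRun.parallel (R' := fun _ _ => True) (by simp) (by simp) c false e1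
    have f2 := SRun.parallel (R' := (· ≠ ·)) (by simp) (by simp) c false e2
    have f3 := SRun.parallel (R' := fun _ _ => True) (by simp) (by simp) c false e3
    have h2 : SlicedLink.parallel c [⟨.cross s, j⟩] = V' ++ ⟨.cross a, i⟩ :: W' := by
      rw [← h1]; simp [SlicedLink.parallel]
    rw [h2] at f2
    obtain ⟨N, g1, g2⟩ := f2.exists_of_append
    rw [← List.singleton_append] at g2
    obtain ⟨N', g2, g3⟩ := g2.exists_of_append
    exact ⟨N, N', f1.append (g1.mono fun _ _ _ => trivial), g2,
      (g3.mono fun _ _ _ => trivial).append f3⟩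

lemma exists_of_length_eq_crossings (W : Word) : ∀ {l l' : List Bool} {b : Bool},
    (l ++ b :: l').length = crossings W → ∃ v a i w, W = v ++ ⟨.cross a, i⟩ :: w ∧
      l.length = crossings v ∧ l'.length = crossings w := by
  induction W with
  | nil => intro l l' b h; simp [crossings] at h
  | cons g W ih =>
    intro l l' b h
    have key : g.piece.isCross = false → ∃ v a i w, g :: W = v ++ ⟨.cross a, i⟩ :: w ∧
        l.length = crossings v ∧ l'.length = crossings w := by
      intro hg
      obtain ⟨v, a, i, w, rfl, h1, h2⟩ := ih (l := l) (l' := l') (b := b)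
        (by simpa [crossings, hg] using h)
      exact ⟨g :: v, a, i, w, rfl, by simpa [crossings, hg] using h1, h2⟩
    rcases g with ⟨_ | _ | a, i⟩
    · exact key rfl
    · exact key rfl
    · rw [crossings_cons_cross] at h
      rcases l with _ | ⟨b', l⟩
      · exact ⟨[], a, i, W, rfl, rfl, by simpa using h⟩
      · obtain ⟨v, a', i', w, rfl, h1, h2⟩ := ih (l := l) (l' := l') (b := b)
          (by simpa using h)
        exact ⟨_ :: v, a', i', w, rfl, by rw [crossings_cons_cross, ← h1]; rfl, h2⟩

/-- Changing `k + 1` splittings of a separated homogeneous state. -/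
lemma Separated.circuits_le {α : Type*} {t : Bool} {W : Word} (h : Separated α t W)
    (hW : Fits W 0 0) (k : ℕ) : ∀ l : List Bool, l.length = crossings W → l.count (!t) = k + 1 →
      circuits (resolve W l) + 1 ≤ circuits (smoothing t W) + k := by
  induction k with
  | zero =>
    intro l hl hk
    obtain ⟨l₁, l₂, rfl⟩ := List.append_of_mem (List.count_pos_iff.1 (by omega : 0 < l.count (!t)))
    have h0 : ∀ l : List Bool, l.count (!t) = 0 → l = List.replicate l.length t := fun l hl => by
      rw [List.eq_replicate_iff]
      refine ⟨rfl, fun b hb => ?_⟩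
      have := List.count_eq_zero.1 hl
      by_contra hbt
      exact this (by rwa [show (!t) = b by revert hbt; cases b <;> cases t <;> simp])
    simp only [List.count_append, List.count_cons_self] at hk
    obtain ⟨v, a, i, w, rfl, h1, h2⟩ := exists_of_length_eq_crossings W hl
    obtain ⟨m, e1, e2, e3⟩ := fits_cross hW
    -- The first change of a splitting loses a circuit, since its arcs are separated.
    rw [resolve_cross _ _ _ _ _ h1, h0 l₁ (by omega), h0 l₂ (by omega), h1, h2,
      resolve_replicate, resolve_replicate, smoothing_cross,
      (h v a i w rfl).circuits_splitting e1 e2 e3]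
    rfl
  | succ k ih =>
    intro l hl hk
    obtain ⟨l₁, l₂, rfl⟩ := List.append_of_mem (List.count_pos_iff.1 (by omega : 0 < l.count (!t)))
    -- One of the changed splittings is changed back; it gains at most one circuit.
    have h3 := ih (l₁ ++ t :: l₂) (by simpa using hl) (by
      simp only [List.count_append, List.count_cons] at hk ⊢
      cases t <;> simp at hk ⊢ <;> omega)
    obtain ⟨v, a, i, w, rfl, h1, h2⟩ := exists_of_length_eq_crossings W hl
    obtain ⟨m, e1, e2, e3⟩ := fits_cross hW
    rw [resolve_cross _ _ _ _ _ h1] at h3 ⊢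
    have := circuits_splitting_le (planar_resolve v l₁ _ _ e1 h1) (planar_resolve w l₂ _ _ e2 h2)
      e3 a (!t)
    rw [Bool.not_not] at this
    omega

lemma pmSum_eq (l : List Bool) (t : Bool) :
    pmSum l = (if t then 1 else -1) * ((l.length : ℤ) - 2 * l.count (!t)) := by
  induction l with
  | nil => simp [pmSum]
  | cons b l ih =>
    have : pmSum (b :: l) = (if b then 1 else -1) + pmSum l := by simp [pmSum]
    rw [this, ih, List.count_cons, List.length_cons]
    cases b <;> cases t <;> simp <;> ring

lemma exists_ofFn_eq {N : ℕ} (l : List Bool) (h : l.length = N) :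
    ∃ s : Fin N → Bool, List.ofFn s = l := by
  subst h
  exact ⟨l.get, List.ofFn_get l⟩

lemma stateCircuits_const (w : Word) (t : Bool) :
    stateCircuits w (fun _ => t) = circuits (smoothing t w) := by
  rw [stateCircuits, List.ofFn_const, resolve_replicate]

lemma Adequate.separated {W : Word} (h : Adequate W) (hW : Fits W 0 0) (t : Bool) :
    Separated Bool t W := by
  refine separated_of_circuits_lt hW fun l hl hc => ?_
  obtain ⟨s, rfl⟩ := exists_ofFn_eq l hl
  have hs := stateSum_eq W s
  rw [pmSum_eq _ t, hl, hc] at hs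
  rw [← stateCircuits_const]
  cases t
  · exact h.2.2 s (by rw [hs]; simp; ring)
  · exact h.2.1 s (by rw [hs]; simp)

/-! ### Circuits of parallels -/

namespace TL
variable {k 𝒜 : Type*} [Field k] [Ring 𝒜] [Algebra k 𝒜] {δ : k} (t : TL k 𝒜 δ)

lemma prod_e (n p : ℕ) :
    ((List.range (n + 1)).map fun b => t.e (p + b)).prod = t.c p * t.u (p + n) := by
  induction n with
  | zero => simp [e]
  | succ n ih =>
    rw [List.range_succ, List.map_append, List.prod_append, ih]
    simp [mul_assoc, ← add_assoc, u_mul_e_succ]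

/-- Each further row of hooks adds one cap and one cup to the nests. The full grid is therefore the
`c`-parallel of a single hook. -/
lemma prod_e_grid (c p : ℕ) : ∀ m ≤ c,
    ((List.range m).reverse.map fun a => ((List.range c).map fun b => t.e (p + a + b)).prod).prod =
      t.C m p * t.U m (p + c - m) := by
  intro m
  induction m with
  | zero => simp [C, U]
  | succ m ih =>
    intro hm
    obtain ⟨c, rfl⟩ : ∃ c', c = c' + 1 := ⟨c - 1, by omega⟩
    rw [List.range_succ (n := m), List.reverse_append, List.map_append, List.prod_append,
      ih (by omega)]
    simp only [List.reverse_singleton, List.map_singleton, List.prod_singleton]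
    have h := (rp_C (t := t) m p (p + c - m) (by omega) 0).1
    rw [add_zero, add_zero, show p + c - m + 2 * m = p + m + c by omega] at h
    rw [prod_e, C_cons, U, mul_assoc, ← mul_assoc (t.u _), h, mul_assoc, mul_assoc]
    congr 4 <;> omega

lemma evF_smoothing_parallel (c : ℕ) (s : Bool) (w : Word) :
    t.evF (smoothing s (parallel c w)) = (t.cable c).evF (smoothing s w) := by
  induction w with
  | nil => rfl
  | cons g w ih =>
    change t.evF (smoothing s (parallelSlice c g ++ parallel c w)) = _
    rw [smoothing_append, evF_append, ih]
    rcases g with ⟨b | _ | a, i⟩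
    · rw [smoothing, evF_cons]
      congr 1
      change _ = t.U c (c * i)
      rw [U_eq_prod]
      simp only [parallelSlice]
      induction List.range c with
      | nil => rfl
      | cons x L ih => rw [List.map_cons, smoothing, evF_cons, ih]; rfl
    · rw [smoothing, evF_cons]
      congr 1
      change _ = t.C c (c * i)
      rw [C_eq_prod]
      simp only [parallelSlice]
      induction (List.range c).reverse with
      | nil => rfl
      | cons x L ih => rw [List.map_cons, smoothing, evF_cons, ih]; rfl
    · rw [smoothing, evF_append]
      congr 1
      by_cases hsa : s = a
      · subst hsa
        rw [if_pos rfl, evF_nil]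
        have : ∀ v : Word, (∀ g ∈ v, g.piece = .cross s) → smoothing s v = [] := by
          intro v hv
          induction v with
          | nil => rfl
          | cons g v ih =>
            obtain ⟨p, j⟩ := g
            obtain rfl : p = .cross s := hv ⟨p, j⟩ (by simp)
            simp [smoothing, ih fun g hg => hv g (by simp [hg])]
        rw [this, evF_nil]
        intro g hg
        simp only [parallelSlice, List.mem_flatMap, List.mem_map] at hg
        obtain ⟨_, _, _, _, rfl⟩ := hg
        rfl
      · rw [if_neg hsa]
        have h1 := t.prod_e_grid c (c * i) c le_rfl
        rw [Nat.add_sub_cancel] at h1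
        have h2 : (t.cable c).evF [.cap i, .cup i] = t.C c (c * i) * t.U c (c * i) := by
          simp [evF, flat, cable]
        rw [h2, ← h1]
        simp only [parallelSlice]
        induction (List.range c).reverse with
        | nil => rfl
        | cons x L ih =>
          rw [List.flatMap_cons, smoothing_append, evF_append, ih, List.map_cons, List.prod_cons]
          congr 1
          induction List.range c with
          | nil => rfl
          | cons y L ih =>
            rw [List.map_cons, smoothing, if_neg hsa, evF_append, ih, List.map_cons,
              List.prod_cons]
            simp [evF, flat, e]

end TL

/-- The value of the state in `bits`, with loop value `2`, is its value in the cabled system, with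
loop value `2 ^ c`; the exponents of `2` are compared. -/
lemma circuits_smoothing_parallel (c : ℕ) (t : Bool) {w : Word} (hw : Fits w 0 0) :
    circuits (smoothing t (parallel c w)) = c * circuits (smoothing t w) := by
  have h1 := (TL.bits.evF_eq_pow _ (planar_smoothing t (fits_parallel c w 0 0 hw))).1
  have h2 := ((TL.bits.cable c).evF_eq_pow _ (planar_smoothing t hw)).1
  rw [← TL.evF_smoothing_parallel, h1, ← pow_mul] at h2
  have h3 := FaithfulSMul.algebraMap_injective ℚ (Module.End ℚ ((ℕ → Bool) → ℚ)) h2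
  exact pow_right_injective₀ (by norm_num) (by norm_num) h3

lemma crossings_parallel (c : ℕ) (w : Word) : crossings (parallel c w) = c ^ 2 * crossings w := by
  induction w with
  | nil => rfl
  | cons g w ih =>
    change crossings (parallelSlice c g ++ parallel c w) = _
    rw [crossings_append, ih]
    rcases g with ⟨b | _ | a, i⟩
    · have : crossings (parallelSlice c ⟨.cup b, i⟩) = 0 := by
        simp [crossings, parallelSlice, List.countP_map, Piece.isCross]
      rw [this, zero_add]; rfl
    · have : crossings (parallelSlice c ⟨.cap, i⟩) = 0 := by
        simp [crossings, parallelSlice, List.countP_map, Piece.isCross]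
      rw [this, zero_add]; rfl
    · have : crossings (parallelSlice c ⟨.cross a, i⟩) = c * c := by
        simp [crossings, parallelSlice, List.countP_flatMap, List.countP_map, Piece.isCross,
          Function.comp_def]
      rw [this, crossings_cons_cross]; ring


/-! ### Extreme coefficients -/

section Extreme
open LaurentPolynomial

/-- For `ε = 1`, the exponents are at most `M`, and the coefficient there is `z`; for `ε = -1` the
exponents are at least `-M`, and the coefficient there is `z`. -/
def Extreme (ε : ℤ) (p : LaurentPolynomial ℤ) (M z : ℤ) : Prop :=
  (∀ k, M < ε * k → p.coeff k = 0) ∧ p.coeff (ε * M) = z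

lemma coeff_T_mul (n k : ℤ) (p : LaurentPolynomial ℤ) : (T n * p).coeff k = p.coeff (k - n) := by
  have := AddMonoidAlgebra.coeff_single_mul_add p (1 : ℤ) n (k - n)
  rwa [add_sub_cancel, one_mul] at this

namespace Extreme
variable {ε : ℤ} {p q : LaurentPolynomial ℤ} {M M' z z' : ℤ}

lemma add (hp : Extreme ε p M z) (hq : Extreme ε q M z') : Extreme ε (p + q) M (z + z') :=
  ⟨fun k hk => by rw [AddMonoidAlgebra.coeff_add, Finsupp.add_apply, hp.1 k hk, hq.1 k hk, add_zero],
    by rw [AddMonoidAlgebra.coeff_add, Finsupp.add_apply, hp.2, hq.2]⟩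

lemma zero : Extreme ε 0 M 0 := ⟨fun _ _ => rfl, rfl⟩

lemma smul (a : ℤ) (hp : Extreme ε p M z) : Extreme ε (a • p) M (a * z) :=
  ⟨fun k hk => by rw [AddMonoidAlgebra.coeff_smul_apply, hp.1 k hk, smul_zero],
    by rw [AddMonoidAlgebra.coeff_smul_apply, hp.2, smul_eq_mul]⟩

lemma sum {ι : Type*} (s : Finset ι) {p : ι → LaurentPolynomial ℤ} {z : ι → ℤ}
    (h : ∀ i ∈ s, Extreme ε (p i) M (z i)) : Extreme ε (∑ i ∈ s, p i) M (∑ i ∈ s, z i) := by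
  classical
  induction s using Finset.induction_on with
  | empty => exact zero
  | insert i s hi ih =>
    rw [Finset.sum_insert hi, Finset.sum_insert hi]
    exact (h i (by simp)).add (ih fun j hj => h j (by simp [hj]))

variable (hε : ε * ε = 1)
include hε

lemma of_lt (hp : Extreme ε p M z) (h : M < M') : Extreme ε p M' 0 :=
  ⟨fun k hk => hp.1 k (by omega), hp.1 _ (by rwa [← mul_assoc, hε, one_mul])⟩

lemma T_mul (n : ℤ) (hp : Extreme ε p M z) : Extreme ε (T n * p) (M + ε * n) z :=
  ⟨fun k hk => by rw [coeff_T_mul]; exact hp.1 _ (by rw [mul_sub]; omega), by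
    rw [coeff_T_mul, mul_add, ← mul_assoc, hε, one_mul, add_sub_cancel_right, hp.2]⟩

lemma loopValue_mul (hp : Extreme ε p M z) : Extreme ε (loopValue * p) (M + 2) (-z) := by
  rw [show loopValue * p = (-1 : ℤ) • (T (2 * ε) * p) + (-1 : ℤ) • (T (-2 * ε) * p) by
    rcases mul_self_eq_one_iff.1 hε with rfl | rfl <;> simp [loopValue] <;> ring]
  have h1 := (hp.T_mul hε (2 * ε)).smul (-1)
  have h2 := ((hp.T_mul hε (-2 * ε)).of_lt (M' := M + 2) hε (by linarith)).smul (-1)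
  rw [show M + ε * (2 * ε) = M + 2 by linear_combination 2 * hε] at h1
  simpa using h1.add h2

lemma loopValue_pow (s : ℕ) : Extreme ε (loopValue ^ s) (2 * s) ((-1) ^ s) := by
  induction s with
  | zero =>
    refine ⟨fun k hk => ?_, ?_⟩
    · rw [pow_zero, ← T_zero, T_apply, if_neg]
      rintro rfl; simp at hk
    · rw [pow_zero, ← T_zero, T_apply]; simp
  | succ s ih =>
    have := ih.loopValue_mul hε
    rw [← pow_succ'] at this
    convert this using 1
    · push_cast; ring
    · ring

lemma eq_of_ne_zero (hp : Extreme ε p M z) (hp' : Extreme ε p M' z') (hz : z ≠ 0) (hz' : z' ≠ 0) :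
    M = M' ∧ z = z' := by
  rcases lt_trichotomy M M' with h | rfl | h
  · exact (hz' (hp'.2.symm.trans (hp.of_lt hε h).2)).elim
  · exact ⟨rfl, hp.2.symm.trans hp'.2⟩
  · exact (hz (hp.2.symm.trans (hp'.of_lt hε h).2)).elim

lemma exists_of_ne_zero (h : p ≠ 0) : ∃ M z, z ≠ 0 ∧ Extreme ε p M z := by
  have hs : p.coeff.support.Nonempty := by
    rw [Finsupp.support_nonempty_iff]
    intro h0
    exact h (AddMonoidAlgebra.coeff_injective h0)
  obtain ⟨k, hk, hmax⟩ := p.coeff.support.exists_max_image (fun k => ε * k) hs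
  refine ⟨ε * k, p.coeff k, Finsupp.mem_support_iff.1 hk, fun l hl => ?_, ?_⟩
  · by_contra h0
    have := hmax l (Finsupp.mem_support_iff.2 h0)
    omega
  · rw [← mul_assoc, hε, one_mul]

/-- The quotient has some extreme coefficient. Multiplying it by the loop value and using uniqueness
identifies it. -/
lemma of_loopValue_mul (hz : z ≠ 0) (hp : Extreme ε (loopValue * p) M z) :
    Extreme ε p (M - 2) (-z) := by
  have h : p ≠ 0 := by
    rintro rfl
    rw [mul_zero] at hp
    exact hz hp.2.symm
  obtain ⟨M', z', hz', h'⟩ := exists_of_ne_zero hε h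
  obtain ⟨rfl, rfl⟩ := hp.eq_of_ne_zero hε (h'.loopValue_mul hε) hz (neg_ne_zero.2 hz')
  simpa using h'

omit hε in
/-- Summands whose extreme coefficients have the same sign do not cancel. -/
lemma exists_sum (hε : ε * ε = 1) {ι : Type*} (s : Finset ι) {p : ι → LaurentPolynomial ℤ} {M a : ι → ℤ} {σ : ℤ}
    (hσ : σ ≠ 0) (ha : ∀ i ∈ s, 0 < a i) (h : ∀ i ∈ s, Extreme ε (p i) (M i) (σ * a i)) {i₀ : ι}
    (hi₀ : i₀ ∈ s) : ∃ M' z, M i₀ ≤ M' ∧ z ≠ 0 ∧ Extreme ε (∑ i ∈ s, p i) M' z := by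
  classical
  obtain ⟨j, hj, hmax⟩ := s.exists_max_image M ⟨i₀, hi₀⟩
  refine ⟨M j, _, hmax i₀ hi₀, ?_, sum s (z := fun i => σ * if M i = M j then a i else 0)
    fun i hi => ?_⟩
  · rw [← Finset.mul_sum]
    refine mul_ne_zero hσ (ne_of_gt ?_)
    refine Finset.sum_pos' (fun i hi => ?_) ⟨j, hj, by simpa using ha j hj⟩
    split_ifs
    · exact (ha i hi).le
    · exact le_rfl
  · split_ifs with hij
    · rw [← hij]; exact h i hi
    · rw [mul_zero]
      exact (h i hi).of_lt hε (lt_of_le_of_ne (hmax i hi) hij)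

end Extreme

/-- The sign that belongs to a splitting. -/
def splitSign (t : Bool) : ℤ := if t then 1 else -1

lemma splitSign_mul_self (t : Bool) : splitSign t * splitSign t = 1 := by cases t <;> rfl

/-- The extreme coefficients of the bracket of a separated diagram. -/
lemma Separated.extreme_fullBracket {α : Type*} {t : Bool} {W : Word} (h : Separated α t W)
    (hW : Fits W 0 0) : Extreme (splitSign t) (fullBracket W)
      (crossings W + 2 * circuits (smoothing t W)) ((-1) ^ circuits (smoothing t W)) := by
  have hε := splitSign_mul_self t
  rw [fullBracket_eq_sum, show ((-1) ^ circuits (smoothing t W) : ℤ) = ∑ s : State W,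
    if s = (fun _ => t) then (-1) ^ circuits (smoothing t W) else 0 by simp]
  refine Extreme.sum _ fun s _ => ?_
  have h1 := (Extreme.loopValue_pow hε (stateCircuits W s)).T_mul hε (stateSum W s)
  rw [stateSum_eq, pmSum_eq _ t, ← mul_assoc] at h1
  change Extreme _ _ (_ + splitSign t * splitSign t * _) _ at h1
  rw [hε, one_mul, List.length_ofFn] at h1
  split_ifs with hs
  · subst hs
    rw [stateCircuits_const] at h1 ⊢
    rw [stateSum_eq, pmSum_eq _ t, List.length_ofFn]
    simpa [List.ofFn_const, List.count_replicate, add_comm] using h1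
  · rw [stateSum_eq, pmSum_eq _ t, List.length_ofFn]
    refine h1.of_lt hε ?_
    obtain ⟨k, hk⟩ : ∃ k, (List.ofFn s).count (!t) = k + 1 := by
      refine Nat.exists_eq_add_one.2 (List.count_pos_iff.2 ?_)
      by_contra hn
      refine hs (funext fun c => ?_)
      have : s c ≠ !t := fun hc => hn (by rw [List.mem_ofFn]; exact ⟨c, hc⟩)
      revert this
      cases s c <;> cases t <;> simp
    -- `k + 1` changed splittings lower the signed state sum by `2 (k + 1)` and raise twice the
    -- number of circuits by at most `2 (k - 1)`, so this summand stays below the extreme exponent.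
    have h2 := h.circuits_le hW k (List.ofFn s) (by simp) hk
    rw [hk]
    change stateCircuits W s + 1 ≤ _ at h2
    push_cast
    omega

/-! ### Extreme terms and breadth for parallels and cables of knots. -/

variable {D : KnotDiagram}

lemma KnotDiagram.fits (D : KnotDiagram) : Fits D.1 0 0 := fits_of_run D.2.1

lemma extreme_parallel (hD : Adequate D.1) (t : Bool) (c : ℕ) :
    Extreme (splitSign t) (fullBracket (parallel c D.1))
      (c ^ 2 * crossings D.1 + 2 * c * circuits (smoothing t D.1))
      ((-1) ^ (c * circuits (smoothing t D.1))) := by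
  have := ((hD.separated D.fits t).parallel c).extreme_fullBracket (fits_parallel c _ 0 0 D.fits)
  rw [crossings_parallel, circuits_smoothing_parallel c t D.fits] at this
  convert this using 1
  push_cast; ring

/-- The smaller colours subtracted from the parallel end strictly earlier, because the diagram has
at least one crossing. So the coloured bracket inherits the extreme term of the parallel. -/
lemma extreme_coloredBracket (hD : Adequate D.1) (t : Bool) (c : ℕ) :
    Extreme (splitSign t) (coloredBracket D.1 c)
      (c ^ 2 * crossings D.1 + 2 * c * circuits (smoothing t D.1))
      ((-1) ^ (c * circuits (smoothing t D.1))) := by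
  induction c using Nat.strong_induction_on with
  | _ c ih =>
  have hε := splitSign_mul_self t
  rw [coloredBracket, sub_eq_add_neg, ← neg_one_smul ℤ]
  have h1 : Extreme (splitSign t) (∑ d : Fin c, (twistCoeff c 0 (d + 1) : LaurentPolynomial ℤ) *
      coloredBracket D.1 (c - 2 * (d + 1)))
      (c ^ 2 * crossings D.1 + 2 * c * circuits (smoothing t D.1)) (∑ d : Fin c, 0) := by
    refine Extreme.sum _ fun d _ => ?_
    rw [← nsmul_eq_mul, ← natCast_zsmul]
    have hd := d.2
    have hj : c - 2 * (d + 1 : ℕ) < c := by omega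
    have h2 : Extreme (splitSign t) (coloredBracket D.1 (c - 2 * (d + 1)))
        (c ^ 2 * crossings D.1 + 2 * c * circuits (smoothing t D.1)) 0 := by
      refine (ih _ hj).of_lt hε ?_
      generalize c - 2 * (d.1 + 1) = j at hj
      have hn : 1 ≤ crossings D.1 := hD.1
      have e1 : (j : ℤ) < c := by exact_mod_cast hj
      have e2 : (1 : ℤ) ≤ crossings D.1 := by exact_mod_cast hn
      have e3 : (0 : ℤ) ≤ j := by positivity
      have e4 : (j : ℤ) ^ 2 < c ^ 2 := by gcongr
      have e5 : (0 : ℤ) ≤ circuits (smoothing t D.1) := by positivity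
      have e6 : (j : ℤ) ^ 2 * crossings D.1 < c ^ 2 * crossings D.1 :=
        mul_lt_mul_of_pos_right e4 (by omega)
      have e7 : 2 * (j : ℤ) * circuits (smoothing t D.1) ≤ 2 * c * circuits (smoothing t D.1) := by
        gcongr
      omega
    simpa using h2.smul (twistCoeff c 0 (d + 1))
  simpa using (extreme_parallel hD t c).add (h1.smul (-1))

/-- The extreme coefficients of the bracket of the cable of an arbitrary diagram. -/
lemma extreme_cable {K : Knot} {E : KnotDiagram} (hD : IsDiagramOf D K) (hE : IsDiagramOf E K)
    (hadq : Adequate D.1) (t : Bool) (r : ℕ) : ∃ M z, z ≠ 0 ∧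
      r ^ 2 * crossings D.1 + 2 * r * circuits (smoothing t D.1) +
        splitSign t * (3 * r * writhe E.1 - writhe D.1 * (r ^ 2 + 2 * r)) ≤ M ∧
      Extreme (splitSign t) (fullBracket (cable r E.1)) M z := by
  classical
  have hε := splitSign_mul_self t
  rw [fullBracket_cable, ← Finset.sum_filter_of_ne (p := fun d => twistCoeff r 0 d ≠ 0)
    fun d _ hd h0 => hd (by rw [h0]; simp)]
  -- The summands for which `r - 2 * d` is truncated have coefficient zero.
  have key : ∀ d, twistCoeff r 0 d ≠ 0 → 2 * d ≤ r := fun d hd => by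
    by_contra hlt
    exact hd (twistCoeff_eq_zero _ _ _ (by omega))
  obtain ⟨M, z, h1, h2, h3⟩ := Extreme.exists_sum hε
    ((Finset.range (r + 1)).filter fun d => twistCoeff r 0 d ≠ 0)
    (p := fun d => (twistCoeff r 0 d : LaurentPolynomial ℤ) *
      T (-writhe E.1 * (((r - 2 * d : ℕ) : ℤ) * ((r - 2 * d : ℕ) - 1) - 6 * d)) *
        coloredBracket E.1 (r - 2 * d))
    (M := fun d => ((r - 2 * d : ℕ) : ℤ) ^ 2 * crossings D.1 +
      2 * (r - 2 * d : ℕ) * circuits (smoothing t D.1) + splitSign t *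
        (3 * r * writhe E.1 - writhe D.1 * (((r - 2 * d : ℕ) : ℤ) ^ 2 + 2 * (r - 2 * d : ℕ))))
    (a := fun d => (twistCoeff r 0 d : ℤ))
    -- The sign of the extreme coefficient depends only on the parity of the colour `r - 2 * d`, so
    -- it is that of the colour `r` for all summands.
    (σ := ((r * (writhe E.1 - writhe D.1) : ℤ).negOnePow : ℤ) *
      (-1) ^ (r * circuits (smoothing t D.1)))
    (by simp) (fun d hd => by
      have := (Finset.mem_filter.1 hd).2
      exact_mod_cast Nat.pos_of_ne_zero this)
    (fun d hd => by
      have hd := key d (Finset.mem_filter.1 hd).2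
      obtain ⟨j, rfl⟩ : ∃ j, r = j + 2 * d := ⟨r - 2 * d, by omega⟩
      rw [Nat.add_sub_cancel, coloredBracket_invariant hD hE, mul_assoc, mul_smul_comm,
        ← nsmul_eq_mul, ← natCast_zsmul, ← mul_assoc, ← T_add]
      have h := (((extreme_coloredBracket hadq t j).T_mul hε
        (-writhe E.1 * ((j : ℤ) * (j - 1) - 6 * d) +
          ((j : ℤ) ^ 2 + 2 * j) * (writhe E.1 - writhe D.1))).smul
        (((j * (writhe E.1 - writhe D.1) : ℤ).negOnePow : ℤ))).smul
          (twistCoeff (j + 2 * d) 0 d : ℤ)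
      have s1 : (((j + 2 * d : ℕ) : ℤ) * (writhe E.1 - writhe D.1)).negOnePow =
          ((j : ℤ) * (writhe E.1 - writhe D.1)).negOnePow := by
        rw [Nat.cast_add, add_mul, Int.negOnePow_add, Nat.cast_mul, Nat.cast_two, mul_assoc 2,
          Int.negOnePow_two_mul, mul_one]
      have s2 : ((-1 : ℤ)) ^ ((j + 2 * d) * circuits (smoothing t D.1)) =
          (-1) ^ (j * circuits (smoothing t D.1)) := by
        rw [add_mul, pow_add, mul_assoc 2, pow_mul _ 2]; simp
      rw [s1, s2]
      convert h using 1
      · push_cast; ring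
      · ring)
    -- The summand of the full colour `r` gives the lower bound; another one may reach further,
    -- hence only an inequality.
    (i₀ := 0) (by simp [twistCoeff_zero])
  exact ⟨M, z, h2, by simpa using h1, h3⟩

/-- The breadth of the Jones polynomial in terms of the bracket. -/
lemma breadth_jones {w : Word} (hw : Fits w 0 0) (h0 : w ≠ []) {a b z z' : ℤ} (hz : z ≠ 0)
    (hz' : z' ≠ 0) (h : Extreme 1 (fullBracket w) a z) (h' : Extreme (-1) (fullBracket w) b z') :
    breadth (jones w) = ((a + b - 4 : ℤ) : ℚ) / 4 := by
  rw [← loopValue_mul_bracket w hw h0] at h h'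
  have g : ∀ {ε M y : ℤ}, ε * ε = 1 → Extreme ε (bracket w) M y →
      Extreme ε (C ((writhe w).negOnePow : ℤ) * T (-3 * writhe w) * bracket w)
        (M + ε * (-3 * writhe w)) ((writhe w).negOnePow * y) := fun hε hM => by
    rw [mul_assoc, ← smul_eq_C_mul]
    exact (hM.T_mul hε _).smul _
  have e1 := g (by norm_num) (h.of_loopValue_mul (by norm_num) hz)
  have e2 := g (by norm_num) (h'.of_loopValue_mul (by norm_num) hz')
  rw [jones]
  set q := C ((writhe w).negOnePow : ℤ) * T (-3 * writhe w) * bracket w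
  have hu : ((writhe w).negOnePow : ℤ) ≠ 0 := by simp
  have n1 : q.coeff (a - 2 + 1 * (-3 * writhe w)) ≠ 0 := by
    have := e1.2
    rw [one_mul (_ + _)] at this
    rw [this]; exact mul_ne_zero hu (neg_ne_zero.2 hz)
  have n2 : q.coeff (-1 * (b - 2 + -1 * (-3 * writhe w))) ≠ 0 := by
    rw [e2.2]; exact mul_ne_zero hu (neg_ne_zero.2 hz')
  have hinj : Function.Injective fun k : ℤ => -(k : ℚ) / 4 := fun k l hkl => by
    simp only at hkl
    have : (k : ℚ) = l := by linarith
    exact_mod_cast this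
  have hsupp : (AddMonoidAlgebra.mapDomain (fun k : ℤ => -(k : ℚ) / 4) q).coeff.support =
      q.coeff.support.image fun k : ℤ => -(k : ℚ) / 4 := by
    rw [AddMonoidAlgebra.coeff_mapDomain]
    exact Finsupp.mapDomain_support_of_injective hinj _
  have m1 := Finset.mem_image_of_mem (fun k : ℤ => -(k : ℚ) / 4) (Finsupp.mem_support_iff.2 n1)
  have m2 := Finset.mem_image_of_mem (fun k : ℤ => -(k : ℚ) / 4) (Finsupp.mem_support_iff.2 n2)
  rw [← hsupp] at m1 m2
  rw [breadth, dif_pos ⟨_, m1⟩]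
  -- The exponent of `t` is `-k / 4`, so the smallest exponent of `t` comes from the largest
  -- exponent of `A`. Passing from `fullBracket` to `bracket` shortens each end by `2`, and the
  -- factor of the writhe shifts both ends alike.
  have hmin := (Finset.min'_eq_iff _ ⟨_, m1⟩ _).2 ⟨m1, fun x hx => by
    rw [hsupp] at hx
    obtain ⟨k, hk, rfl⟩ := Finset.mem_image.1 hx
    have : ¬ (a - 2 + 1 * (-3 * writhe w) < 1 * k) := fun hlt =>
      Finsupp.mem_support_iff.1 hk (e1.1 k hlt)
    have : k ≤ a - 2 + 1 * (-3 * writhe w) := by omega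
    have : (k : ℚ) ≤ ((a - 2 + 1 * (-3 * writhe w) : ℤ) : ℚ) := by exact_mod_cast this
    linarith⟩
  have hmax := (Finset.max'_eq_iff _ ⟨_, m1⟩ _).2 ⟨m2, fun x hx => by
    rw [hsupp] at hx
    obtain ⟨k, hk, rfl⟩ := Finset.mem_image.1 hx
    have : ¬ (b - 2 + -1 * (-3 * writhe w) < -1 * k) := fun hlt =>
      Finsupp.mem_support_iff.1 hk (e2.1 k hlt)
    have : -1 * (b - 2 + -1 * (-3 * writhe w)) ≤ k := by omega
    have : ((-1 * (b - 2 + -1 * (-3 * writhe w)) : ℤ) : ℚ) ≤ k := by exact_mod_cast this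
    linarith⟩
  rw [hmin, hmax]
  push_cast
  ring

lemma parallel_ne_nil (D : KnotDiagram) {r : ℕ} (hr : r ≠ 0) : parallel r D.1 ≠ [] := by
  obtain ⟨b, w, h, -⟩ := D.exists_cons
  rw [h]
  simp [parallel, parallelSlice, hr]

lemma cable_ne_nil (D : KnotDiagram) {r : ℕ} (hr : r ≠ 0) : cable r D.1 ≠ [] := by
  obtain ⟨b, w, h, -⟩ := D.exists_cons
  rw [cable, h]
  simp [parallel, parallelSlice, hr]

lemma fits_cable_knot (D : KnotDiagram) (r : ℕ) : Fits (cable r D.1) 0 0 := by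
  obtain ⟨b, w, h1, h2⟩ := D.exists_cons
  have h := fits_cable r (-writhe D.1) h2
  have h5 : cable r D.1 = parallel r [⟨.cup b, 0⟩] ++ fullTwists r (-writhe D.1) ++ parallel r w := by
    rw [cable]; congr 2 <;> rw [h1] <;> rfl
  rwa [h5]

lemma parallel_zero (w : Word) : parallel 0 w = [] := by
  rw [parallel, List.flatMap_eq_nil_iff]
  rintro ⟨_ | _ | _, i⟩ _ <;> rfl

lemma cable_zero (w : Word) : cable 0 w = [] := by
  simp [cable, parallel_zero, fullTwists]

end Extreme
end SlicedLink

theorem mainTheorem6 (K : SlicedLink.Knot)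
    (D : SlicedLink.KnotDiagram) (hD : SlicedLink.IsDiagramOf D K) (hadq : SlicedLink.Adequate D.1)
    (E : SlicedLink.KnotDiagram) (hE : SlicedLink.IsDiagramOf E K) (r : ℕ) :
    SlicedLink.breadth (SlicedLink.jones (SlicedLink.cable r E.1)) ≥
      SlicedLink.breadth (SlicedLink.jones (SlicedLink.parallel r D.1)) := by
  rcases eq_or_ne r 0 with rfl | hr
  -- For `r = 0` both words are empty; the other case divides by the loop value and needs nonempty
  -- words.
  · rw [SlicedLink.cable_zero, SlicedLink.parallel_zero]
  obtain ⟨a, z, hz, ha, h1⟩ := SlicedLink.extreme_cable hD hE hadq true r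
  obtain ⟨b, z', hz', hb, h2⟩ := SlicedLink.extreme_cable hD hE hadq false r
  rw [SlicedLink.breadth_jones (SlicedLink.fits_cable_knot E r) (SlicedLink.cable_ne_nil E hr)
      hz hz' h1 h2,
    SlicedLink.breadth_jones (SlicedLink.fits_parallel r _ 0 0 D.fits)
      (SlicedLink.parallel_ne_nil D hr) (by simp) (by simp)
      (SlicedLink.extreme_parallel hadq true r) (SlicedLink.extreme_parallel hadq false r)]
  simp only [SlicedLink.splitSign, if_true, Bool.false_eq_true, if_false] at ha hb
  refine div_le_div_of_nonneg_right (Int.cast_le.2 ?_) (by norm_num)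
  -- The shifts by the writhes in `ha` and `hb` have opposite signs and cancel in the sum.
  linarith
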